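/- **Setting.** Let $\mathcal M=(\mathcal S,\mathcal A,r,c,P,\rho)$ be a CMDP with finite $\mathcal S,\mathcal A$, reward $r\in[0,1]$, constraint cost $c\in[-1,1]$, transition kernel $P$ and initial law $\rho$. For a policy $\pi:\mathcal S\to\Delta(\mathcal A)$ and $g\in\{r,c\}$ let $J_g^\pi=\lim_{N\to\infty}\frac1N\mathbb E_\pi[\sum_{t<N}g(s_t,a_t)\mid s_0\sim\rho]$, let $Q_g^\pi(s,a)=\sum_{t\ge0}(\mathbb E_\pi[g(s_t,a_t)\mid s_0=s,a_0=a]-J_g^\pi)$, $V_g^\pi(s)=\sum_a\pi(a|s)Q_g^\pi(s,a)$, $A_g^\pi=Q_g^\pi-V_g^\pi$, let $d^\pi$ be the stationary law of the induced chain $P^\pi$, and $\nu^\pi(s,a)=d^\pi(s)\pi(a|s)$. Let $\pi^*$ maximize $J_r^\pi$ over all policies with $J_c^\pi\ge0$. Let $\{\pi_\theta\}_{\theta\in\mathbb R^d}$ be a policy class, $J_g(\theta)=J_g^{\pi_\theta}$, $F(\theta)=\mathbb E_{\nu^{\pi_\theta}}[\nabla_\theta\log\pi_\theta(a|s)\nabla_\theta\log\pi_\theta(a|s)^\top]$,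 and let $\tau_{\rm mix}=\sup_\theta\min\{t\ge1:\ \|(P^{\pi_\theta})^t(s,\cdot)-d^{\pi_\theta}\|_{TV}\le\frac14\ \forall s\}$. Let $\phi_g:\mathcal S\to\mathbb R^m$ be features with $\|\phi_g\|\le1$. For a transition $z=(s,a,s')$ put $$\mathbf A_g(z)=\begin{pmatrix}c_\gamma&0\\ \phi_g(s)&\phi_g(s)(\phi_g(s)-\phi_g(s'))^\top\end{pmatrix},\qquad \mathbf b_g(z)=\begin{pmatrix}c_\gamma g(s,a)\\ g(s,a)\phi_g(s)\end{pmatrix};$$ let $\mathbb E_\theta$ be the expectation for $(s,a)\sim\nu^{\pi_\theta}$, $s'\sim P(\cdot|s,a)$, and $[\eta_g^*(\theta),\zeta_g^*(\theta)]=(\mathbb E_\theta\mathbf A_g)^{-1}\mathbb E_\theta\mathbf b_g$. **Assumptions.** (1) $J_c(\bar\theta)\ge\delta$ for some $\bar\theta$, where $\delta\in(0,1)$. (2) Under every policy the state chain is irreducible and aperiodic. (3) $\epsilon_{\rm app}=\max_{g}\sup_\theta\mathbb E_{s\sim d^{\pi_\theta}}[(\zeta_g^*(\theta)^\top\phi_g(s)-V_g^{\pi_\theta}(s))^2]<\infty$.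 (4) For some $\lambda>0$, $x^\top\mathbb E_\theta[\phi_g(s)(\phi_g(s)-\phi_g(s'))^\top]x\ge\lambda\|x\|^2$ for all $x,\theta,g$; and $c_\gamma\ge\lambda+\sqrt{\max(\lambda^{-2}-1,0)}$. (5) With $L_\nu(\omega,\theta,l)=\mathbb E_\nu[(\nabla_\theta\log\pi_\theta(a|s)\cdot\omega-A_r^{\pi_\theta}(s,a)-l\,A_c^{\pi_\theta}(s,a))^2]$ and $\omega^*_{\theta,l}=\arg\min_\omega L_{\nu^{\pi_\theta}}(\omega,\theta,l)$, one has $L_{\nu^{\pi^*}}(\omega^*_{\theta,l},\theta,l)\le\epsilon_{\rm bias}$ for all $\theta$ and $l\in[0,2/\delta]$. (6) $\pi_\theta(a|s)>0$, $\log\pi_\theta(a|s)$ is differentiable in $\theta$, and its gradient is bounded by $G_1>0$ and $G_2$-Lipschitz, $G_2>0$. (7) $F(\theta)-\mu I$ is positive semidefinite for all $\theta$, where $\mu>0$. **Algorithm (PDNAC).** Start from $\theta_0$, $\lambda_0=0$ and a state $s_0\sim\rho$; all samples come from one trajectory that is continued throughout. A multi-level estimate of a function $v(z)$ of a transition under $\pi_\theta$: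 draw $q$ with $\Pr(q=j)=2^{-j}$, $j\ge1$; run $\pi_\theta$ from the current state for $2^q$ steps if $2^q\le T_{\max}$ and for one step otherwise, giving transitions $z_0,z_1,\dots$; with $v^j=2^{-j}\sum_{t<2^j}v(z_t)$ return $v^0+2^q(v^q-v^{q-1})\mathbf 1(2^q\le T_{\max})$. In epoch $k=0,\dots,K-1$: (critic) from $\xi_g=[\eta_g,\zeta_g]=0$ do $H$ times $\xi_g\leftarrow\xi_g-\gamma_\xi\hat v_g$, with $\hat v_g$ the multi-level estimate of $\mathbf A_g(z)\xi_g-\mathbf b_g(z)$ under $\pi_{\theta_k}$; (actor) from $\omega_g=0$ do $H$ times $\omega_g\leftarrow\omega_g-\gamma_\omega\hat u_g$, with $\hat u_g$ the multi-level estimate of $\psi\psi^\top\omega_g-[g(s,a)-\eta_g+\zeta_g^\top(\phi_g(s')-\phi_g(s))]\psi$, $\psi=\nabla_\theta\log\pi_{\theta_k}(a|s)$ (both $g$ use the same samples); then $\theta_{k+1}=\theta_k+\alpha(\omega_r+\lambda_k\omega_c)$ and $\lambda_{k+1}=\mathcal P_{[0,2/\delta]}[\lambda_k-\beta\eta_c]$.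 **Theorem.** For a horizon $T\ge2$ take $\alpha=\beta=T^{-1/2}$, $T_{\max}=T$, $\gamma_\xi=\frac{2\log T}{\lambda H}$, $\gamma_\omega=\frac{2\log T}{\mu H}$, $K=\lfloor T/H\rfloor$ and $H=\tilde\Theta(\tau_{\rm mix}^2)$, that is $c_0\tau_{\rm mix}^2\log^2T\le H\le c_1\tau_{\rm mix}^2\log^{q}T$. For every $q$ there is an exponent $p$ depending only on $q$, there is a constant $c_0>0$ depending only on $q,G_1,G_2,\mu,\lambda,c_\gamma,\delta$, and for all $c_1$, $D$ and every value of $\tau_{\rm mix}$ there is a constant $C$ depending only on these quantities, $c_1$, $D$ and $\tau_{\rm mix}$, such that, whenever $\mathbb E_{s\sim d^{\pi^*}}[KL(\pi^*(\cdot|s)\|\pi_{\theta_0}(\cdot|s))]\le D$, the step sizes satisfy $$\gamma_\xi\le\frac{\lambda}{24c_\gamma^2\tau_{\rm mix}\log T_{\max}},\qquad \gamma_\omega\le\frac{\mu}{4(6G_1^4\tau_{\rm mix}\log T_{\max}+2G_1^2\tau_{\rm mix}^2\log T_{\max})},$$ and $$\frac1K\sum_{k=0}^{K-1}\mathbb E[J_r^{\pi^*}-J_r(\theta_k)]\le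 C(\log T)^p\Big(\sqrt{\epsilon_{\rm bias}}+\sqrt{\epsilon_{\rm app}}+\frac1{\sqrt T}\Big),$$ $$\frac1K\sum_{k=0}^{K-1}\mathbb E[-J_c(\theta_k)]\le C(\log T)^p\Big(\sqrt{\epsilon_{\rm bias}}+\sqrt{\epsilon_{\rm app}}+\frac1{\sqrt T}\Big)$$ (for $K=0$ the averages are read as $0$). -/

import Mathlib

open scoped BigOperators

noncomputable section

namespace PDNAC

/-- The probability that `p` gives to `x`, as a real number. -/
def prob {X : Type*} (p : PMF X) (x : X) : ℝ := (p x).toReal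

/-- The expectation of a real function under a discrete law. -/
def expect {X : Type*} (p : PMF X) (f : X → ℝ) : ℝ := ∑' x, prob p x * f x

/-- The two signals `r` (reward) and `c` (constraint cost). -/
inductive Sig where
  | r
  | c

/-- A finite constrained Markov decision process. -/
structure CMDP (S A : Type*) where
  r : S → A → ℝ
  c : S → A → ℝ
  r_mem : ∀ s a, r s a ∈ Set.Icc (0 : ℝ) 1
  c_mem : ∀ s a, c s a ∈ Set.Icc (-1 : ℝ) 1
  P : S → A → PMF S
  ρ : PMF S

/-- A (stationary, randomized) policy. -/
abbrev Policy (S A : Type*) := S → PMF A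

/-- The parameter space `ℝ^n` with its Euclidean norm. -/
abbrev E (n : ℕ) := EuclideanSpace ℝ (Fin n)

section Model

variable {S A : Type*} [Fintype S] [DecidableEq S] [Fintype A]

def CMDP.sig (M : CMDP S A) : Sig → S → A → ℝ
  | .r => M.r
  | .c => M.c

/-- The state transition matrix `P^π(s,s') = ∑ₐ π(a|s) P(s'|s,a)`. -/
def CMDP.trans (M : CMDP S A) (π : Policy S A) : Matrix S S ℝ :=
  Matrix.of fun s s' => ∑ a, prob (π s) a * prob (M.P s a) s'

/-- No common period: for every state `s` the gcd of the possible return times is one. -/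
def Aperiodic (Q : Matrix S S ℝ) : Prop :=
  ∀ s, ∀ k : ℕ, (∀ n : ℕ, 1 ≤ n → 0 < (Q ^ n) s s → k ∣ n) → k = 1

/-- Under every policy the induced state chain is irreducible and aperiodic. -/
def CMDP.Ergodic (M : CMDP S A) : Prop :=
  ∀ π : Policy S A, (M.trans π).IsIrreducible ∧ Aperiodic (M.trans π)

/-- `𝔼_π[g(s_t,a_t) | s_0 = s]`. -/
def CMDP.meanAt (M : CMDP S A) (π : Policy S A) (g : Sig) (t : ℕ) (s : S) : ℝ :=
  ∑ s', (M.trans π ^ t) s s' * ∑ a, prob (π s') a * M.sig g s' a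

/-- The long-run average `J_g^π = lim_T (1/T) 𝔼_π[∑_{t<T} g(s_t,a_t) | s_0 ∼ ρ]`. -/
def CMDP.J (M : CMDP S A) (g : Sig) (π : Policy S A) : ℝ :=
  Filter.limUnder Filter.atTop fun T : ℕ =>
    (1 / (T : ℝ)) * ∑ t ∈ Finset.range T, ∑ s, prob M.ρ s * M.meanAt π g t s

/-- `D` is a stationary probability vector of the chain induced by `π`. -/
def CMDP.IsStationary (M : CMDP S A) (π : Policy S A) (D : S → ℝ) : Prop :=
  (∀ s, 0 ≤ D s) ∧ ∑ s, D s = 1 ∧ ∀ s', ∑ s, D s * M.trans π s s' = D s'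

/-- The stationary distribution `d^π` (unique for an ergodic CMDP). -/
def CMDP.statDist (M : CMDP S A) (π : Policy S A) : S → ℝ :=
  Classical.epsilon (M.IsStationary π)

/-- The occupancy measure `ν^π(s,a) = d^π(s) π(a|s)`. -/
def CMDP.occ (M : CMDP S A) (π : Policy S A) (s : S) (a : A) : ℝ :=
  M.statDist π s * prob (π s) a

/-- The mixing time of one policy: the first `t ≥ 1` at which the total variation distance
to `d^π` is at most `1/4` from every starting state. -/
def CMDP.mixTime (M : CMDP S A) (π : Policy S A) : ℕ :=
  sInf {t : ℕ | 1 ≤ t ∧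
    ∀ s, (1 / 2 : ℝ) * ∑ s', |(M.trans π ^ t) s s' - M.statDist π s'| ≤ 1 / 4}

/-- `𝔼_π[g(s_t,a_t) | s_0 = s, a_0 = a]`. -/
def CMDP.meanAtSA (M : CMDP S A) (π : Policy S A) (g : Sig) : ℕ → S → A → ℝ
  | 0, s, a => M.sig g s a
  | t + 1, s, a => ∑ s', prob (M.P s a) s' * M.meanAt π g t s'

def CMDP.Q (M : CMDP S A) (g : Sig) (π : Policy S A) (s : S) (a : A) : ℝ :=
  ∑' t : ℕ, (M.meanAtSA π g t s a - M.J g π)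

def CMDP.V (M : CMDP S A) (g : Sig) (π : Policy S A) (s : S) : ℝ :=
  ∑ a, prob (π s) a * M.Q g π s a

def CMDP.Adv (M : CMDP S A) (g : Sig) (π : Policy S A) (s : S) (a : A) : ℝ :=
  M.Q g π s a - M.V g π s

/-- `πs` solves `max_π J_r^π` subject to `J_c^π ≥ 0` over all policies. -/
def CMDP.IsOptimal (M : CMDP S A) (πs : Policy S A) : Prop :=
  0 ≤ M.J .c πs ∧ ∀ π : Policy S A, 0 ≤ M.J .c π → M.J .r π ≤ M.J .r πs

/-- `𝔼_{s ∼ d^{πs}} KL(πs(·|s) ‖ π(·|s))`. -/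
def CMDP.klFrom (M : CMDP S A) (πs π : Policy S A) : ℝ :=
  ∑ s, M.statDist πs s *
    ∑ a, prob (πs s) a * Real.log (prob (πs s) a / prob (π s) a)

end Model

section Parametrized

variable {S A : Type*} [Fintype S] [DecidableEq S] [Fintype A] {d m : ℕ}

/-- The overall mixing time of the parametrized class. -/
def tauMix (M : CMDP S A) (π : E d → Policy S A) : ℕ := ⨆ θ, M.mixTime (π θ)

/-- The score `∇_θ log π_θ(a|s)`. -/
def score (π : E d → Policy S A) (θ : E d) (s : S) (a : A) : E d :=
  gradient (fun θ' => Real.log (prob (π θ' s) a)) θ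

/-- The Fisher information matrix. -/
def fisher (M : CMDP S A) (π : E d → Policy S A) (θ : E d) : Matrix (Fin d) (Fin d) ℝ :=
  ∑ s, ∑ a, M.occ (π θ) s a • Matrix.vecMulVec (score π θ s a) (score π θ s a)

/-- The compatible function approximation error `L_ν(ω,θ,l)`. -/
def compErr (M : CMDP S A) (π : E d → Policy S A) (ν : S → A → ℝ) (ω θ : E d) (l : ℝ) : ℝ :=
  ∑ s, ∑ a, ν s a *
    (inner ℝ (score π θ s a) ω - M.Adv .r (π θ) s a - l * M.Adv .c (π θ) s a) ^ 2

/-- Critic vectors `ξ = [η, ζ]`: the coordinate `inl ()` is `η`, the coordinates `inr i`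
form `ζ`. -/
abbrev Critic (m : ℕ) := Unit ⊕ Fin m → ℝ

/-- `𝐀_g(θ; z)` at a transition `z = (s, a, s')`. -/
def critA (φ : Sig → S → E m) (cγ : ℝ) (g : Sig) (z : S × A × S) :
    Matrix (Unit ⊕ Fin m) (Unit ⊕ Fin m) ℝ :=
  Matrix.fromBlocks
    (Matrix.of fun _ _ => cγ) 0
    (Matrix.of fun i _ => φ g z.1 i)
    (Matrix.of fun i j => φ g z.1 i * (φ g z.1 j - φ g z.2.2 j))

/-- `𝐛_g(θ; z)` at a transition `z = (s, a, s')`. -/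
def critb (M : CMDP S A) (φ : Sig → S → E m) (cγ : ℝ) (g : Sig) (z : S × A × S) : Critic m :=
  Sum.elim (fun _ => cγ * M.sig g z.1 z.2.1) (fun i => M.sig g z.1 z.2.1 * φ g z.1 i)

/-- `𝔼_θ[f(z)]` for `z = (s,a,s')` with `(s,a) ∼ ν^{π_θ}` and `s' ∼ P(s,a)`. -/
def meanZ {X : Type*} [AddCommMonoid X] [Module ℝ X] (M : CMDP S A) (π : E d → Policy S A)
    (θ : E d) (f : S × A × S → X) : X :=
  ∑ s, ∑ a, ∑ s', (M.occ (π θ) s a * prob (M.P s a) s') • f (s, a, s')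

/-- `ξ_g^*(θ) = 𝐀_g(θ)⁻¹ 𝐛_g(θ)`. -/
def xiStar (M : CMDP S A) (π : E d → Policy S A) (φ : Sig → S → E m) (cγ : ℝ) (g : Sig)
    (θ : E d) : Critic m :=
  Matrix.mulVec (meanZ M π θ (critA φ cγ g))⁻¹ (meanZ M π θ (critb M φ cγ g))

/-- `𝔼_{s ∼ d^{π_θ}} [ζ_g^*(θ)ᵀ φ_g(s) - V_g^{π_θ}(s)]²`. -/
def critErr (M : CMDP S A) (π : E d → Policy S A) (φ : Sig → S → E m) (cγ : ℝ) (g : Sig)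
    (θ : E d) : ℝ :=
  ∑ s, M.statDist (π θ) s *
    (∑ i, xiStar M π φ cγ g θ (Sum.inr i) * φ g s i - M.V g (π θ) s) ^ 2

/-- The worst-case critic approximation error `ε_app`. -/
def epsApp (M : CMDP S A) (π : E d → Policy S A) (φ : Sig → S → E m) (cγ : ℝ) : ℝ :=
  max (⨆ θ, critErr M π φ cγ .r θ) (⨆ θ, critErr M π φ cγ .c θ)

/-- Slater condition with parameter `δ`. -/
def Slater (M : CMDP S A) (π : E d → Policy S A) (δ : ℝ) : Prop :=
  ∃ θ, δ ≤ M.J .c (π θ)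

/-- The worst-case critic approximation error is finite. -/
def CriticErrFinite (M : CMDP S A) (π : E d → Policy S A) (φ : Sig → S → E m) (cγ : ℝ) : Prop :=
  ∀ g, BddAbove (Set.range (critErr M π φ cγ g))

/-- `𝔼_θ[φ_g(s)(φ_g(s)-φ_g(s'))ᵀ] - lam I` is positive semi-definite, in the sense of the
quadratic form (the matrix need not be symmetric). -/
def CriticPosDef (M : CMDP S A) (π : E d → Policy S A) (φ : Sig → S → E m) (lam : ℝ) : Prop :=
  ∀ (g : Sig) (θ : E d) (x : E m), lam * ‖x‖ ^ 2 ≤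
    meanZ M π θ fun z => inner ℝ x (φ g z.1) * inner ℝ (φ g z.1 - φ g z.2.2) x

/-- The transferred compatible function approximation error is at most `εbias`. -/
def BiasBound (M : CMDP S A) (π : E d → Policy S A) (πs : Policy S A) (δ εbias : ℝ) : Prop :=
  ∀ (θ : E d) (l : ℝ), l ∈ Set.Icc 0 (2 / δ) → ∀ ω : E d,
    (∀ ω', compErr M π (M.occ (π θ)) ω θ l ≤ compErr M π (M.occ (π θ)) ω' θ l) →
      compErr M π (M.occ πs) ω θ l ≤ εbias

/-- The score exists everywhere, is bounded by `G₁` and `G₂`-Lipschitz. -/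
structure ScoreBounds (π : E d → Policy S A) (G₁ G₂ : ℝ) : Prop where
  pos : ∀ θ s a, 0 < prob (π θ s) a
  diff : ∀ s a, Differentiable ℝ fun θ => Real.log (prob (π θ s) a)
  bound : ∀ θ s a, ‖score π θ s a‖ ≤ G₁
  lip : ∀ θ₁ θ₂ s a, ‖score π θ₁ s a - score π θ₂ s a‖ ≤ G₂ * ‖θ₁ - θ₂‖

/-- Fisher non-degeneracy. -/
def FisherNonDeg (M : CMDP S A) (π : E d → Policy S A) (μ : ℝ) : Prop :=
  ∀ θ, (fisher M π θ - μ • (1 : Matrix (Fin d) (Fin d) ℝ)).PosSemidef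

end Parametrized

section Algorithm

/-- The geometric law with parameter `1/2` on `{1, 2, 3, …}`: `j` has probability `2^{-j}`. -/
def geomHalf : PMF ℕ :=
  ⟨fun j => if j = 0 then 0 else (2⁻¹ : ENNReal) ^ j, by
    have h : ∑' j : ℕ, (if j = 0 then 0 else (2⁻¹ : ENNReal) ^ j) = 1 := by
      rw [tsum_eq_zero_add' ENNReal.summable]
      simp [ENNReal.tsum_geometric_add_one, ENNReal.one_sub_inv_two, ENNReal.inv_mul_cancel]
    exact h ▸ ENNReal.summable.hasSum⟩

/-- `n` successive draws of a Markov kernel. -/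
def iterLaw {X : Type*} (step : X → PMF X) : ℕ → X → PMF X
  | 0, x => PMF.pure x
  | n + 1, x => (iterLaw step n x).bind step

variable {S A : Type*} {d m : ℕ}

/-- The list of the first `n` transitions `(s_t, a_t, s_{t+1})` of a `π`-induced trajectory
that starts at a given state. -/
def rollout (M : CMDP S A) (π : Policy S A) : ℕ → S → PMF (List (S × A × S))
  | 0, _ => PMF.pure []
  | n + 1, s => (π s).bind fun a => (M.P s a).bind fun s' =>
      (rollout M π n s').map fun zs => (s, a, s') :: zs

/-- The state in which a trajectory from `s` ends. -/
def finalState (s : S) (zs : List (S × A × S)) : S :=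
  (zs.getLast?.map fun z => z.2.2).getD s

/-- `2^{-j} ∑_{t < 2^j} v(z_t)`. -/
def levelAvg {X : Type*} [AddCommGroup X] [Module ℝ X] (v : S × A × S → X)
    (zs : List (S × A × S)) (j : ℕ) : X :=
  ((2 : ℝ) ^ j)⁻¹ • ((zs.take (2 ^ j)).map v).sum

/-- The multi-level Monte Carlo estimate with level `q`. -/
def mlmc {X : Type*} [AddCommGroup X] [Module ℝ X] (Tmax : ℕ) (v : S × A × S → X)
    (zs : List (S × A × S)) (q : ℕ) : X :=
  levelAvg v zs 0 +
    if 2 ^ q ≤ Tmax then (2 : ℝ) ^ q • (levelAvg v zs q - levelAvg v zs (q - 1)) else 0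

/-- The trajectory length `(2^q - 1) 𝟏(2^q ≤ Tmax) + 1`. -/
def trajLen (Tmax q : ℕ) : ℕ := (if 2 ^ q ≤ Tmax then 2 ^ q - 1 else 0) + 1

/-- The parameters of the algorithm. -/
structure Params where
  α : ℝ
  β : ℝ
  γω : ℝ
  γξ : ℝ
  cγ : ℝ
  δ : ℝ
  H : ℕ
  Tmax : ℕ

/-- One step of the critic subroutine, on pairs (current state, `(ξ_r, ξ_c)`). -/
def criticStep (M : CMDP S A) (π : E d → Policy S A) (φ : Sig → S → E m) (p : Params)
    (θ : E d) (x : S × (Sig → Critic m)) : PMF (S × (Sig → Critic m)) :=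
  geomHalf.bind fun q => (rollout M (π θ) (trajLen p.Tmax q) x.1).map fun zs =>
    (finalState x.1 zs, fun g => x.2 g - p.γξ •
      mlmc p.Tmax (fun z => Matrix.mulVec (critA φ p.cγ g z) (x.2 g) - critb M φ p.cγ g z) zs q)

/-- The advantage estimate (temporal difference error) `Â_g(ξ; z)`. -/
def advEst (M : CMDP S A) (φ : Sig → S → E m) (g : Sig) (ξ : Critic m) (z : S × A × S) : ℝ :=
  M.sig g z.1 z.2.1 - ξ (Sum.inl ()) + ∑ i, ξ (Sum.inr i) * (φ g z.2.2 i - φ g z.1 i)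

/-- The one-sample estimate of the gradient of `f_g(θ, ·)` at `ω`. -/
def npgGrad (M : CMDP S A) (π : E d → Policy S A) (φ : Sig → S → E m) (θ : E d) (g : Sig)
    (ξ : Critic m) (ω : E d) (z : S × A × S) : E d :=
  inner ℝ (score π θ z.1 z.2.1) ω • score π θ z.1 z.2.1
    - advEst M φ g ξ z • score π θ z.1 z.2.1

/-- One step of the actor subroutine, on pairs (current state, `(ω_r, ω_c)`). -/
def actorStep (M : CMDP S A) (π : E d → Policy S A) (φ : Sig → S → E m) (p : Params)
    (θ : E d) (ξ : Sig → Critic m) (x : S × (Sig → E d)) : PMF (S × (Sig → E d)) :=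
  geomHalf.bind fun q => (rollout M (π θ) (trajLen p.Tmax q) x.1).map fun zs =>
    (finalState x.1 zs, fun g => x.2 g - p.γω •
      mlmc p.Tmax (npgGrad M π φ θ g (ξ g) (x.2 g)) zs q)

/-- What the algorithm carries from one epoch to the next. -/
structure AlgState (S : Type*) (d : ℕ) where
  state : S
  θ : E d
  lam : ℝ

/-- One epoch: critic subroutine, actor subroutine, then the primal and dual updates. -/
def epoch (M : CMDP S A) (π : E d → Policy S A) (φ : Sig → S → E m) (p : Params)
    (x : AlgState S d) : PMF (AlgState S d) :=
  (iterLaw (criticStep M π φ p x.θ) p.H (x.state, 0)).bind fun y =>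
    (iterLaw (actorStep M π φ p x.θ y.2) p.H (y.1, 0)).map fun w =>
      { state := w.1
        θ := x.θ + p.α • (w.2 .r + x.lam • w.2 .c)
        lam := max 0 (min (2 / p.δ) (x.lam - p.β * y.2 .c (Sum.inl ()))) }

/-- The joint law of the environment state and of `(θ_k, λ_k)` at the start of epoch `k`, from
`s_0 ∼ ρ`, the initial parameter `θ₀`, and `λ_0 = 0`. -/
def algLaw (M : CMDP S A) (π : E d → Policy S A) (φ : Sig → S → E m) (p : Params) (θ₀ : E d)
    (k : ℕ) : PMF (AlgState S d) :=
  M.ρ.bind fun s => iterLaw (epoch M π φ p) k ⟨s, θ₀, 0⟩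

/-- The parameters for horizon `T` and inner loop size `H`:
`α = β = T^{-1/2}`, `γ_ω = 2 log T / (μ H)`, `γ_ξ = 2 log T / (lam H)`, `T_max = T`. -/
def horizonParams (μ lam cγ δ : ℝ) (T H : ℕ) : Params where
  α := (T : ℝ) ^ (-(1 / 2) : ℝ)
  β := (T : ℝ) ^ (-(1 / 2) : ℝ)
  γω := 2 * Real.log T / (μ * H)
  γξ := 2 * Real.log T / (lam * H)
  cγ := cγ
  δ := δ
  H := H
  Tmax := T

end Algorithm

end PDNAC

end

open PDNAC

open scoped BigOperators

noncomputable section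

namespace PDNAC

set_option linter.unusedSectionVars false

/-! ### Expectations under finitely supported laws -/

section FiniteSupport

variable {X Y : Type*} {V W : Type*} [NormedAddCommGroup V] [NormedSpace ℝ V]
  [NormedAddCommGroup W] [NormedSpace ℝ W]

/-! The argument is a drift estimate for the potential `klFrom πs (π θ_k) + (λ_k - l₀)² / 2`, where
`l₀` is a fixed number in `[0, 2/δ]`. Since the score is Lipschitz, the divergence changes by `-α`
times an inner product with the actor output, up to a term of order `α²`. The performance difference
identity (`sum_occ_adv`) and the bias assumption show that the exact natural gradient direction
gains the Lagrangian advantage up to `√εbias` (`npg_gain`). Adding the drift of the projected dual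
step cancels the terms `λ_k J_c(θ_k)`, and `J_c(πs) ≥ 0` disposes of what remains of `λ_k`. Hence
the potential falls in expectation by `α (J_r(πs) - J_r(θ_k) - l₀ J_c(θ_k))` up to small errors
(`potential_drift`). Summing over epochs and using that the potential is nonnegative bounds the
average Lagrangian gap (`lagrangian_regret`); the initial potential contributes a multiple of
`1/(αK)`, of order `H/√T`.

Both drifts are linear in the outputs of the inner loops up to second order terms. So the second
moments of these outputs only have to be bounded, while their means, conditional on the start of the
epoch, have to be accurate to `√ε_app + 1/√T`. Both properties follow from one analysis of
stochastic approximation with an affine, coercive mean field (`sa_affine_bounds`). The second moment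
obeys a contracting recursion because the step is small. The mean obeys a recursion without noise,
driven only by the bias of the gradient estimates. The multi-level estimate has the bias of an
average over about `T` samples, of order `τ/T`, and a second moment of order `τ log T`
(`norm_ev_mlmc_sub_le`, `ev_norm_mlmc_sq_le`). These two rest on the fact that the chain halves
centred functions every mixing time.

The choice `l₀ = 0` gives the optimality gap. For the violation, occupancy measures form a convex
set, so strong duality holds with a multiplier `l ≤ 1/δ` (`exists_multiplier`). Then `J_r(πs) - J_r
≥ l J_c` for every policy, and the regret against `l₀ = 2/δ` controls `(2/δ - l)(-J_c)`, whose
factor is at least one. -/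

/-- The law `p` has finite support. -/
def FinSupp (p : PMF X) : Prop := p.support.Finite

/-- The support of a finitely supported law, as a finset. -/
def FinSupp.finset {p : PMF X} (h : FinSupp p) : Finset X := Set.Finite.toFinset h

theorem FinSupp.mem_finset {p : PMF X} (h : FinSupp p) {x : X} :
    x ∈ h.finset ↔ x ∈ p.support :=
  Set.Finite.mem_toFinset h

theorem FinSupp.support_subset {p : PMF X} (h : FinSupp p) : p.support ⊆ h.finset :=
  fun _ hx => h.mem_finset.2 hx

/-- The expectation of a vector valued function under a discrete law. -/
def ev (p : PMF X) (f : X → V) : V := ∑' x, prob p x • f x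

theorem prob_nonneg (p : PMF X) (x : X) : 0 ≤ prob p x := ENNReal.toReal_nonneg

theorem prob_eq_zero {p : PMF X} {x : X} (h : x ∉ p.support) : prob p x = 0 := by
  have : p x = 0 := by simpa [PMF.mem_support_iff] using h
  simp [prob, this]

theorem ev_eq_sum {p : PMF X} {t : Finset X} (ht : p.support ⊆ t) (f : X → V) :
    ev p f = ∑ x ∈ t, prob p x • f x :=
  tsum_eq_sum fun x hx => by rw [prob_eq_zero fun h => hx (ht h), zero_smul]

theorem ev_eq_sum_univ [Fintype X] (p : PMF X) (f : X → V) :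
    ev p f = ∑ x, prob p x • f x :=
  ev_eq_sum (by simp) f

theorem FinSupp.ev_eq {p : PMF X} (h : FinSupp p) (f : X → V) :
    ev p f = ∑ x ∈ h.finset, prob p x • f x :=
  ev_eq_sum h.support_subset f

theorem sum_prob_of_subset {p : PMF X} {t : Finset X} (ht : p.support ⊆ t) :
    ∑ x ∈ t, prob p x = 1 := by
  unfold prob
  rw [← ENNReal.toReal_sum fun x _ => p.apply_ne_top x,
    ← tsum_eq_sum (L := .unconditional X) fun x hx => ?_, p.tsum_coe, ENNReal.toReal_one]
  by_contra h
  exact hx (ht ((p.mem_support_iff x).2 h))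

theorem sum_prob [Fintype X] (p : PMF X) : ∑ x, prob p x = 1 :=
  sum_prob_of_subset (by simp)

theorem finSupp_of_finite [Finite X] (p : PMF X) : FinSupp p := Set.toFinite _

theorem finSupp_pure (x : X) : FinSupp (PMF.pure x) := by
  simp [FinSupp, PMF.support_pure]

theorem FinSupp.bind {p : PMF X} (hp : FinSupp p) {k : X → PMF Y} (hk : ∀ x, FinSupp (k x)) :
    FinSupp (p.bind k) := by
  rw [FinSupp, PMF.support_bind]
  exact hp.biUnion fun x _ => hk x

theorem FinSupp.map {p : PMF X} (hp : FinSupp p) (f : X → Y) : FinSupp (p.map f) := by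
  rw [FinSupp, PMF.support_map]
  exact hp.image f

theorem finSupp_iterLaw {step : X → PMF X} (h : ∀ x, FinSupp (step x)) (n : ℕ) (x : X) :
    FinSupp (iterLaw step n x) := by
  induction n with
  | zero => exact finSupp_pure x
  | succ n ih => exact ih.bind h

theorem prob_pure [DecidableEq X] (x y : X) :
    prob (PMF.pure x) y = if y = x then 1 else 0 := by
  unfold prob; rw [PMF.pure_apply]; split_ifs <;> simp

theorem ev_pure (x : X) (f : X → V) : ev (PMF.pure x) f = f x := by
  classical
  rw [ev_eq_sum (t := {x}) (by simp [PMF.support_pure])]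
  simp [prob_pure]

theorem prob_bind {p : PMF X} {t : Finset X} (ht : p.support ⊆ t) (k : X → PMF Y) (y : Y) :
    prob (p.bind k) y = ∑ x ∈ t, prob p x * prob (k x) y := by
  unfold prob
  rw [PMF.bind_apply, tsum_eq_sum (s := t), ENNReal.toReal_sum]
  · simp [ENNReal.toReal_mul]
  · exact fun x _ => ENNReal.mul_ne_top (p.apply_ne_top x) ((k x).apply_ne_top y)
  · intro x hx
    have : p x = 0 := by
      by_contra h
      exact hx (ht ((p.mem_support_iff x).2 h))
    simp [this]

theorem FinSupp.ev_bind {p : PMF X} (hp : FinSupp p) {k : X → PMF Y} (hk : ∀ x, FinSupp (k x))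
    (f : Y → V) : ev (p.bind k) f = ev p fun x => ev (k x) f := by
  classical
  set t := hp.finset.biUnion fun x => (hk x).finset
  have hb : (p.bind k).support ⊆ t := by
    rw [PMF.support_bind]; intro y; simp [t, FinSupp.mem_finset]
  rw [ev_eq_sum hb, hp.ev_eq]
  have hpt := hp.support_subset
  simp_rw [prob_bind hpt, Finset.sum_smul, mul_smul]
  rw [Finset.sum_comm]
  refine Finset.sum_congr rfl fun x hx => ?_
  rw [← Finset.smul_sum, ev_eq_sum (t := t)]
  intro y hy
  simp only [t, Finset.coe_biUnion, Set.mem_iUnion]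
  exact ⟨x, hx, (hk x).support_subset hy⟩

theorem FinSupp.ev_map {p : PMF X} (hp : FinSupp p) (g : X → Y) (f : Y → V) :
    ev (p.map g) f = ev p fun x => f (g x) := by
  rw [← PMF.bind_pure_comp, hp.ev_bind (k := PMF.pure ∘ g) fun x => finSupp_pure _]
  simp [ev_pure]

theorem FinSupp.ev_congr {p : PMF X} {f g : X → V} (h : ∀ x ∈ p.support, f x = g x) :
    ev p f = ev p g := by
  refine tsum_congr fun x => ?_
  by_cases hx : x ∈ p.support
  · rw [h x hx]
  · simp [prob_eq_zero hx]

theorem FinSupp.ev_const {p : PMF X} (hp : FinSupp p) (v : V) : ev p (fun _ => v) = v := by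
  rw [hp.ev_eq, ← Finset.sum_smul, sum_prob_of_subset hp.support_subset, one_smul]

theorem FinSupp.ev_add {p : PMF X} (hp : FinSupp p) (f g : X → V) :
    ev p (fun x => f x + g x) = ev p f + ev p g := by
  simp [hp.ev_eq, smul_add, Finset.sum_add_distrib]

theorem FinSupp.ev_sub {p : PMF X} (hp : FinSupp p) (f g : X → V) :
    ev p (fun x => f x - g x) = ev p f - ev p g := by
  simp [hp.ev_eq, smul_sub, Finset.sum_sub_distrib]

theorem FinSupp.map_ev {p : PMF X} (hp : FinSupp p) (L : V →ₗ[ℝ] W) (f : X → V) :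
    L (ev p f) = ev p fun x => L (f x) := by
  simp [hp.ev_eq, map_sum]

theorem FinSupp.ev_smul {p : PMF X} (hp : FinSupp p) (c : ℝ) (f : X → V) :
    ev p (fun x => c • f x) = c • ev p f :=
  (hp.map_ev (LinearMap.lsmul ℝ V c) f).symm

theorem FinSupp.ev_mul {p : PMF X} (hp : FinSupp p) (c : ℝ) (f : X → ℝ) :
    ev p (fun x => c * f x) = c * ev p f :=
  hp.ev_smul c f

theorem FinSupp.ev_mono {p : PMF X} (hp : FinSupp p) {f g : X → ℝ}
    (h : ∀ x ∈ p.support, f x ≤ g x) : ev p f ≤ ev p g := by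
  rw [hp.ev_eq, hp.ev_eq]
  exact Finset.sum_le_sum fun x hx =>
    mul_le_mul_of_nonneg_left (h x (hp.mem_finset.1 hx)) (prob_nonneg p x)

theorem FinSupp.ev_le {p : PMF X} (hp : FinSupp p) {f : X → ℝ} {c : ℝ}
    (h : ∀ x ∈ p.support, f x ≤ c) : ev p f ≤ c :=
  (hp.ev_mono (g := fun _ => c) h).trans_eq (hp.ev_const c)

theorem FinSupp.ev_nonneg {p : PMF X} (hp : FinSupp p) {f : X → ℝ}
    (h : ∀ x, 0 ≤ f x) : 0 ≤ ev p f :=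
  (hp.ev_const (0 : ℝ)).symm.trans_le (hp.ev_mono fun x _ => h x)

theorem FinSupp.norm_ev_le {p : PMF X} (hp : FinSupp p) (f : X → V) :
    ‖ev p f‖ ≤ ev p fun x => ‖f x‖ := by
  rw [hp.ev_eq, hp.ev_eq]
  refine (norm_sum_le _ _).trans (Finset.sum_le_sum fun x _ => ?_)
  rw [norm_smul, Real.norm_of_nonneg (prob_nonneg p x), smul_eq_mul]

theorem FinSupp.sq_ev_le {p : PMF X} (hp : FinSupp p) (f : X → ℝ) :
    (ev p f) ^ 2 ≤ ev p fun x => f x ^ 2 := by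
  have h : 0 ≤ ev p fun x => (f x - ev p f) ^ 2 := hp.ev_nonneg fun x => sq_nonneg _
  have e : (fun x => (f x - ev p f) ^ 2) =
      fun x => (f x ^ 2 - (2 * ev p f) * f x) + (ev p f) ^ 2 := by
    funext x; ring
  rw [e, hp.ev_add, hp.ev_sub, hp.ev_mul, hp.ev_const] at h
  nlinarith

theorem FinSupp.ev_le_sqrt {p : PMF X} (hp : FinSupp p) (f : X → ℝ) :
    ev p f ≤ √(ev p fun x => f x ^ 2) :=
  Real.le_sqrt_of_sq_le (hp.sq_ev_le f)

/-- A chain observed through a function that its kernel respects is again a chain. This isolates one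
signal from the critic and actor loops, which run both signals on shared samples. -/
theorem iterLaw_map {step : X → PMF X} {step' : Y → PMF Y} {f : X → Y}
    (h : ∀ x, (step x).map f = step' (f x)) (n : ℕ) (x : X) :
    (iterLaw step n x).map f = iterLaw step' n (f x) := by
  induction n with
  | zero => simp [iterLaw, PMF.pure_map]
  | succ n ih =>
    simp only [iterLaw, PMF.map_bind, h]
    rw [← ih, PMF.bind_map]
    rfl

end FiniteSupport

/-! ### Convergence of finite Markov chains -/

section MarkovChain

variable {S : Type*} [Fintype S] [DecidableEq S] {V : Type*} [NormedAddCommGroup V]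
  [NormedSpace ℝ V]

/-- The action of a matrix on vector valued functions. -/
def act (Q : Matrix S S ℝ) (f : S → V) (s : S) : V := ∑ s', Q s s' • f s'

/-- `D` is a stationary probability vector of `Q`. -/
def IsStat (Q : Matrix S S ℝ) (D : S → ℝ) : Prop :=
  (∀ s, 0 ≤ D s) ∧ ∑ s, D s = 1 ∧ ∀ s', ∑ s, D s * Q s s' = D s'

theorem act_mul (Q R : Matrix S S ℝ) (f : S → V) : act (Q * R) f = act Q (act R f) := by
  funext s
  simp only [act, Matrix.mul_apply, Finset.sum_smul, Finset.smul_sum, mul_smul]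
  rw [Finset.sum_comm]

theorem act_one (f : S → V) : act (1 : Matrix S S ℝ) f = f := by
  funext s
  simp [act, Matrix.one_apply]

theorem act_const {Q : Matrix S S ℝ} (hQ : Q ∈ Matrix.rowStochastic ℝ S) (v : V) (s : S) :
    act Q (fun _ => v) s = v := by
  rw [act, ← Finset.sum_smul, Matrix.sum_row_of_mem_rowStochastic hQ, one_smul]

theorem act_sub (Q : Matrix S S ℝ) (f g : S → V) (s : S) :
    act Q (fun x => f x - g x) s = act Q f s - act Q g s := by
  simp [act, smul_sub]

theorem act_sum {ι : Type*} (Q : Matrix S S ℝ) (t : Finset ι) (f : ι → S → V) (s : S) :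
    act Q (fun x => ∑ i ∈ t, f i x) s = ∑ i ∈ t, act Q (f i) s := by
  simp only [act, Finset.smul_sum]
  rw [Finset.sum_comm]

theorem norm_act_le {Q : Matrix S S ℝ} (hQ : Q ∈ Matrix.rowStochastic ℝ S) {f : S → V} {B : ℝ}
    (hf : ∀ s, ‖f s‖ ≤ B) (s : S) : ‖act Q f s‖ ≤ B := by
  have h0 : ∀ s', 0 ≤ Q s s' := fun s' => Matrix.nonneg_of_mem_rowStochastic hQ
  calc ‖act Q f s‖ ≤ ∑ s', Q s s' * B := by
        refine (norm_sum_le _ _).trans (Finset.sum_le_sum fun s' _ => ?_)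
        rw [norm_smul, Real.norm_of_nonneg (h0 s')]
        exact mul_le_mul_of_nonneg_left (hf s') (h0 s')
    _ = B := by rw [← Finset.sum_mul, Matrix.sum_row_of_mem_rowStochastic hQ, one_mul]

theorem IsStat.sum_act {Q : Matrix S S ℝ} {D : S → ℝ} (hD : IsStat Q D) (f : S → V) :
    ∑ s, D s • act Q f s = ∑ s, D s • f s := by
  simp only [act, Finset.smul_sum, smul_smul]
  rw [Finset.sum_comm]
  refine Finset.sum_congr rfl fun s' _ => ?_
  rw [← Finset.sum_smul, hD.2.2]

theorem IsStat.pow {Q : Matrix S S ℝ} {D : S → ℝ} (hD : IsStat Q D) (n : ℕ) :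
    IsStat (Q ^ n) D := by
  refine ⟨hD.1, hD.2.1, ?_⟩
  induction n with
  | zero => intro s'; simp [Matrix.one_apply]
  | succ n ih =>
    intro s'
    simp only [pow_succ, Matrix.mul_apply, Finset.mul_sum, ← mul_assoc]
    rw [Finset.sum_comm]
    simp_rw [← Finset.sum_mul, ih]
    exact hD.2.2 s'

/-- Subtracting a multiple of `D` from a row does not affect its action on functions of `D`-mean
zero, so only the remaining mass of the row counts. The multiple is `e = 1` for mixing and the
minorization constant in Doeblin's argument. -/
theorem norm_act_le_of_centred {R : Matrix S S ℝ} {D : S → ℝ} {f : S → V} {B c e : ℝ}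
    (hB : 0 ≤ B) (hf : ∀ s, ‖f s‖ ≤ B) (h0 : ∑ s, D s • f s = 0) {s : S}
    (hc : ∑ s', |R s s' - e * D s'| ≤ c) : ‖act R f s‖ ≤ c * B := by
  have h : act R f s = ∑ s', (R s s' - e * D s') • f s' := by
    simp only [sub_smul, Finset.sum_sub_distrib, mul_smul, ← Finset.smul_sum, h0, smul_zero,
      sub_zero, act]
  rw [h]
  calc ‖∑ s', (R s s' - e * D s') • f s'‖ ≤ ∑ s', |R s s' - e * D s'| * B := by
        refine (norm_sum_le _ _).trans (Finset.sum_le_sum fun s' _ => ?_)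
        rw [norm_smul, Real.norm_eq_abs]
        exact mul_le_mul_of_nonneg_left (hf s') (abs_nonneg _)
    _ ≤ c * B := by rw [← Finset.sum_mul]; exact mul_le_mul_of_nonneg_right hc hB

theorem norm_act_pow_le {R : Matrix S S ℝ} {D : S → ℝ} (hD : IsStat R D) {f : S → V} {B c e : ℝ}
    (hB : 0 ≤ B) (hc0 : 0 ≤ c) (hf : ∀ s, ‖f s‖ ≤ B) (h0 : ∑ s, D s • f s = 0)
    (hc : ∀ s, ∑ s', |R s s' - e * D s'| ≤ c) (k : ℕ) (s : S) :
    ‖act (R ^ k) f s‖ ≤ c ^ k * B := by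
  induction k generalizing f B with
  | zero => simpa [act_one] using hf s
  | succ k ih =>
    rw [pow_succ, act_mul, pow_succ, mul_assoc]
    exact ih (mul_nonneg hc0 hB) (fun s => norm_act_le_of_centred hB hf h0 (hc s))
      (by rw [hD.sum_act, h0])

/-- Stationarity keeps functions centred, so each block of `t` steps contributes a factor 1/2; the
`n % t` left-over steps do not increase the sup norm. -/
theorem norm_act_pow_le_half {Q : Matrix S S ℝ} (hQ : Q ∈ Matrix.rowStochastic ℝ S) {D : S → ℝ}
    (hD : IsStat Q D) {t : ℕ} (ht : ∀ s, ∑ s', |(Q ^ t) s s' - D s'| ≤ 1 / 2)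
    {f : S → V} {B : ℝ} (hB : 0 ≤ B) (hf : ∀ s, ‖f s‖ ≤ B) (h0 : ∑ s, D s • f s = 0)
    (n : ℕ) (s : S) : ‖act (Q ^ n) f s‖ ≤ (1 / 2 : ℝ) ^ (n / t) * B := by
  conv_lhs => rw [← Nat.mod_add_div n t, pow_add, pow_mul, act_mul]
  refine norm_act_le (pow_mem hQ _) (fun s => ?_) s
  exact norm_act_pow_le (e := 1) (hD.pow t) hB (by norm_num) hf h0 (by simpa using ht) _ s

/-- The summand is constant on blocks of length `t`, so this is `t` copies of a geometric series. -/
theorem sum_half_pow_div_le (t n : ℕ) (ht : 1 ≤ t) :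
    ∑ i ∈ Finset.range n, (1 / 2 : ℝ) ^ (i / t) ≤ 2 * t := by
  have key : ∀ k, ∑ i ∈ Finset.range (t * k), (1 / 2 : ℝ) ^ (i / t)
      ≤ 2 * t * (1 - (1 / 2) ^ k) := by
    intro k
    induction k with
    | zero => simp
    | succ k ih =>
      rw [mul_add, mul_one, Finset.sum_range_add]
      have : ∑ x ∈ Finset.range t, (1 / 2 : ℝ) ^ ((t * k + x) / t) = t * (1 / 2) ^ k := by
        rw [Finset.sum_congr rfl (g := fun _ => (1 / 2 : ℝ) ^ k)]
        · simp
        · intro x hx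
          rw [Nat.mul_add_div (by lia), Nat.div_eq_of_lt (Finset.mem_range.1 hx), add_zero]
      rw [this, pow_succ]
      linarith
  calc ∑ i ∈ Finset.range n, (1 / 2 : ℝ) ^ (i / t)
      ≤ ∑ i ∈ Finset.range (t * n), (1 / 2 : ℝ) ^ (i / t) := by
        refine Finset.sum_le_sum_of_subset_of_nonneg ?_ fun _ _ _ => by positivity
        exact Finset.range_mono (Nat.le_mul_of_pos_left n ht)
    _ ≤ 2 * t * (1 - (1 / 2) ^ n) := key n
    _ ≤ 2 * t := by
        have : (0 : ℝ) ≤ (1 / 2) ^ n := by positivity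
        have : (0 : ℝ) ≤ t := by positivity
        nlinarith

theorem sum_norm_act_pow_le {Q : Matrix S S ℝ} (hQ : Q ∈ Matrix.rowStochastic ℝ S) {D : S → ℝ}
    (hD : IsStat Q D) {t : ℕ} (ht1 : 1 ≤ t) (ht : ∀ s, ∑ s', |(Q ^ t) s s' - D s'| ≤ 1 / 2)
    {f : S → V} {B : ℝ} (hB : 0 ≤ B) (hf : ∀ s, ‖f s‖ ≤ B) (h0 : ∑ s, D s • f s = 0)
    (n : ℕ) (s : S) : ∑ i ∈ Finset.range n, ‖act (Q ^ i) f s‖ ≤ 2 * t * B := by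
  calc ∑ i ∈ Finset.range n, ‖act (Q ^ i) f s‖
      ≤ ∑ i ∈ Finset.range n, (1 / 2 : ℝ) ^ (i / t) * B :=
        Finset.sum_le_sum fun i _ => norm_act_pow_le_half hQ hD ht hB hf h0 i s
    _ ≤ 2 * t * B := by
        rw [← Finset.sum_mul]
        exact mul_le_mul_of_nonneg_right (sum_half_pow_div_le t n ht1) hB

/-- The return times to a state form an additive submonoid of gcd one, which contains all large
integers. Looping at `i` long enough and then following a path to `j` reaches every pair at one
common time. -/
theorem exists_pow_pos {Q : Matrix S S ℝ} (hI : Q.IsIrreducible) (hA : Aperiodic Q) :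
    ∃ n, 1 ≤ n ∧ ∀ i j, 0 < (Q ^ n) i j := by
  have hnn : ∀ n i j, 0 ≤ (Q ^ n) i j := fun n => Matrix.pow_apply_nonneg hI.nonneg n
  have hmul : ∀ {a b i j k}, 0 < (Q ^ a) i j → 0 < (Q ^ b) j k → 0 < (Q ^ (a + b)) i k := by
    intro a b i j k h1 h2
    rw [pow_add, Matrix.mul_apply]
    exact Finset.sum_pos' (fun x _ => mul_nonneg (hnn _ _ _) (hnn _ _ _))
      ⟨j, Finset.mem_univ _, mul_pos h1 h2⟩
  have hret : ∀ i, ∃ n, ∀ m ≥ n, 0 < (Q ^ m) i i := by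
    intro i
    let R : Set ℕ := {m | 0 < (Q ^ m) i i}
    obtain ⟨n, hn⟩ := Nat.exists_mem_closure_of_ge R
    have hg : Nat.setGcd R = 1 :=
      hA i _ fun m _ hm => Nat.setGcd_dvd_of_mem hm
    refine ⟨n, fun m hm => ?_⟩
    have hmem := hn m hm (by rw [hg]; exact one_dvd m)
    refine AddSubmonoid.closure_induction (motive := fun m _ => 0 < (Q ^ m) i i)
      (fun x hx => hx) (by simp) (fun x y _ _ hx hy => hmul hx hy) hmem
  choose a ha using hret
  choose b hb0 hb using (Matrix.isIrreducible_iff_exists_pow_pos hI.nonneg).1 hI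
  -- The sums serve as a common upper bound: after reserving `b i j` steps for the path, at least `a
  -- i` remain for the loop.
  refine ⟨∑ i, a i + ∑ i, ∑ j, b i j + 1, by lia, fun i j => ?_⟩
  have h1 : a i ≤ ∑ i, a i := Finset.single_le_sum (fun _ _ => Nat.zero_le _) (Finset.mem_univ i)
  have h2 : b i j ≤ ∑ i, ∑ j, b i j :=
    (Finset.single_le_sum (f := fun j => b i j) (fun _ _ => Nat.zero_le _)
      (Finset.mem_univ j)).trans
    (Finset.single_le_sum (f := fun i => ∑ j, b i j) (fun _ _ => Nat.zero_le _)
      (Finset.mem_univ i))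
  obtain ⟨k, hk⟩ : ∃ k, ∑ i, a i + ∑ i, ∑ j, b i j + 1 = k + b i j ∧ a i ≤ k :=
    ⟨∑ i, a i + ∑ i, ∑ j, b i j + 1 - b i j, by lia⟩
  rw [hk.1]
  exact hmul (ha i k hk.2) (hb i j)

/-- The constants are a right null vector of `Q - 1`, so a left null vector `v` exists. Then `|v| ≤
|v| Q` holds coordinatewise with equal total mass, hence with equality, and `|v|` can be normalized.
-/
theorem exists_isStat [Nonempty S] {Q : Matrix S S ℝ} (hQ : Q ∈ Matrix.rowStochastic ℝ S) :
    ∃ D, IsStat Q D := by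
  have hdet : (Q - 1).det = 0 := by
    rw [← Matrix.exists_mulVec_eq_zero_iff]
    refine ⟨1, one_ne_zero, ?_⟩
    rw [Matrix.sub_mulVec, Matrix.one_vecMul_of_mem_rowStochastic hQ, Matrix.one_mulVec, sub_self]
  obtain ⟨v, hv0, hv⟩ := Matrix.exists_vecMul_eq_zero_iff.2 hdet
  have hst : ∀ s', ∑ s, v s * Q s s' = v s' := by
    intro s'
    have := congrFun hv s'
    rw [Matrix.vecMul_sub, Matrix.vecMul_one, Pi.sub_apply, Pi.zero_apply, sub_eq_zero] at this
    simpa [Matrix.vecMul, dotProduct] using this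
  have hle : ∀ s', |v s'| ≤ ∑ s, |v s| * Q s s' := by
    intro s'
    conv_lhs => rw [← hst s']
    refine (Finset.abs_sum_le_sum_abs _ _).trans_eq (Finset.sum_congr rfl fun s _ => ?_)
    rw [abs_mul, abs_of_nonneg (Matrix.nonneg_of_mem_rowStochastic hQ)]
  have hsum : ∑ s', |v s'| = ∑ s', ∑ s, |v s| * Q s s' := by
    rw [Finset.sum_comm]
    simp_rw [← Finset.mul_sum, Matrix.sum_row_of_mem_rowStochastic hQ, mul_one]
  have heq := (Finset.sum_eq_sum_iff_of_le fun s' _ => hle s').1 hsum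
  have hpos : 0 < ∑ s, |v s| := by
    obtain ⟨s, hs⟩ := Function.ne_iff.1 hv0
    exact Finset.sum_pos' (fun _ _ => abs_nonneg _) ⟨s, Finset.mem_univ _, abs_pos.2 hs⟩
  refine ⟨fun s => |v s| / ∑ s, |v s|, fun s => by positivity, ?_, fun s' => ?_⟩
  · rw [← Finset.sum_div, div_self hpos.ne']
  · simp_rw [div_mul_eq_mul_div]
    rw [← Finset.sum_div, ← heq s' (Finset.mem_univ _)]

theorem IsStat.le_one {Q : Matrix S S ℝ} {D : S → ℝ} (hD : IsStat Q D) (s : S) : D s ≤ 1 :=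
  (Finset.single_le_sum (fun s _ => hD.1 s) (Finset.mem_univ s)).trans_eq hD.2.1

/-- Doeblin's argument: some power of `Q` has all entries at least `e > 0`, so subtracting `e D`
leaves nonnegative rows of mass `1 - e`. -/
theorem exists_mixed {Q : Matrix S S ℝ} (hQ : Q ∈ Matrix.rowStochastic ℝ S)
    (hI : Q.IsIrreducible) (hA : Aperiodic Q) {D : S → ℝ} (hD : IsStat Q D) :
    ∃ t, 1 ≤ t ∧ ∀ s, ∑ s', |(Q ^ t) s s' - D s'| ≤ 1 / 2 := by
  obtain ⟨N, hN1, hN⟩ := exists_pow_pos hI hA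
  obtain ⟨e, he0, he1, he⟩ : ∃ e : ℝ, 0 < e ∧ e ≤ 1 ∧ ∀ i j, e ≤ (Q ^ N) i j := by
    rcases isEmpty_or_nonempty S with hS | hS
    · exact ⟨1, one_pos, le_rfl, fun i => hS.elim i⟩
    · obtain ⟨x, hx⟩ := Finite.exists_min fun x : S × S => (Q ^ N) x.1 x.2
      exact ⟨(Q ^ N) x.1 x.2, hN _ _, Matrix.le_one_of_mem_rowStochastic (pow_mem hQ N),
        fun i j => hx (i, j)⟩
  have hc : ∀ s, ∑ s', |(Q ^ N) s s' - e * D s'| ≤ 1 - e := by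
    intro s
    have : ∀ s', |(Q ^ N) s s' - e * D s'| = (Q ^ N) s s' - e * D s' := fun s' =>
      abs_of_nonneg (by nlinarith [he s s', hD.le_one s', hD.1 s'])
    simp_rw [this, Finset.sum_sub_distrib, ← Finset.mul_sum, hD.2.1,
      Matrix.sum_row_of_mem_rowStochastic (pow_mem hQ N)]
    simp
  have hconv : ∀ k s s', |((Q ^ N) ^ k) s s' - D s'| ≤ (1 - e) ^ k := by
    intro k s s'
    -- The centred indicator of `s'` turns the contraction of functions into convergence of the
    -- matrix entries.
    have h := norm_act_pow_le (V := ℝ) (hD.pow N) (B := 1) (c := 1 - e) (e := e)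
      (f := fun x => (if x = s' then 1 else 0) - D s') zero_le_one (by linarith) ?_ ?_ hc k s
    · rw [act_sub, act_const (pow_mem (pow_mem hQ N) k)] at h
      simpa [act] using h
    · intro x
      have h1 := hD.le_one s'
      have h2 := hD.1 s'
      rw [Real.norm_eq_abs, abs_le]
      split_ifs <;> constructor <;> linarith
    · simp [mul_sub, Finset.sum_sub_distrib, ← Finset.sum_mul, hD.2.1]
  have hlim : Filter.Tendsto (fun k : ℕ => (Fintype.card S : ℝ) * (1 - e) ^ k) Filter.atTop
      (nhds ((Fintype.card S : ℝ) * 0)) :=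
    (tendsto_pow_atTop_nhds_zero_of_lt_one (by linarith) (by linarith)).const_mul _
  rw [mul_zero] at hlim
  obtain ⟨k, hk, hk1⟩ := ((hlim.eventually (gt_mem_nhds (show (0 : ℝ) < 1 / 2 by norm_num))).and
    (Filter.eventually_ge_atTop 1)).exists
  have hsmall : ∀ s, ∑ s', |(Q ^ (N * k)) s s' - D s'| ≤ 1 / 2 := fun s => by
    rw [pow_mul]
    refine (Finset.sum_le_sum fun s' _ => hconv k s s').trans ?_
    simpa using hk.le
  exact ⟨N * k, Nat.mul_pos hN1 hk1, hsmall⟩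

end MarkovChain

/-! ### Average rewards, value functions and strong duality -/

section Model

variable {S A : Type*} [Fintype S] [DecidableEq S] [Fintype A] {M : CMDP S A}

theorem CMDP.nonempty_state (M : CMDP S A) : Nonempty S := M.ρ.support_nonempty.to_type

theorem CMDP.trans_mem (M : CMDP S A) (π : Policy S A) :
    M.trans π ∈ Matrix.rowStochastic ℝ S := by
  rw [Matrix.mem_rowStochastic_iff_sum]
  refine ⟨fun i j => Finset.sum_nonneg fun a _ => mul_nonneg (prob_nonneg _ _) (prob_nonneg _ _),
    fun i => ?_⟩
  simp only [CMDP.trans, Matrix.of_apply]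
  rw [Finset.sum_comm]
  simp_rw [← Finset.mul_sum, sum_prob, mul_one]
  exact sum_prob _

theorem CMDP.statDist_isStat (M : CMDP S A) (π : Policy S A) :
    IsStat (M.trans π) (M.statDist π) := by
  have := M.nonempty_state
  exact Classical.epsilon_spec (p := M.IsStationary π) (exists_isStat (M.trans_mem π))

theorem CMDP.Ergodic.mixTime_spec (hM : M.Ergodic) (π : Policy S A) :
    1 ≤ M.mixTime π ∧
      ∀ s, ∑ s', |(M.trans π ^ M.mixTime π) s s' - M.statDist π s'| ≤ 1 / 2 := by
  have hne : {t : ℕ | 1 ≤ t ∧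
    ∀ s, (1 / 2 : ℝ) * ∑ s', |(M.trans π ^ t) s s' - M.statDist π s'| ≤ 1 / 4}.Nonempty := by
    obtain ⟨t, ht1, ht⟩ :=
      exists_mixed (M.trans_mem π) (hM π).1 (hM π).2 (M.statDist_isStat π)
    exact ⟨t, ht1, fun s => by linarith [ht s]⟩
  have h := Nat.sInf_mem hne
  exact ⟨h.1, fun s => by have := h.2 s; unfold CMDP.mixTime; linarith⟩

theorem CMDP.Ergodic.sum_norm_act_le {V : Type*} [NormedAddCommGroup V] [NormedSpace ℝ V]
    (hM : M.Ergodic) {π : Policy S A} {τ : ℕ} (hτ : M.mixTime π ≤ τ)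
    {f : S → V} {B : ℝ} (hB : 0 ≤ B) (hf : ∀ s, ‖f s‖ ≤ B)
    (h0 : ∑ s, M.statDist π s • f s = 0) (n : ℕ) (s : S) :
    ∑ i ∈ Finset.range n, ‖act (M.trans π ^ i) f s‖ ≤ 2 * τ * B := by
  obtain ⟨h1, h2⟩ := hM.mixTime_spec π
  refine (sum_norm_act_pow_le (M.trans_mem π) (M.statDist_isStat π) h1 h2 hB hf h0 n s).trans ?_
  have : (M.mixTime π : ℝ) ≤ τ := by exact_mod_cast hτ
  gcongr

/-- The supremum of an unbounded set of naturals is 0 by convention, so `1 ≤ τ` certifies that the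
mixing times are bounded. -/
theorem mixTime_le_of_tauMix {d : ℕ} {π : E d → Policy S A} {τ : ℕ} (h : tauMix M π = τ)
    (hτ : 1 ≤ τ) (θ : E d) : M.mixTime (π θ) ≤ τ := by
  by_cases hb : BddAbove (Set.range fun θ => M.mixTime (π θ))
  · rw [← h]; exact le_ciSup hb θ
  · have : tauMix M π = 0 := Nat.sSup_of_not_bddAbove hb
    lia

theorem abs_sig_le (M : CMDP S A) (g : Sig) (s : S) (a : A) : |M.sig g s a| ≤ 1 := by
  rw [abs_le]
  cases g
  · have := M.r_mem s a; exact ⟨by change -1 ≤ M.r s a; linarith [this.1], this.2⟩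
  · exact M.c_mem s a

/-- The mean of the signal `g` in state `s` under `π`. -/
def CMDP.sigBar (M : CMDP S A) (π : Policy S A) (g : Sig) (s : S) : ℝ :=
  ∑ a, prob (π s) a * M.sig g s a

theorem abs_sum_prob_mul_le {X : Type*} [Fintype X] (p : PMF X) {f : X → ℝ} {B : ℝ}
    (hf : ∀ x, |f x| ≤ B) : |∑ x, prob p x * f x| ≤ B := by
  calc |∑ x, prob p x * f x| ≤ ∑ x, prob p x * B := by
        refine (Finset.abs_sum_le_sum_abs _ _).trans (Finset.sum_le_sum fun x _ => ?_)
        rw [abs_mul, abs_of_nonneg (prob_nonneg p x)]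
        exact mul_le_mul_of_nonneg_left (hf x) (prob_nonneg p x)
    _ = B := by rw [← Finset.sum_mul, sum_prob, one_mul]

theorem abs_sigBar_le (M : CMDP S A) (π : Policy S A) (g : Sig) (s : S) :
    |M.sigBar π g s| ≤ 1 :=
  abs_sum_prob_mul_le _ fun a => abs_sig_le M g s a

theorem meanAt_eq (M : CMDP S A) (π : Policy S A) (g : Sig) (t : ℕ) (s : S) :
    M.meanAt π g t s = act (M.trans π ^ t) (M.sigBar π g) s := rfl

theorem abs_stat_mean_le {Q : Matrix S S ℝ} {D : S → ℝ} (hD : IsStat Q D) {f : S → ℝ} {B : ℝ}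
    (hf : ∀ s, |f s| ≤ B) : |∑ s, D s * f s| ≤ B := by
  calc |∑ x, D x * f x| ≤ ∑ x, D x * B := by
        refine (Finset.abs_sum_le_sum_abs _ _).trans (Finset.sum_le_sum fun x _ => ?_)
        rw [abs_mul, abs_of_nonneg (hD.1 x)]
        exact mul_le_mul_of_nonneg_left (hf x) (hD.1 x)
    _ = B := by rw [← Finset.sum_mul, hD.2.1, one_mul]

theorem CMDP.Ergodic.tendsto_meanAt (hM : M.Ergodic) (π : Policy S A) {D : S → ℝ}
    (hD : IsStat (M.trans π) D) (g : Sig) (s : S) :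
    Filter.Tendsto (fun t => M.meanAt π g t s) Filter.atTop
      (nhds (∑ s, D s * M.sigBar π g s)) := by
  obtain ⟨t, ht1, ht⟩ := exists_mixed (M.trans_mem π) (hM π).1 (hM π).2 hD
  set j := ∑ s, D s * M.sigBar π g s with hj
  have hj1 : |j| ≤ 1 := abs_stat_mean_le hD fun s => abs_sigBar_le M π g s
  rw [tendsto_iff_norm_sub_tendsto_zero]
  have hlim : Filter.Tendsto (fun n : ℕ => (1 / 2 : ℝ) ^ (n / t) * 2) Filter.atTop
      (nhds (0 * 2)) :=
    ((tendsto_pow_atTop_nhds_zero_of_lt_one (by norm_num) (by norm_num)).comp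
      (Nat.tendsto_div_const_atTop (by lia))).mul_const 2
  rw [zero_mul] at hlim
  refine squeeze_zero (fun _ => norm_nonneg _) (fun n => ?_) hlim
  have h := norm_act_pow_le_half (V := ℝ) (M.trans_mem π) hD ht (B := 2)
    (f := fun s => M.sigBar π g s - j) (by norm_num) ?_ ?_ n s
  · rwa [act_sub, act_const (pow_mem (M.trans_mem π) n)] at h
  · intro s
    calc |M.sigBar π g s - j| ≤ |M.sigBar π g s| + |j| := abs_sub _ _
      _ ≤ 2 := by linarith [abs_sigBar_le M π g s]
  · simp [mul_sub, Finset.sum_sub_distrib, ← Finset.sum_mul, hD.2.1, hj]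

/-- The Cesàro limit forgets the initial law. An arbitrary stationary vector is allowed because for
a mixture policy one is at hand explicitly, without an identification with `statDist`. -/
theorem CMDP.Ergodic.J_eq (hM : M.Ergodic) (π : Policy S A) {D : S → ℝ}
    (hD : IsStat (M.trans π) D) (g : Sig) : M.J g π = ∑ s, D s * M.sigBar π g s := by
  refine Filter.Tendsto.limUnder_eq ?_
  have h : Filter.Tendsto (fun t => ∑ s, prob M.ρ s * M.meanAt π g t s) Filter.atTop
      (nhds (∑ s, prob M.ρ s * ∑ s, D s * M.sigBar π g s)) :=
    tendsto_finsetSum _ fun s _ => (hM.tendsto_meanAt π hD g s).const_mul _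
  rw [← Finset.sum_mul, sum_prob, one_mul] at h
  simpa [one_div] using h.cesaro

theorem CMDP.Ergodic.J_eq_statDist (hM : M.Ergodic) (π : Policy S A) (g : Sig) :
    M.J g π = ∑ s, M.statDist π s * M.sigBar π g s :=
  hM.J_eq π (M.statDist_isStat π) g

theorem CMDP.Ergodic.abs_J_le (hM : M.Ergodic) (π : Policy S A) (g : Sig) : |M.J g π| ≤ 1 := by
  rw [hM.J_eq_statDist]
  exact abs_stat_mean_le (M.statDist_isStat π) fun s => abs_sigBar_le M π g s

theorem CMDP.Ergodic.J_r_mem (hM : M.Ergodic) (π : Policy S A) : M.J .r π ∈ Set.Icc (0 : ℝ) 1 := by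
  refine ⟨?_, (abs_le.1 (hM.abs_J_le π .r)).2⟩
  rw [hM.J_eq_statDist]
  exact Finset.sum_nonneg fun s _ => mul_nonneg ((M.statDist_isStat π).1 s)
    (Finset.sum_nonneg fun a _ => mul_nonneg (prob_nonneg _ _) (M.r_mem s a).1)

/-- The centred mean signal. -/
def CMDP.sigCent (M : CMDP S A) (π : Policy S A) (g : Sig) (s : S) : ℝ :=
  M.sigBar π g s - M.J g π

theorem CMDP.Ergodic.abs_sigCent_le (hM : M.Ergodic) (π : Policy S A) (g : Sig) (s : S) :
    |M.sigCent π g s| ≤ 2 :=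
  (abs_sub _ _).trans (by linarith [abs_sigBar_le M π g s, hM.abs_J_le π g])

theorem CMDP.Ergodic.sum_sigCent (hM : M.Ergodic) (π : Policy S A) (g : Sig) :
    ∑ s, M.statDist π s • M.sigCent π g s = 0 := by
  simp [CMDP.sigCent, mul_sub, Finset.sum_sub_distrib, ← Finset.sum_mul,
    (M.statDist_isStat π).2.1, ← hM.J_eq_statDist]

theorem act_sigCent (M : CMDP S A) (π : Policy S A) (g : Sig) (t : ℕ) (s : S) :
    act (M.trans π ^ t) (M.sigCent π g) s = M.meanAt π g t s - M.J g π := by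
  unfold CMDP.sigCent
  rw [act_sub, act_const (pow_mem (M.trans_mem π) t), meanAt_eq]

/-- The differential value function, as a series along the chain. -/
def CMDP.potential (M : CMDP S A) (π : Policy S A) (g : Sig) (s : S) : ℝ :=
  ∑' t : ℕ, (M.meanAt π g t s - M.J g π)

theorem CMDP.Ergodic.sum_abs_meanAt_le (hM : M.Ergodic) {π : Policy S A} {τ : ℕ}
    (hτ : M.mixTime π ≤ τ) (g : Sig) (s : S) (n : ℕ) :
    ∑ t ∈ Finset.range n, |M.meanAt π g t s - M.J g π| ≤ 4 * τ := by
  have := hM.sum_norm_act_le hτ (by norm_num) (hM.abs_sigCent_le π g) (hM.sum_sigCent π g) n s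
  simp only [act_sigCent, Real.norm_eq_abs] at this
  linarith

theorem CMDP.Ergodic.summable_meanAt (hM : M.Ergodic) (π : Policy S A) (g : Sig) (s : S) :
    Summable fun t => M.meanAt π g t s - M.J g π :=
  Summable.of_norm (summable_of_sum_range_le (fun _ => norm_nonneg _)
    (hM.sum_abs_meanAt_le le_rfl g s))

theorem meanAt_succ (M : CMDP S A) (π : Policy S A) (g : Sig) (t : ℕ) (s : S) :
    M.meanAt π g (t + 1) s = act (M.trans π) (fun s' => M.meanAt π g t s') s := by
  rw [meanAt_eq, pow_succ', act_mul]
  rfl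

theorem sum_prob_act (M : CMDP S A) (π : Policy S A) (f : S → ℝ) (s : S) :
    ∑ a, prob (π s) a * ∑ s', prob (M.P s a) s' * f s' = act (M.trans π) f s := by
  simp only [act, CMDP.trans, Matrix.of_apply, smul_eq_mul, Finset.sum_mul, Finset.mul_sum]
  rw [Finset.sum_comm]
  simp only [mul_assoc]

theorem CMDP.Ergodic.Q_eq_potential (hM : M.Ergodic) (π : Policy S A) (g : Sig) (s : S) (a : A) :
    M.Q g π s a =
      M.sig g s a - M.J g π + ∑ s', prob (M.P s a) s' * M.potential π g s' := by
  have hstep : ∀ t, M.meanAtSA π g (t + 1) s a - M.J g π =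
      ∑ s', prob (M.P s a) s' * (M.meanAt π g t s' - M.J g π) := by
    intro t
    simp only [CMDP.meanAtSA, mul_sub, Finset.sum_sub_distrib, ← Finset.sum_mul, sum_prob, one_mul]
  have hsum : HasSum (fun t => M.meanAtSA π g (t + 1) s a - M.J g π)
      (∑ s', prob (M.P s a) s' * M.potential π g s') := by
    simp_rw [hstep]
    exact hasSum_sum fun s' _ => (hM.summable_meanAt π g s').hasSum.mul_left _
  have h1 : Summable fun t => M.meanAtSA π g t s a - M.J g π :=
    (summable_nat_add_iff 1).1 hsum.summable
  rw [CMDP.Q, h1.tsum_eq_zero_add, hsum.tsum_eq]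
  rfl

/-- The Poisson equation, from splitting off the first term of the series. -/
theorem CMDP.Ergodic.potential_eq (hM : M.Ergodic) (π : Policy S A) (g : Sig) (s : S) :
    M.potential π g s = M.sigCent π g s + act (M.trans π) (M.potential π g) s := by
  have hsum : HasSum (fun t => M.meanAt π g (t + 1) s - M.J g π)
      (act (M.trans π) (M.potential π g) s) := by
    have e : ∀ t, M.meanAt π g (t + 1) s - M.J g π =
        ∑ s', M.trans π s s' * (M.meanAt π g t s' - M.J g π) := by
      intro t
      rw [meanAt_succ]
      simp [act, mul_sub, Finset.sum_sub_distrib, ← Finset.sum_mul,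
        Matrix.sum_row_of_mem_rowStochastic (M.trans_mem π)]
    simp_rw [e]
    exact hasSum_sum fun s' _ => (hM.summable_meanAt π g s').hasSum.mul_left _
  rw [CMDP.potential, (hM.summable_meanAt π g s).tsum_eq_zero_add, hsum.tsum_eq, meanAt_eq,
    pow_zero, act_one]
  rfl

theorem CMDP.Ergodic.V_eq_potential (hM : M.Ergodic) (π : Policy S A) (g : Sig) (s : S) :
    M.V g π s = M.potential π g s := by
  rw [hM.potential_eq, CMDP.V, ← sum_prob_act]
  simp only [hM.Q_eq_potential, mul_add, mul_sub, Finset.sum_add_distrib, Finset.sum_sub_distrib,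
    ← Finset.sum_mul, sum_prob, one_mul]
  rfl

theorem CMDP.Ergodic.adv_eq (hM : M.Ergodic) (π : Policy S A) (g : Sig) (s : S) (a : A) :
    M.Adv g π s a = M.sig g s a - M.J g π + ∑ s', prob (M.P s a) s' * M.V g π s' - M.V g π s := by
  simp_rw [CMDP.Adv, hM.Q_eq_potential, ← hM.V_eq_potential]

/-- The performance difference identity. -/
theorem CMDP.Ergodic.sum_occ_adv (hM : M.Ergodic) (πs π : Policy S A) (g : Sig) :
    ∑ s, ∑ a, M.occ πs s a * M.Adv g π s a = M.J g πs - M.J g π := by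
  have hst := M.statDist_isStat πs
  have h1 : ∀ s, ∑ a, M.occ πs s a * M.Adv g π s a =
      M.statDist πs s * M.sigBar πs g s - M.statDist πs s * M.J g π +
        (M.statDist πs s • act (M.trans πs) (M.V g π) s - M.statDist πs s • M.V g π s) := by
    intro s
    rw [← sum_prob_act]
    simp only [CMDP.occ, mul_assoc, ← Finset.mul_sum, smul_eq_mul, ← mul_sub, ← mul_add]
    congr 1
    simp only [hM.adv_eq, mul_add, mul_sub, Finset.sum_add_distrib, Finset.sum_sub_distrib,
      ← Finset.sum_mul, sum_prob, one_mul, CMDP.sigBar]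
    ring
  -- Stationarity under `πs` cancels the two value terms.
  simp_rw [h1, Finset.sum_add_distrib, Finset.sum_sub_distrib, hst.sum_act, sub_self, add_zero,
    ← Finset.sum_mul, hst.2.1, one_mul, ← hM.J_eq_statDist]

theorem occ_nonneg (M : CMDP S A) (π : Policy S A) (s : S) (a : A) : 0 ≤ M.occ π s a :=
  mul_nonneg ((M.statDist_isStat π).1 s) (prob_nonneg _ _)

theorem sum_occ_right (M : CMDP S A) (π : Policy S A) (s : S) :
    ∑ a, M.occ π s a = M.statDist π s := by
  simp only [CMDP.occ, ← Finset.mul_sum, sum_prob, mul_one]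

theorem exists_pmf_of_weights {X : Type*} [Fintype X] (w : X → ℝ) (h0 : ∀ x, 0 ≤ w x)
    (h1 : ∑ x, w x = 1) : ∃ p : PMF X, ∀ x, prob p x = w x := by
  refine ⟨PMF.ofFintype (fun x => ENNReal.ofReal (w x)) ?_, fun x => ?_⟩
  · rw [← ENNReal.ofReal_sum_of_nonneg fun x _ => h0 x, h1, ENNReal.ofReal_one]
  · simp [prob, ENNReal.toReal_ofReal (h0 x)]

/-- Mixtures of occupancy measures are attained by policies. -/
theorem CMDP.Ergodic.exists_mixture (hM : M.Ergodic) (π₁ π₂ : Policy S A) {t : ℝ} (ht0 : 0 ≤ t)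
    (ht1 : t ≤ 1) : ∃ π : Policy S A, ∀ g, M.J g π = t * M.J g π₁ + (1 - t) * M.J g π₂ := by
  have hs1 := M.statDist_isStat π₁
  have hs2 := M.statDist_isStat π₂
  have ht2 : 0 ≤ 1 - t := by linarith
  set D : S → ℝ := fun s => t * M.statDist π₁ s + (1 - t) * M.statDist π₂ s with hDdef
  have hD0 : ∀ s, 0 ≤ D s := fun s =>
    add_nonneg (mul_nonneg ht0 (hs1.1 s)) (mul_nonneg ht2 (hs2.1 s))
  -- The mixing policy is the conditional law of the action under the mixed occupancy measure; where
  -- the mixture gives no mass to the state, any choice works.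
  have key : ∀ s, ∃ p : PMF A, ∀ a,
      D s * prob p a = t * M.occ π₁ s a + (1 - t) * M.occ π₂ s a := by
    intro s
    rcases (hD0 s).eq_or_lt with h | h
    · have e1 := mul_nonneg ht0 (hs1.1 s)
      have e2 := mul_nonneg ht2 (hs2.1 s)
      have h' : t * M.statDist π₁ s + (1 - t) * M.statDist π₂ s = 0 := h.symm
      have z1 : t * M.statDist π₁ s = 0 := by linarith
      have z2 : (1 - t) * M.statDist π₂ s = 0 := by linarith
      refine ⟨π₁ s, fun a => ?_⟩
      rw [← h, CMDP.occ, CMDP.occ, ← mul_assoc, ← mul_assoc, z1, z2]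
      simp
    · obtain ⟨p, hp⟩ := exists_pmf_of_weights
        (fun a => (t * M.occ π₁ s a + (1 - t) * M.occ π₂ s a) / D s)
        (fun a => div_nonneg (add_nonneg (mul_nonneg ht0 (occ_nonneg M _ _ _))
          (mul_nonneg ht2 (occ_nonneg M _ _ _))) h.le)
        (by rw [← Finset.sum_div, Finset.sum_add_distrib, ← Finset.mul_sum, ← Finset.mul_sum,
              sum_occ_right, sum_occ_right, div_self h.ne'])
      exact ⟨p, fun a => by rw [hp, mul_div_cancel₀ _ h.ne']⟩
  choose π hπ using key
  -- The flow equations are linear in the occupancy measure, so they pass to the mixture.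
  have hstat : IsStat (M.trans π) D := by
    refine ⟨hD0, ?_, fun s' => ?_⟩
    · simp only [hDdef, Finset.sum_add_distrib, ← Finset.mul_sum, hs1.2.1, hs2.2.1]; ring
    · have e1 := hs1.2.2 s'
      have e2 := hs2.2.2 s'
      simp only [CMDP.trans, Matrix.of_apply, Finset.mul_sum, ← mul_assoc] at e1 e2 ⊢
      simp only [hπ, add_mul, Finset.sum_add_distrib, mul_assoc, ← Finset.mul_sum]
      simp only [CMDP.occ, hDdef]
      rw [← e1, ← e2]
  refine ⟨π, fun g => ?_⟩
  rw [hM.J_eq π hstat, hM.J_eq_statDist, hM.J_eq_statDist]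
  simp only [CMDP.sigBar, Finset.mul_sum, ← mul_assoc, hπ, add_mul, Finset.sum_add_distrib]
  simp only [CMDP.occ, mul_assoc]

/-- Strong duality: a Lagrange multiplier bounded by the inverse Slater margin. -/
theorem CMDP.Ergodic.exists_multiplier (hM : M.Ergodic) {πs πb : Policy S A} {δ : ℝ}
    (hδ : 0 < δ) (hopt : M.IsOptimal πs) (hb : δ ≤ M.J .c πb) :
    ∃ l : ℝ, 0 ≤ l ∧ l ≤ 1 / δ ∧ ∀ π, M.J .r π + l * M.J .c π ≤ M.J .r πs := by
  -- An infeasible and a strictly feasible policy are mixed so that the constraint holds with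
  -- equality. Optimality of `πs` against the mixture compares the two slopes.
  have hpair : ∀ π π', M.J .c π < 0 → 0 < M.J .c π' →
      (M.J .r π - M.J .r πs) / (-M.J .c π) ≤ (M.J .r πs - M.J .r π') / M.J .c π' := by
    intro π π' h1 h2
    set x := M.J .c π
    set y := M.J .c π'
    have hxy : 0 < y - x := by linarith
    obtain ⟨π'', h⟩ := hM.exists_mixture π π' (t := y / (y - x)) (div_nonneg h2.le hxy.le)
      (by rw [div_le_one hxy]; linarith)
    have hc : M.J .c π'' = 0 := by
      rw [h .c]; change y / (y - x) * x + (1 - y / (y - x)) * y = 0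
      field_simp; ring
    have hr := hopt.2 π'' hc.ge
    rw [h .r] at hr
    have hr' : y * M.J .r π + (-x) * M.J .r π' ≤ (y - x) * M.J .r πs := by
      have : y * M.J .r π + (-x) * M.J .r π' =
          (y - x) * (y / (y - x) * M.J .r π + (1 - y / (y - x)) * M.J .r π') := by
        field_simp; ring
      rw [this]; exact mul_le_mul_of_nonneg_left hr hxy.le
    rw [div_le_div_iff₀ (by linarith) h2]
    nlinarith
  have hb0 : 0 < M.J .c πb := hδ.trans_le hb
  -- The slopes of infeasible policies lie below those of strictly feasible ones, and the supremum
  -- separates them. Inserting 0 keeps the multiplier nonnegative and the set nonempty.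
  set U : Set ℝ := insert 0 {u | ∃ π, M.J .c π < 0 ∧ u = (M.J .r π - M.J .r πs) / (-M.J .c π)}
  have hub : ∀ π', 0 < M.J .c π' → ∀ u ∈ U, u ≤ (M.J .r πs - M.J .r π') / M.J .c π' := by
    rintro π' h' u (rfl | ⟨π, h, rfl⟩)
    · exact div_nonneg (by linarith [hopt.2 π' h'.le]) h'.le
    · exact hpair π π' h h'
  have hbdd : BddAbove U := ⟨_, hub πb hb0⟩
  have hne : U.Nonempty := ⟨0, Set.mem_insert _ _⟩
  refine ⟨sSup U, le_csSup hbdd (Set.mem_insert _ _), ?_, fun π => ?_⟩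
  · refine (csSup_le hne (hub πb hb0)).trans ?_
    have h1 := (hM.J_r_mem πs).2
    have h2 := (hM.J_r_mem πb).1
    exact div_le_div₀ zero_le_one (by linarith) hδ hb
  · rcases lt_trichotomy (M.J .c π) 0 with h | h | h
    · have := le_csSup hbdd (Set.mem_insert_of_mem 0 ⟨π, h, rfl⟩ :
        (M.J .r π - M.J .r πs) / (-M.J .c π) ∈ U)
      rw [div_le_iff₀ (by linarith)] at this
      linarith
    · rw [h]; linarith [hopt.2 π h.ge]
    · have := csSup_le hne (hub π h)
      rw [le_div_iff₀ h] at this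
      linarith

end Model

/-! ### Averages along a trajectory -/

section Rollout

variable {S A : Type*} [Fintype S] [DecidableEq S] [Fintype A] {M : CMDP S A}
  {V : Type*} [NormedAddCommGroup V] [InnerProductSpace ℝ V]

/-- The law of one transition from `s`. -/
def stepLaw (M : CMDP S A) (π : Policy S A) (s : S) : PMF (S × A × S) :=
  (π s).bind fun a => (M.P s a).map fun s' => (s, a, s')

/-- The stationary mean of a function of a transition. -/
def statMean (M : CMDP S A) (π : Policy S A) (v : S × A × S → V) : V :=
  ∑ s, M.statDist π s • ev (stepLaw M π s) v

theorem finSupp_stepLaw (M : CMDP S A) (π : Policy S A) (s : S) : FinSupp (stepLaw M π s) :=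
  (finSupp_of_finite _).bind fun _ => (finSupp_of_finite _).map _

theorem ev_stepLaw (M : CMDP S A) (π : Policy S A) (s : S) (v : S × A × S → V) :
    ev (stepLaw M π s) v = ∑ a, prob (π s) a • ∑ s', prob (M.P s a) s' • v (s, a, s') := by
  rw [stepLaw, (finSupp_of_finite _).ev_bind fun _ => (finSupp_of_finite _).map _, ev_eq_sum_univ]
  simp_rw [(finSupp_of_finite _).ev_map, ev_eq_sum_univ]

theorem ev_stepLaw_next (M : CMDP S A) (π : Policy S A) (s : S) (f : S → V) :
    ev (stepLaw M π s) (fun z => f z.2.2) = act (M.trans π) f s := by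
  rw [ev_stepLaw]
  simp only [act, CMDP.trans, Matrix.of_apply, Finset.sum_smul, Finset.smul_sum, mul_smul]
  rw [Finset.sum_comm]

theorem meanZ_eq_statMean {d : ℕ} (M : CMDP S A) (π : E d → Policy S A) (θ : E d)
    (f : S × A × S → V) : meanZ M π θ f = statMean M (π θ) f := by
  simp only [meanZ, statMean, ev_stepLaw, CMDP.occ, Finset.smul_sum, smul_smul, mul_assoc]

theorem rollout_succ (M : CMDP S A) (π : Policy S A) (n : ℕ) (s : S) :
    rollout M π (n + 1) s =
      (stepLaw M π s).bind fun z => (rollout M π n z.2.2).map fun zs => z :: zs := by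
  simp only [rollout, stepLaw, PMF.bind_bind, PMF.bind_map]
  rfl

theorem finSupp_rollout (M : CMDP S A) (π : Policy S A) (n : ℕ) (s : S) :
    FinSupp (rollout M π n s) := by
  induction n generalizing s with
  | zero => exact finSupp_pure _
  | succ n ih =>
    rw [rollout_succ]
    exact (finSupp_stepLaw M π s).bind fun z => (ih _).map _

theorem ev_rollout_succ {W : Type*} [NormedAddCommGroup W] [NormedSpace ℝ W]
    (M : CMDP S A) (π : Policy S A) (n : ℕ) (s : S) (F : List (S × A × S) → W) :
    ev (rollout M π (n + 1) s) F =
      ev (stepLaw M π s) fun z => ev (rollout M π n z.2.2) fun zs => F (z :: zs) := by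
  rw [rollout_succ, (finSupp_stepLaw M π s).ev_bind fun z => (finSupp_rollout M π n _).map _]
  simp_rw [(finSupp_rollout M π n _).ev_map]

theorem length_of_mem_rollout {π : Policy S A} {n : ℕ} {s : S} {zs : List (S × A × S)}
    (h : zs ∈ (rollout M π n s).support) : zs.length = n := by
  induction n generalizing s zs with
  | zero => simp_all [rollout, PMF.support_pure]
  | succ n ih =>
    rw [rollout_succ, PMF.mem_support_bind_iff] at h
    obtain ⟨z, -, h⟩ := h
    rw [PMF.mem_support_map_iff] at h
    obtain ⟨ws, hws, rfl⟩ := h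
    simp [ih hws]

/-- By this consistency, the averages of all lengths read off one trajectory can be analysed as if
each had its own. -/
theorem rollout_map_take (M : CMDP S A) (π : Policy S A) {n N : ℕ} (h : n ≤ N) (s : S) :
    (rollout M π N s).map (List.take n) = rollout M π n s := by
  induction n generalizing N s with
  | zero =>
    have : (List.take 0 : List (S × A × S) → _) = Function.const _ [] := by funext; simp
    rw [this, PMF.map_const]; rfl
  | succ n ih =>
    obtain ⟨N, rfl⟩ : ∃ k, N = k + 1 := ⟨N - 1, by lia⟩
    simp only [rollout_succ, PMF.map_bind, PMF.map_comp]
    congr 1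
    funext z
    rw [← ih (N := N) (by lia), PMF.map_comp]
    congr 1

theorem ev_rollout_take {W : Type*} [NormedAddCommGroup W] [NormedSpace ℝ W]
    (M : CMDP S A) (π : Policy S A) {n N : ℕ} (h : n ≤ N) (s : S)
    (F : List (S × A × S) → W) :
    ev (rollout M π N s) (fun zs => F (zs.take n)) = ev (rollout M π n s) F := by
  rw [← rollout_map_take M π h, (finSupp_rollout M π N s).ev_map]

theorem ev_rollout_sum (M : CMDP S A) (π : Policy S A) (u : S × A × S → V) (n : ℕ) (s : S) :
    ev (rollout M π n s) (fun zs => (zs.map u).sum) =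
      ∑ i ∈ Finset.range n, act (M.trans π ^ i) (fun s' => ev (stepLaw M π s') u) s := by
  induction n generalizing s with
  | zero => simp [rollout, ev_pure]
  | succ n ih =>
    rw [ev_rollout_succ]
    simp only [List.map_cons, List.sum_cons]
    simp_rw [(finSupp_rollout M π n _).ev_add, (finSupp_rollout M π n _).ev_const]
    rw [(finSupp_stepLaw M π s).ev_add]
    simp_rw [ih]
    rw [ev_stepLaw_next M π s (fun x => ∑ i ∈ Finset.range n,
        act (M.trans π ^ i) (fun s' => ev (stepLaw M π s') u) x), act_sum,
      Finset.sum_range_succ', pow_zero, act_one, add_comm]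
    simp_rw [pow_succ', act_mul]

/-- Splitting off the first transition, the cross term pairs `u z` with the conditional mean of the
remaining sum, which `R` bounds. So the second moment grows linearly, and no double sum of
covariances appears. -/
theorem ev_rollout_norm_sum_sq_le (M : CMDP S A) (π : Policy S A) {u : S × A × S → V} {B R : ℝ}
    (hB : 0 ≤ B) (hu : ∀ z, ‖u z‖ ≤ B)
    (hR : ∀ n s, ‖ev (rollout M π n s) (fun zs => (zs.map u).sum)‖ ≤ R) (n : ℕ) (s : S) :
    ev (rollout M π n s) (fun zs => ‖(zs.map u).sum‖ ^ 2) ≤ n * (B ^ 2 + 2 * B * R) := by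
  induction n generalizing s with
  | zero => simp [rollout, ev_pure]
  | succ n ih =>
    rw [ev_rollout_succ]
    refine (finSupp_stepLaw M π s).ev_le fun z _ => ?_
    have hF := finSupp_rollout M π n z.2.2
    simp only [List.map_cons, List.sum_cons]
    simp_rw [norm_add_sq_real]
    rw [hF.ev_add, hF.ev_add, hF.ev_const, hF.ev_mul]
    have e : ev (rollout M π n z.2.2) (fun zs => inner ℝ (u z) (zs.map u).sum) =
        inner ℝ (u z) (ev (rollout M π n z.2.2) fun zs => (zs.map u).sum) :=
      (hF.map_ev (innerₗ V (u z)) fun zs => (zs.map u).sum).symm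
    rw [e]
    have h1 := real_inner_le_norm (u z) (ev (rollout M π n z.2.2) fun zs => (zs.map u).sum)
    have h2 := mul_le_mul (hu z) (hR n z.2.2) (norm_nonneg _) hB
    have h3 : ‖u z‖ ^ 2 ≤ B ^ 2 := pow_le_pow_left₀ (norm_nonneg _) (hu z) 2
    have h4 := ih z.2.2
    push_cast
    linarith

theorem norm_ev_le_of_le {X : Type*} {W : Type*} [NormedAddCommGroup W] [NormedSpace ℝ W]
    {p : PMF X} (hp : FinSupp p) {f : X → W} {B : ℝ}
    (hf : ∀ x, ‖f x‖ ≤ B) : ‖ev p f‖ ≤ B :=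
  (hp.norm_ev_le f).trans (hp.ev_le fun x _ => hf x)

theorem norm_statMean_le (M : CMDP S A) (π : Policy S A) {v : S × A × S → V} {B : ℝ}
    (hv : ∀ z, ‖v z‖ ≤ B) : ‖statMean M π v‖ ≤ B := by
  have hD := M.statDist_isStat π
  calc ‖statMean M π v‖ ≤ ∑ s, M.statDist π s * B := by
        refine (norm_sum_le _ _).trans (Finset.sum_le_sum fun s _ => ?_)
        rw [norm_smul, Real.norm_of_nonneg (hD.1 s)]
        exact mul_le_mul_of_nonneg_left (norm_ev_le_of_le (finSupp_stepLaw M π s) hv) (hD.1 s)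
    _ = B := by rw [← Finset.sum_mul, hD.2.1, one_mul]

/-- The conditional means of the centred terms are summable by mixing, so the bound is uniform in
the length. It supplies the constant `R` of `ev_rollout_norm_sum_sq_le`. -/
theorem CMDP.Ergodic.norm_ev_rollout_sum_le (hM : M.Ergodic) {π : Policy S A} {τ : ℕ}
    (hτ : M.mixTime π ≤ τ) {v : S × A × S → V} {B : ℝ} (hB : 0 ≤ B) (hv : ∀ z, ‖v z‖ ≤ B)
    (n : ℕ) (s : S) :
    ‖ev (rollout M π n s) (fun zs => (zs.map fun z => v z - statMean M π v).sum)‖ ≤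
      4 * τ * B := by
  rw [ev_rollout_sum]
  have hc : ∀ z, ‖v z - statMean M π v‖ ≤ 2 * B := fun z =>
    (norm_sub_le _ _).trans (by linarith [hv z, norm_statMean_le M π hv])
  refine (norm_sum_le _ _).trans
    ((hM.sum_norm_act_le hτ (B := 2 * B) (by linarith)
      (fun s => norm_ev_le_of_le (finSupp_stepLaw M π s) hc) ?_ n s).trans_eq (by ring))
  simp_rw [(finSupp_stepLaw M π _).ev_sub, (finSupp_stepLaw M π _).ev_const, smul_sub,
    Finset.sum_sub_distrib, ← Finset.sum_smul, (M.statDist_isStat π).2.1, one_smul]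
  exact sub_self _

theorem levelAvg_eq_take {X : Type*} [AddCommGroup X] [Module ℝ X] (v : S × A × S → X)
    (zs : List (S × A × S)) (j : ℕ) : levelAvg v zs j = levelAvg v (zs.take (2 ^ j)) j := by
  rw [levelAvg, levelAvg, List.take_take, min_self]

theorem levelAvg_sub_const (v : S × A × S → V) (c : V) {zs : List (S × A × S)} {j : ℕ}
    (h : zs.length = 2 ^ j) :
    levelAvg v zs j - c = ((2 : ℝ) ^ j)⁻¹ • (zs.map fun z => v z - c).sum := by
  have e : (zs.map fun z => v z - c).sum = (zs.map v).sum - zs.length • c := by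
    clear h
    induction zs with
    | nil => simp
    | cons z zs ih =>
      simp only [List.map_cons, List.sum_cons, ih, List.length_cons, add_smul, one_smul]
      abel
  have h2 : (2 : ℝ) ^ j ≠ 0 := by positivity
  rw [e, h, levelAvg, List.take_of_length_le h.le, smul_sub, ← Nat.cast_smul_eq_nsmul ℝ,
    smul_smul]
  push_cast
  rw [inv_mul_cancel₀ h2, one_smul]

theorem norm_levelAvg_le {v : S × A × S → V} {B : ℝ} (hv : ∀ z, ‖v z‖ ≤ B)
    (hB : 0 ≤ B) (zs : List (S × A × S)) (j : ℕ) : ‖levelAvg v zs j‖ ≤ B := by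
  have h : ∀ ws : List (S × A × S), ‖(ws.map v).sum‖ ≤ ws.length * B := by
    intro ws
    induction ws with
    | nil => simp
    | cons z ws ih =>
      simp only [List.map_cons, List.sum_cons, List.length_cons]
      push_cast
      linarith [norm_add_le (v z) (ws.map v).sum, hv z]
  rw [levelAvg, norm_smul, norm_inv, Real.norm_of_nonneg (by positivity), inv_mul_le_iff₀
    (by positivity)]
  refine (h _).trans (mul_le_mul_of_nonneg_right ?_ hB)
  have : (zs.take (2 ^ j)).length ≤ 2 ^ j := List.length_take_le _ _
  exact_mod_cast this

theorem ev_levelAvg (M : CMDP S A) (π : Policy S A) (v : S × A × S → V) {j N : ℕ}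
    (h : 2 ^ j ≤ N) (s : S) :
    ev (rollout M π N s) (fun zs => levelAvg v zs j) =
      ev (rollout M π (2 ^ j) s) (fun zs => levelAvg v zs j) := by
  rw [← ev_rollout_take M π h s fun zs => levelAvg v zs j]
  simp_rw [← levelAvg_eq_take]

theorem CMDP.Ergodic.norm_ev_levelAvg_sub_le (hM : M.Ergodic) {π : Policy S A} {τ : ℕ}
    (hτ : M.mixTime π ≤ τ) {v : S × A × S → V} {B : ℝ} (hB : 0 ≤ B) (hv : ∀ z, ‖v z‖ ≤ B)
    (j : ℕ) (s : S) :
    ‖ev (rollout M π (2 ^ j) s) (fun zs => levelAvg v zs j) - statMean M π v‖ ≤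
      4 * τ * B / 2 ^ j := by
  have hF := finSupp_rollout M π (2 ^ j) s
  have e : ev (rollout M π (2 ^ j) s) (fun zs => levelAvg v zs j) - statMean M π v =
      ((2 : ℝ) ^ j)⁻¹ •
        ev (rollout M π (2 ^ j) s) (fun zs => (zs.map fun z => v z - statMean M π v).sum) := by
    rw [← hF.ev_smul]
    conv_lhs => rw [← hF.ev_const (statMean M π v), ← hF.ev_sub]
    exact FinSupp.ev_congr fun zs hzs => levelAvg_sub_const v _ (length_of_mem_rollout hzs)
  rw [e, norm_smul, norm_inv, Real.norm_of_nonneg (by positivity), div_eq_inv_mul]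
  exact mul_le_mul_of_nonneg_left (hM.norm_ev_rollout_sum_le hτ hB hv _ s) (by positivity)

theorem CMDP.Ergodic.ev_levelAvg_sub_sq_le (hM : M.Ergodic) {π : Policy S A} {τ : ℕ}
    (hτ : M.mixTime π ≤ τ) {v : S × A × S → V} {B : ℝ} (hB : 0 ≤ B) (hv : ∀ z, ‖v z‖ ≤ B)
    {j N : ℕ} (hj : 2 ^ j ≤ N) (s : S) :
    ev (rollout M π N s) (fun zs => ‖levelAvg v zs j - statMean M π v‖ ^ 2) ≤
      (4 + 16 * τ) * B ^ 2 / 2 ^ j := by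
  have hF := finSupp_rollout M π (2 ^ j) s
  have e1 := ev_rollout_take M π hj s fun zs => ‖levelAvg v zs j - statMean M π v‖ ^ 2
  simp_rw [← levelAvg_eq_take] at e1
  have e2 : ev (rollout M π (2 ^ j) s) (fun zs => ‖levelAvg v zs j - statMean M π v‖ ^ 2) =
      (((2 : ℝ) ^ j)⁻¹) ^ 2 * ev (rollout M π (2 ^ j) s)
        (fun zs => ‖(zs.map fun z => v z - statMean M π v).sum‖ ^ 2) := by
    rw [← hF.ev_mul]
    refine FinSupp.ev_congr fun zs hzs => ?_
    rw [levelAvg_sub_const v _ (length_of_mem_rollout hzs), norm_smul, norm_inv,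
      Real.norm_of_nonneg (by positivity), mul_pow]
  have hc : ∀ z, ‖v z - statMean M π v‖ ≤ 2 * B := fun z =>
    (norm_sub_le _ _).trans (by linarith [hv z, norm_statMean_le M π hv])
  have h := ev_rollout_norm_sum_sq_le M π (by linarith) hc
    (hM.norm_ev_rollout_sum_le hτ hB hv) (2 ^ j) s
  rw [e1, e2]
  -- Centred terms are bounded by `2B` and `R = 4τB`, which produces `4 + 16τ`.
  calc _ ≤ (((2 : ℝ) ^ j)⁻¹) ^ 2 *
        (((2 ^ j : ℕ) : ℝ) * ((2 * B) ^ 2 + 2 * (2 * B) * (4 * τ * B))) :=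
        mul_le_mul_of_nonneg_left h (by positivity)
    _ = (4 + 16 * τ) * B ^ 2 / 2 ^ j := by push_cast; field_simp; ring

end Rollout

/-! ### Bias and second moment of multi-level estimates -/

section MultiLevel

variable {S A : Type*} [Fintype S] [DecidableEq S] [Fintype A] {M : CMDP S A}
  {V : Type*} [NormedAddCommGroup V] [InnerProductSpace ℝ V]

/-- The geometric level, with all levels above `J` merged into `J + 1`. -/
def truncGeom (J : ℕ) : PMF ℕ := geomHalf.map fun q => min q (J + 1)

theorem support_truncGeom (J : ℕ) : (truncGeom J).support ⊆ Finset.range (J + 2) := by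
  intro q hq
  rw [truncGeom, PMF.mem_support_map_iff] at hq
  obtain ⟨a, -, rfl⟩ := hq
  simp

theorem finSupp_truncGeom (J : ℕ) : FinSupp (truncGeom J) :=
  (Finset.finite_toSet _).subset (support_truncGeom J)

theorem prob_truncGeom {J q : ℕ} (hq : q ≤ J) :
    prob (truncGeom J) q = if q = 0 then 0 else ((2 : ℝ) ^ q)⁻¹ := by
  have h : truncGeom J q = geomHalf q := by
    rw [truncGeom, PMF.map_apply, tsum_eq_single q]
    · rw [if_pos (by lia)]
    · intro b hb
      rw [if_neg (by lia)]
  have h2 : geomHalf q = if q = 0 then 0 else (2⁻¹ : ENNReal) ^ q := rfl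
  rw [prob, h, h2]
  split_ifs <;> simp

/-- The joint law of the level and of the trajectory that a multi-level estimate uses. -/
def sampleLaw (M : CMDP S A) (π : Policy S A) (Tmax : ℕ) (s : S) :
    PMF (ℕ × List (S × A × S)) :=
  (truncGeom (Nat.log 2 Tmax)).bind fun q =>
    (rollout M π (trajLen Tmax q) s).map fun zs => (q, zs)

theorem finSupp_sampleLaw (M : CMDP S A) (π : Policy S A) (Tmax : ℕ) (s : S) :
    FinSupp (sampleLaw M π Tmax s) :=
  (finSupp_truncGeom _).bind fun _ => (finSupp_rollout M π _ s).map _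

theorem ev_sampleLaw {W : Type*} [NormedAddCommGroup W] [NormedSpace ℝ W]
    (M : CMDP S A) (π : Policy S A) (Tmax : ℕ) (s : S) (F : ℕ × List (S × A × S) → W) :
    ev (sampleLaw M π Tmax s) F = ev (truncGeom (Nat.log 2 Tmax)) fun q =>
      ev (rollout M π (trajLen Tmax q) s) fun zs => F (q, zs) := by
  rw [sampleLaw, (finSupp_truncGeom _).ev_bind fun _ => (finSupp_rollout M π _ s).map _]
  simp_rw [(finSupp_rollout M π _ s).ev_map]

theorem pow_le_iff_le_log {Tmax q : ℕ} (hT : Tmax ≠ 0) : 2 ^ q ≤ Tmax ↔ q ≤ Nat.log 2 Tmax :=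
  (Nat.le_log_iff_pow_le (by norm_num) hT).symm

/-- All levels with `2 ^ q > Tmax` run a single step and yield the same output, so merging them does
not change the law. This makes every law of the algorithm finitely supported. -/
theorem geomHalf_bind_rollout {Y : Type*} (M : CMDP S A) (π : Policy S A) {Tmax : ℕ}
    (hT : Tmax ≠ 0) (s : S) (F : ℕ → List (S × A × S) → Y)
    (hF : ∀ q q', ¬ 2 ^ q ≤ Tmax → ¬ 2 ^ q' ≤ Tmax → F q = F q') :
    (geomHalf.bind fun q => (rollout M π (trajLen Tmax q) s).map (F q)) =
      (sampleLaw M π Tmax s).map fun w => F w.1 w.2 := by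
  rw [sampleLaw, truncGeom, PMF.bind_map, PMF.map_bind]
  congr 1
  funext q
  simp only [Function.comp, PMF.map_comp]
  rcases le_or_gt q (Nat.log 2 Tmax + 1) with h | h
  · rw [min_eq_left h]; rfl
  · rw [min_eq_right h.le]
    have h1 : ¬ 2 ^ q ≤ Tmax := by rw [pow_le_iff_le_log hT]; lia
    have h2 : ¬ 2 ^ (Nat.log 2 Tmax + 1) ≤ Tmax := by rw [pow_le_iff_le_log hT]; lia
    rw [trajLen, trajLen, if_neg h1, if_neg h2, hF q _ h1 h2]
    rfl

/-- The probability `2^{-q}` cancels the factor `2^q`, and the differences telescope to the top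
level. -/
theorem ev_mlmc (M : CMDP S A) (π : Policy S A) {Tmax : ℕ} (hT : Tmax ≠ 0) (s : S)
    (v : S × A × S → V) :
    ev (sampleLaw M π Tmax s) (fun w => mlmc Tmax v w.2 w.1) =
      ev (rollout M π (2 ^ Nat.log 2 Tmax) s) fun zs => levelAvg v zs (Nat.log 2 Tmax) := by
  set J := Nat.log 2 Tmax with hJ
  set L : ℕ → V := fun j => ev (rollout M π (2 ^ j) s) fun zs => levelAvg v zs j with hL
  have hq : ∀ q, ev (rollout M π (trajLen Tmax q) s) (fun zs => mlmc Tmax v zs q) =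
      L 0 + if q ≤ J then (2 : ℝ) ^ q • (L q - L (q - 1)) else 0 := by
    intro q
    have hF := finSupp_rollout M π (trajLen Tmax q) s
    simp only [mlmc]
    rw [hF.ev_add, ev_levelAvg M π v (by simp [trajLen]) s]
    congr 1
    by_cases h : 2 ^ q ≤ Tmax
    · have hq' := (pow_le_iff_le_log hT).1 h
      have hlen : trajLen Tmax q = 2 ^ q := by
        have : 0 < 2 ^ q := by positivity
        rw [trajLen, if_pos h]; lia
      simp only [if_pos h]
      rw [if_pos (show q ≤ J from hq')]
      have hlen' : 2 ^ (q - 1) ≤ trajLen Tmax q := by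
        rw [hlen]; exact Nat.pow_le_pow_right (by norm_num) (Nat.sub_le _ _)
      rw [hF.ev_smul, hF.ev_sub, ev_levelAvg M π v hlen.ge s, ev_levelAvg M π v hlen' s]
    · have hq' : ¬ q ≤ J := fun h' => h ((pow_le_iff_le_log hT).2 h')
      simp only [if_neg h, if_neg hq']
      exact hF.ev_const 0
  rw [ev_sampleLaw]
  simp_rw [hq]
  rw [(finSupp_truncGeom _).ev_add, (finSupp_truncGeom _).ev_const,
    ev_eq_sum (support_truncGeom _), Finset.sum_range_succ, Finset.sum_range_succ']
  have h1 : ∀ q ∈ Finset.range J, (prob (truncGeom J) (q + 1) •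
      if q + 1 ≤ J then (2 : ℝ) ^ (q + 1) • (L (q + 1) - L (q + 1 - 1)) else 0) =
      L (q + 1) - L q := by
    intro q hq
    have hq' : q + 1 ≤ J := Finset.mem_range.1 hq
    rw [if_pos hq', prob_truncGeom hq', if_neg (Nat.succ_ne_zero q), smul_smul,
      inv_mul_cancel₀ (by positivity), one_smul, Nat.add_sub_cancel]
  rw [Finset.sum_congr rfl h1, Finset.sum_range_sub, if_neg (by lia : ¬ J + 1 ≤ J),
    prob_truncGeom (Nat.zero_le J)]
  simp [hL]

theorem CMDP.Ergodic.norm_ev_mlmc_sub_le (hM : M.Ergodic) {π : Policy S A} {τ : ℕ}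
    (hτ : M.mixTime π ≤ τ) {v : S × A × S → V} {B : ℝ} (hB : 0 ≤ B) (hv : ∀ z, ‖v z‖ ≤ B)
    {Tmax : ℕ} (hT : Tmax ≠ 0) (s : S) :
    ‖ev (sampleLaw M π Tmax s) (fun w => mlmc Tmax v w.2 w.1) - statMean M π v‖ ≤
      8 * τ / Tmax * B := by
  rw [ev_mlmc M π hT]
  refine (hM.norm_ev_levelAvg_sub_le hτ hB hv _ s).trans ?_
  -- The top level uses more than half of `Tmax` samples, which doubles the constant `4τ`.
  have h : (Tmax : ℝ) ≤ 2 * 2 ^ Nat.log 2 Tmax := by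
    have := Nat.lt_pow_succ_log_self (b := 2) (by norm_num) Tmax
    rw [Nat.succ_eq_add_one, pow_succ'] at this
    exact_mod_cast this.le
  have hT' : (0 : ℝ) < Tmax := by positivity
  rw [div_mul_eq_mul_div, div_le_div_iff₀ (by positivity) hT']
  have : 0 ≤ 4 * τ * B := by positivity
  nlinarith

theorem norm_add_sq_le_two (x y : V) : ‖x + y‖ ^ 2 ≤ 2 * ‖x‖ ^ 2 + 2 * ‖y‖ ^ 2 := by
  have h := norm_add_le x y
  nlinarith [norm_nonneg (x + y), sq_nonneg (‖x‖ - ‖y‖), norm_nonneg x, norm_nonneg y]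

/-- The correction at level `q` has second moment of order `4^q · τB²/2^q`, drawn with probability
`2^{-q}`. Each level therefore contributes order `τB²`, and there are `Nat.log 2 Tmax` of them. -/
theorem CMDP.Ergodic.ev_norm_mlmc_sq_le (hM : M.Ergodic) {π : Policy S A} {τ : ℕ}
    (hτ : M.mixTime π ≤ τ) {v : S × A × S → V} {B : ℝ} (hB : 0 ≤ B) (hv : ∀ z, ‖v z‖ ≤ B)
    {Tmax : ℕ} (hT : Tmax ≠ 0) (s : S) :
    ev (sampleLaw M π Tmax s) (fun w => ‖mlmc Tmax v w.2 w.1‖ ^ 2) ≤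
      (2 + 12 * (4 + 16 * τ) * Nat.log 2 Tmax) * B ^ 2 := by
  set J := Nat.log 2 Tmax with hJ
  set κ := (4 + 16 * (τ : ℝ)) * B ^ 2 with hκ
  have hκ0 : 0 ≤ κ := by positivity
  have hbase : ∀ zs : List (S × A × S), ‖levelAvg v zs 0‖ ^ 2 ≤ B ^ 2 := fun zs =>
    pow_le_pow_left₀ (norm_nonneg _) (norm_levelAvg_le hv hB zs 0) 2
  -- Level 0 is set aside because truncated subtraction breaks `2 ^ q = 2 * 2 ^ (q - 1)` there; it
  -- has probability zero.
  have hq : ∀ q, 1 ≤ q ∨ J < q → ev (rollout M π (trajLen Tmax q) s)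
      (fun zs => ‖mlmc Tmax v zs q‖ ^ 2) ≤
      2 * B ^ 2 + if q ≤ J then 12 * κ * (2 : ℝ) ^ q else 0 := by
    intro q hq1
    have hF := finSupp_rollout M π (trajLen Tmax q) s
    by_cases h : 2 ^ q ≤ Tmax
    · have hq' := (pow_le_iff_le_log hT).1 h
      have hlen : trajLen Tmax q = 2 ^ q := by
        have : 0 < 2 ^ q := by positivity
        rw [trajLen, if_pos h]; lia
      rw [if_pos hq']
      have hlen' : 2 ^ (q - 1) ≤ trajLen Tmax q := by
        rw [hlen]; exact Nat.pow_le_pow_right (by norm_num) (Nat.sub_le _ _)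
      have h1 := hM.ev_levelAvg_sub_sq_le hτ hB hv hlen.ge s
      have h2 := hM.ev_levelAvg_sub_sq_le hτ hB hv hlen' s
      set m := statMean M π v
      have hpt : ∀ zs ∈ (rollout M π (trajLen Tmax q) s).support, ‖mlmc Tmax v zs q‖ ^ 2 ≤
          2 * B ^ 2 + (4 * (2 ^ q) ^ 2) * (‖levelAvg v zs q - m‖ ^ 2 +
            ‖levelAvg v zs (q - 1) - m‖ ^ 2) := by
        intro zs _
        rw [mlmc, if_pos h]
        have e1 := norm_add_sq_le_two (levelAvg v zs 0)
          ((2 : ℝ) ^ q • (levelAvg v zs q - levelAvg v zs (q - 1)))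
        have e2 := norm_add_sq_le_two (levelAvg v zs q - m) (-(levelAvg v zs (q - 1) - m))
        have e3 : levelAvg v zs q - m + -(levelAvg v zs (q - 1) - m) =
          levelAvg v zs q - levelAvg v zs (q - 1) := by abel
        rw [e3, norm_neg] at e2
        rw [norm_smul, Real.norm_of_nonneg (by positivity), mul_pow] at e1
        have e4 := mul_le_mul_of_nonneg_left e2 (show (0 : ℝ) ≤ 2 * (2 ^ q) ^ 2 by positivity)
        linarith [hbase zs]
      refine (hF.ev_mono hpt).trans ?_
      rw [hF.ev_add, hF.ev_const, hF.ev_mul, hF.ev_add]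
      have e5 : (2 : ℝ) ^ q = 2 * 2 ^ (q - 1) := by
        rw [← pow_succ', Nat.sub_add_cancel (by lia)]
      -- Halving the sample doubles the variance, so the two averages together cost `3κ / 2 ^ q`;
      -- with the prefactor `4 (2 ^ q)²` this gives `12 κ 2 ^ q`.
      have e6 : κ / 2 ^ (q - 1) = 2 * (κ / 2 ^ q) := by
        rw [e5]; field_simp
      rw [← hκ] at h1 h2
      rw [e6] at h2
      have e7 := mul_le_mul_of_nonneg_left (add_le_add h1 h2)
        (show (0 : ℝ) ≤ 4 * (2 ^ q) ^ 2 by positivity)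
      have e8 : 4 * ((2 : ℝ) ^ q) ^ 2 * (κ / 2 ^ q + 2 * (κ / 2 ^ q)) = 12 * κ * 2 ^ q := by
        field_simp; ring
      linarith
    · have hq' : ¬ q ≤ J := fun h' => h ((pow_le_iff_le_log hT).2 h')
      rw [if_neg hq', add_zero]
      refine hF.ev_le fun zs _ => ?_
      rw [mlmc, if_neg h, add_zero]
      nlinarith [hbase zs, sq_nonneg B]
  have hG := finSupp_truncGeom J
  rw [ev_sampleLaw]
  have hle : ∀ q ∈ (truncGeom J).support, ev (rollout M π (trajLen Tmax q) s)
      (fun zs => ‖mlmc Tmax v zs q‖ ^ 2) ≤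
      2 * B ^ 2 + if q ≤ J then 12 * κ * (2 : ℝ) ^ q else 0 := by
    intro q hqs
    refine hq q ?_
    rcases Nat.eq_zero_or_pos q with rfl | h
    · exfalso
      rw [PMF.mem_support_iff] at hqs
      have := prob_truncGeom (Nat.zero_le J)
      rw [if_pos rfl, prob, ENNReal.toReal_eq_zero_iff] at this
      exact this.elim hqs (PMF.apply_ne_top _ _)
    · exact Or.inl h
  refine (hG.ev_mono hle).trans ?_
  rw [hG.ev_add, hG.ev_const, ev_eq_sum (support_truncGeom _), Finset.sum_range_succ,
    Finset.sum_range_succ']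
  have h1 : ∀ q ∈ Finset.range J, (prob (truncGeom J) (q + 1) •
      if q + 1 ≤ J then 12 * κ * (2 : ℝ) ^ (q + 1) else 0) = 12 * κ := by
    intro q hq
    have hq' : q + 1 ≤ J := Finset.mem_range.1 hq
    rw [if_pos hq', prob_truncGeom hq', if_neg (Nat.succ_ne_zero q), smul_eq_mul]
    field_simp
  rw [Finset.sum_congr rfl h1, if_neg (by lia : ¬ J + 1 ≤ J), prob_truncGeom (Nat.zero_le J)]
  simp only [Finset.sum_const, Finset.card_range, if_pos, zero_smul, smul_zero, add_zero,
    nsmul_eq_mul]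
  apply le_of_eq
  rw [hκ]; ring

end MultiLevel

/-! ### Stochastic approximation with an affine mean field -/

section StochasticApproximation

variable {S A : Type*} [Fintype S] [DecidableEq S] [Fintype A] {M : CMDP S A}
  {V : Type*} [NormedAddCommGroup V] [InnerProductSpace ℝ V]

/-- One step of stochastic approximation with multi-level estimates of the field `v`. -/
def saStep (M : CMDP S A) (π : Policy S A) (Tmax : ℕ) (γ : ℝ) (v : V → S × A × S → V)
    (x : S × V) : PMF (S × V) :=
  (sampleLaw M π Tmax x.1).map fun w =>
    (finalState x.1 w.2, x.2 - γ • mlmc Tmax (v x.2) w.2 w.1)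

theorem finSupp_saStep (M : CMDP S A) (π : Policy S A) (Tmax : ℕ) (γ : ℝ)
    (v : V → S × A × S → V) (x : S × V) : FinSupp (saStep M π Tmax γ v x) :=
  (finSupp_sampleLaw M π Tmax x.1).map _

/-- The field `v` has a linear coercive stationary mean with zero `xs`. -/
structure LinField (M : CMDP S A) (π : Policy S A) (v : V → S × A × S → V) (Kb : V →ₗ[ℝ] V)
    (xs : V) (a B κ : ℝ) : Prop where
  a_pos : 0 < a
  B_nonneg : 0 ≤ B
  κ_pos : 0 < κ
  bound : ∀ x z, ‖v x z‖ ≤ a * ‖x - xs‖ + B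
  mean : ∀ x, statMean M π (v x) = Kb (x - xs)
  coer : ∀ x, κ * ‖x‖ ^ 2 ≤ inner ℝ x (Kb x)
  op : ∀ x, ‖Kb x‖ ≤ a * ‖x‖

/-- The step size `γ` is small, and the multi-level horizon large, for a field with constants
`a` and `κ` along a chain with mixing time `τ`. -/
structure StepSmall (τ Tmax : ℕ) (γ a κ : ℝ) : Prop where
  T_ne : Tmax ≠ 0
  pos : 0 ≤ γ
  le_one : γ * κ ≤ 1
  bias : 4 * (8 * τ / Tmax) * a ≤ κ
  var : 8 * γ * (2 + 12 * (4 + 16 * τ) * Nat.log 2 Tmax) * a ^ 2 ≤ κ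

theorem affine_rec_bound {e : ℕ → ℝ} {c m : ℝ} (hc1 : c ≤ 1) (hm : 0 ≤ m)
    (h : ∀ n, e (n + 1) ≤ (1 - c) * e n + c * m) (n : ℕ) :
    e n ≤ (1 - c) ^ n * e 0 + m := by
  induction n with
  | zero => simpa using hm
  | succ n ih =>
    have := mul_le_mul_of_nonneg_left ih (show 0 ≤ 1 - c by linarith)
    rw [pow_succ]
    linarith [h n]

theorem ev_iterLaw_succ {X W : Type*} [NormedAddCommGroup W] [NormedSpace ℝ W]
    {step : X → PMF X} (h : ∀ x, FinSupp (step x)) (n : ℕ) (x : X) (f : X → W) :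
    ev (iterLaw step (n + 1) x) f = ev (iterLaw step n x) fun y => ev (step y) f :=
  (finSupp_iterLaw h n x).ev_bind h f

variable {π : Policy S A} {v : V → S × A × S → V} {Kb : V →ₗ[ℝ] V} {xs : V} {a B κ γ : ℝ}
  {τ Tmax : ℕ}

/-- In the expanded square, coercivity yields `-2γκ r²`. The bias and the second moment grow with
the distance `r`, and the conditions in `StepSmall` let half of this decrease absorb them. -/
theorem ev_saStep_sq_le (hM : M.Ergodic) (hτ : M.mixTime π ≤ τ)
    (hv : LinField M π v Kb xs a B κ) (hγ : StepSmall τ Tmax γ a κ) (x : S × V) :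
    ev (saStep M π Tmax γ v x) (fun y => ‖y.2 - xs‖ ^ 2) ≤
      (1 - γ * κ) * ‖x.2 - xs‖ ^ 2 + γ * κ * (B ^ 2 / (2 * a ^ 2)) := by
  have hF := finSupp_sampleLaw M π Tmax x.1
  have ha := hv.a_pos
  have hB := hv.B_nonneg
  have hκ := hv.κ_pos
  have hγ0 := hγ.pos
  set r := ‖x.2 - xs‖ with hr
  have hr0 : 0 ≤ r := norm_nonneg _
  have hb0 : 0 ≤ a * r + B := by positivity
  have hbias := hM.norm_ev_mlmc_sub_le hτ hb0 (hv.bound x.2) hγ.T_ne x.1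
  have hvar := hM.ev_norm_mlmc_sq_le hτ hb0 (hv.bound x.2) hγ.T_ne x.1
  set σ := (2 + 12 * (4 + 16 * (τ : ℝ)) * Nat.log 2 Tmax)
  set ε := 8 * (τ : ℝ) / Tmax
  have hε0 : 0 ≤ ε := by positivity
  set m := ev (sampleLaw M π Tmax x.1) (fun w => mlmc Tmax (v x.2) w.2 w.1) with hm
  rw [hv.mean] at hbias
  have hexp : ev (saStep M π Tmax γ v x) (fun y => ‖y.2 - xs‖ ^ 2) =
      r ^ 2 - 2 * γ * inner ℝ (x.2 - xs) m +
        γ ^ 2 * ev (sampleLaw M π Tmax x.1) (fun w => ‖mlmc Tmax (v x.2) w.2 w.1‖ ^ 2) := by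
    rw [saStep, hF.ev_map]
    have e : ∀ w : ℕ × List (S × A × S), ‖x.2 - γ • mlmc Tmax (v x.2) w.2 w.1 - xs‖ ^ 2 =
        r ^ 2 - 2 * γ * inner ℝ (x.2 - xs) (mlmc Tmax (v x.2) w.2 w.1) +
          γ ^ 2 * ‖mlmc Tmax (v x.2) w.2 w.1‖ ^ 2 := by
      intro w
      rw [sub_right_comm, norm_sub_sq_real, norm_smul, mul_pow, inner_smul_right,
        Real.norm_eq_abs, sq_abs]
      ring
    simp_rw [e]
    rw [hF.ev_add, hF.ev_sub, hF.ev_const, hF.ev_mul, hF.ev_mul]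
    congr 3
    exact (hF.map_ev (innerₗ V (x.2 - xs)) fun w => mlmc Tmax (v x.2) w.2 w.1).symm
  rw [hexp]
  have h1 := hv.coer (x.2 - xs)
  rw [← hr] at h1
  have h2 : inner ℝ (x.2 - xs) (Kb (x.2 - xs)) - r * (ε * (a * r + B)) ≤
      inner ℝ (x.2 - xs) m := by
    have e1 : inner ℝ (x.2 - xs) m = inner ℝ (x.2 - xs) (Kb (x.2 - xs)) +
        inner ℝ (x.2 - xs) (m - Kb (x.2 - xs)) := by rw [← inner_add_right]; simp
    have e2 := abs_real_inner_le_norm (x.2 - xs) (m - Kb (x.2 - xs))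
    have e3 := mul_le_mul_of_nonneg_left hbias hr0
    have e4 := neg_abs_le (inner ℝ (x.2 - xs) (m - Kb (x.2 - xs)))
    rw [← hr] at e2
    linarith
  -- With `B = a y` the field is bounded by `a (r + y)`, and the claim becomes homogeneous in `r`
  -- and `y`.
  obtain ⟨y, hy0, hy⟩ : ∃ y, 0 ≤ y ∧ B = a * y := ⟨B / a, by positivity, by field_simp⟩
  have hy2 : B ^ 2 / (2 * a ^ 2) = y ^ 2 / 2 := by rw [hy]; field_simp
  rw [hy2]
  rw [hy] at h2 hvar
  have h3 : r * (ε * (a * r + a * y)) ≤ κ / 4 * (r * (r + y)) := by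
    have h := mul_le_mul_of_nonneg_right (show ε * a ≤ κ / 4 by linarith [hγ.bias])
      (show 0 ≤ r * (r + y) by positivity)
    linarith
  have h4 : γ ^ 2 * (σ * (a * r + a * y) ^ 2) ≤ γ * (κ / 8 * (r + y) ^ 2) := by
    have h := mul_le_mul_of_nonneg_right (show γ * σ * a ^ 2 ≤ κ / 8 by linarith [hγ.var])
      (show 0 ≤ (r + y) ^ 2 by positivity)
    have h' := mul_le_mul_of_nonneg_left h hγ0
    linarith
  have h5 := mul_le_mul_of_nonneg_left hvar (sq_nonneg γ)
  have h6 : κ * r ^ 2 - κ / 4 * (r * (r + y)) ≤ inner ℝ (x.2 - xs) m := by linarith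
  have h7 := mul_le_mul_of_nonneg_left h6 (show 0 ≤ 2 * γ by linarith)
  -- After all bounds, the two sides differ by exactly 3/8 of this square.
  have h8 : 0 ≤ γ * κ * (r - y) ^ 2 := by positivity
  linarith

theorem ev_saStep_iter_sq_le (hM : M.Ergodic) (hτ : M.mixTime π ≤ τ)
    (hv : LinField M π v Kb xs a B κ) (hγ : StepSmall τ Tmax γ a κ) (x : S × V) (n : ℕ) :
    ev (iterLaw (saStep M π Tmax γ v) n x) (fun y => ‖y.2 - xs‖ ^ 2) ≤
      ‖x.2 - xs‖ ^ 2 + B ^ 2 / (2 * a ^ 2) := by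
  have hS := finSupp_saStep M π Tmax γ v
  have hc0 : 0 ≤ γ * κ := mul_nonneg hγ.pos hv.κ_pos.le
  have ha := hv.a_pos
  have h := affine_rec_bound (e := fun n =>
    ev (iterLaw (saStep M π Tmax γ v) n x) (fun y => ‖y.2 - xs‖ ^ 2)) hγ.le_one
    (show 0 ≤ B ^ 2 / (2 * a ^ 2) by positivity) (fun n => by
      have hI := finSupp_iterLaw hS n x
      change ev (iterLaw _ (n + 1) x) _ ≤ _
      rw [ev_iterLaw_succ hS]
      refine (hI.ev_mono fun y _ => ev_saStep_sq_le hM hτ hv hγ y).trans_eq ?_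
      rw [hI.ev_add, hI.ev_const, hI.ev_mul]) n
  refine h.trans ?_
  simp only [iterLaw, ev_pure]
  gcongr
  exact mul_le_of_le_one_left (sq_nonneg _) (pow_le_one₀ (by linarith [hγ.le_one]) (by linarith))

/-- The squared norm shrinks by `1 - 2γκ + γ²a²`. Since `γa² ≤ κ`, this is at most `1 - γκ ≤ (1 -
γκ/2)²`. -/
theorem LinField.norm_sub_smul_le (hv : LinField M π v Kb xs a B κ)
    (hγ : StepSmall τ Tmax γ a κ) (y : V) :
    ‖y - γ • Kb y‖ ≤ (1 - γ * κ / 2) * ‖y‖ := by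
  have ha := hv.a_pos
  have hκ := hv.κ_pos
  have hγ0 := hγ.pos
  have hγa : γ * a ^ 2 ≤ κ := by
    have h1 := hγ.var
    have h2 : 0 ≤ γ * a ^ 2 * (12 * (4 + 16 * (τ : ℝ)) * Nat.log 2 Tmax) := by positivity
    have h3 : 0 ≤ γ * a ^ 2 := by positivity
    linarith
  have h1 : 0 ≤ 1 - γ * κ / 2 := by linarith [hγ.le_one]
  refine le_of_sq_le_sq ?_ (by positivity)
  rw [norm_sub_sq_real, norm_smul, mul_pow, inner_smul_right, Real.norm_eq_abs, sq_abs, mul_pow]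
  have h2 := mul_le_mul_of_nonneg_left (hv.coer y) hγ0
  have h3 := mul_le_mul_of_nonneg_left
    (pow_le_pow_left₀ (norm_nonneg _) (hv.op y) 2) (sq_nonneg γ)
  have h4 := mul_le_mul_of_nonneg_right (mul_le_mul_of_nonneg_left hγa hγ0) (sq_nonneg ‖y‖)
  have h5 : 0 ≤ (γ * κ / 2) ^ 2 * ‖y‖ ^ 2 := by positivity
  nlinarith

/-- The mean field is affine, so the mean iterate follows the deterministic contraction, perturbed
only by the bias of the estimates. The noise enters through the root mean square distance alone,
multiplied by that bias, so the limit error is not of order `√γ`. -/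
theorem norm_ev_saStep_iter_sub_le (hM : M.Ergodic) (hτ : M.mixTime π ≤ τ)
    (hv : LinField M π v Kb xs a B κ) (hγ : StepSmall τ Tmax γ a κ) (x : S × V) (n : ℕ) :
    ‖ev (iterLaw (saStep M π Tmax γ v) n x) (fun y => y.2) - xs‖ ≤
      (1 - γ * κ / 2) ^ n * ‖x.2 - xs‖ +
        2 * (8 * τ / Tmax) / κ * (a * √(‖x.2 - xs‖ ^ 2 + B ^ 2 / (2 * a ^ 2)) + B) := by
  have hS := finSupp_saStep M π Tmax γ v
  have ha := hv.a_pos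
  have hB := hv.B_nonneg
  have hκ := hv.κ_pos
  have hγ0 := hγ.pos
  set ε := 8 * (τ : ℝ) / Tmax
  have hε0 : 0 ≤ ε := by positivity
  set R := √(‖x.2 - xs‖ ^ 2 + B ^ 2 / (2 * a ^ 2))
  have hR0 : 0 ≤ R := Real.sqrt_nonneg _
  have hstep : ∀ y : S × V, ‖ev (saStep M π Tmax γ v y) (fun y => y.2 - xs) -
      ((y.2 - xs) - γ • Kb (y.2 - xs))‖ ≤ γ * (ε * (a * ‖y.2 - xs‖ + B)) := by
    intro y
    have hF := finSupp_sampleLaw M π Tmax y.1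
    have hbias := hM.norm_ev_mlmc_sub_le hτ (by positivity) (hv.bound y.2) hγ.T_ne y.1
    rw [hv.mean] at hbias
    rw [saStep, hF.ev_map, hF.ev_sub, hF.ev_sub, hF.ev_const, hF.ev_const, hF.ev_smul]
    have e : ∀ m : V, y.2 - γ • m - xs - (y.2 - xs - γ • Kb (y.2 - xs)) =
        -(γ • (m - Kb (y.2 - xs))) := by intro m; rw [smul_sub]; abel
    rw [e, norm_neg, norm_smul, Real.norm_of_nonneg hγ0]
    exact mul_le_mul_of_nonneg_left hbias hγ0
  have h := affine_rec_bound (e := fun n =>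
    ‖ev (iterLaw (saStep M π Tmax γ v) n x) (fun y => y.2 - xs)‖) (c := γ * κ / 2)
    (m := 2 * ε / κ * (a * R + B)) (by linarith [hγ.le_one]) (by positivity)
    (fun n => by
      have hI := finSupp_iterLaw hS n x
      change ‖ev (iterLaw _ (n + 1) x) _‖ ≤ _
      rw [ev_iterLaw_succ hS]
      set q := iterLaw (saStep M π Tmax γ v) n x
      have e1 : ev q (fun y => ev (saStep M π Tmax γ v y) fun y => y.2 - xs) =
          (ev q (fun y => y.2 - xs) - γ • Kb (ev q fun y => y.2 - xs)) +
          ev q (fun y => ev (saStep M π Tmax γ v y) (fun y => y.2 - xs) -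
            ((y.2 - xs) - γ • Kb (y.2 - xs))) := by
        rw [hI.map_ev, ← hI.ev_smul, ← hI.ev_sub, ← hI.ev_add]
        simp
      rw [e1]
      refine (norm_add_le _ _).trans ?_
      have e2 := hv.norm_sub_smul_le hγ (ev q fun y => y.2 - xs)
      have e3 : ‖ev q (fun y => ev (saStep M π Tmax γ v y) (fun y => y.2 - xs) -
            ((y.2 - xs) - γ • Kb (y.2 - xs)))‖ ≤ γ * (ε * (a * R + B)) := by
        refine (hI.norm_ev_le _).trans ((hI.ev_mono fun y _ => hstep y).trans ?_)
        rw [hI.ev_mul, hI.ev_mul, hI.ev_add, hI.ev_mul, hI.ev_const]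
        have : ev q (fun y => ‖y.2 - xs‖) ≤ R :=
          (hI.ev_le_sqrt _).trans (Real.sqrt_le_sqrt (ev_saStep_iter_sq_le hM hτ hv hγ x n))
        gcongr
      have e4 : γ * κ / 2 * (2 * ε / κ * (a * R + B)) = γ * (ε * (a * R + B)) := by
        field_simp
      linarith) n
  have hI := finSupp_iterLaw hS n x
  simp only [iterLaw, ev_pure] at h
  rwa [hI.ev_sub, hI.ev_const] at h

end StochasticApproximation

/-! ### Averaged operators under the stationary law -/

section StationaryLaw

variable {S A : Type*} [Fintype S] [DecidableEq S] [Fintype A] {M : CMDP S A}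
  {V : Type*} [NormedAddCommGroup V] [InnerProductSpace ℝ V]

/-- The stationary distribution as a law. -/
def statPMF (M : CMDP S A) (π : Policy S A) : PMF S :=
  Classical.choose (exists_pmf_of_weights (M.statDist π) (M.statDist_isStat π).1
    (M.statDist_isStat π).2.1)

theorem prob_statPMF (M : CMDP S A) (π : Policy S A) (s : S) :
    prob (statPMF M π) s = M.statDist π s :=
  Classical.choose_spec (exists_pmf_of_weights (M.statDist π) (M.statDist_isStat π).1
    (M.statDist_isStat π).2.1) s

/-- The stationary law of a transition. -/
def statLaw (M : CMDP S A) (π : Policy S A) : PMF (S × A × S) :=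
  (statPMF M π).bind (stepLaw M π)

theorem finSupp_statLaw (M : CMDP S A) (π : Policy S A) : FinSupp (statLaw M π) :=
  (finSupp_of_finite _).bind (finSupp_stepLaw M π)

theorem ev_statPMF (M : CMDP S A) (π : Policy S A) (f : S → V) :
    ev (statPMF M π) f = ∑ s, M.statDist π s • f s := by
  rw [ev_eq_sum_univ]
  simp_rw [prob_statPMF]

theorem statMean_eq_ev (M : CMDP S A) (π : Policy S A) (v : S × A × S → V) :
    statMean M π v = ev (statLaw M π) v := by
  rw [statLaw, (finSupp_of_finite _).ev_bind (finSupp_stepLaw M π), ev_statPMF]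
  rfl

theorem ev_statLaw_fst (M : CMDP S A) (π : Policy S A) (f : S → V) :
    ev (statLaw M π) (fun z => f z.1) = ∑ s, M.statDist π s • f s := by
  rw [← statMean_eq_ev, statMean]
  refine Finset.sum_congr rfl fun s _ => ?_
  rw [ev_stepLaw]
  simp_rw [← Finset.sum_smul, sum_prob, one_smul, ← Finset.sum_smul, sum_prob, one_smul]

theorem ev_statLaw_next (M : CMDP S A) (π : Policy S A) (f : S → V) :
    ev (statLaw M π) (fun z => f z.2.2) = ∑ s, M.statDist π s • f s := by
  rw [← statMean_eq_ev, statMean]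
  simp_rw [ev_stepLaw_next]
  exact (M.statDist_isStat π).sum_act f

theorem ev_statLaw_eq (M : CMDP S A) (π : Policy S A) (v : S × A × S → V) :
    ev (statLaw M π) v =
      ∑ s, ∑ a, M.occ π s a • ∑ s', prob (M.P s a) s' • v (s, a, s') := by
  rw [← statMean_eq_ev, statMean]
  simp_rw [ev_stepLaw, Finset.smul_sum, smul_smul, CMDP.occ, mul_assoc]

theorem sum_occ_eq_ev (M : CMDP S A) (π : Policy S A) (f : S → A → V) :
    ∑ s, ∑ a, M.occ π s a • f s a = ev (statLaw M π) fun z => f z.1 z.2.1 := by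
  rw [ev_statLaw_eq]
  simp_rw [← Finset.sum_smul, sum_prob, one_smul]

theorem CMDP.Ergodic.ev_statLaw_sig (hM : M.Ergodic) (π : Policy S A) (g : Sig) :
    ev (statLaw M π) (fun z => M.sig g z.1 z.2.1) = M.J g π := by
  rw [hM.J_eq_statDist, ← sum_occ_eq_ev M π (M.sig g)]
  simp only [CMDP.occ, CMDP.sigBar, smul_eq_mul, mul_assoc, Finset.mul_sum]

/-- The stationary mean of a family of linear maps. -/
def meanOp (M : CMDP S A) (π : Policy S A) (k : S × A × S → V →ₗ[ℝ] V) : V →ₗ[ℝ] V where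
  toFun x := ev (statLaw M π) fun z => k z x
  map_add' x y := by simp_rw [map_add]; exact (finSupp_statLaw M π).ev_add _ _
  map_smul' c x := by simp_rw [map_smul]; exact (finSupp_statLaw M π).ev_smul _ _

theorem inner_meanOp (M : CMDP S A) (π : Policy S A) (k : S × A × S → V →ₗ[ℝ] V) (x y : V) :
    inner ℝ y (meanOp M π k x) = ev (statLaw M π) fun z => inner ℝ y (k z x) :=
  (finSupp_statLaw M π).map_ev (innerₗ V y) fun z => k z x

theorem norm_le_of_coercive {K : V →ₗ[ℝ] V} {κ : ℝ} (hκ : 0 < κ)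
    (h : ∀ x, κ * ‖x‖ ^ 2 ≤ inner ℝ x (K x)) (x : V) : ‖x‖ ≤ ‖K x‖ / κ := by
  rw [le_div_iff₀ hκ]
  rcases (norm_nonneg x).eq_or_lt with h0 | h0
  · rw [← h0, zero_mul]; exact norm_nonneg _
  · have h1 := (h x).trans (real_inner_le_norm x (K x))
    have h2 : ‖x‖ * (‖x‖ * κ) ≤ ‖x‖ * ‖K x‖ := by linarith
    exact le_of_mul_le_mul_left h2 h0

theorem injective_of_coercive {K : V →ₗ[ℝ] V} {κ : ℝ} (hκ : 0 < κ)
    (h : ∀ x, κ * ‖x‖ ^ 2 ≤ inner ℝ x (K x)) : Function.Injective K := by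
  rw [injective_iff_map_eq_zero]
  intro x hx
  have := norm_le_of_coercive hκ h x
  rw [hx, norm_zero, zero_div] at this
  exact norm_le_zero_iff.1 this

/-- The factor `a/κ + 1` comes from recentring at `xs`, whose norm is at most `B/κ`. -/
theorem linField_of_affine {π : Policy S A} {k : S × A × S → V →ₗ[ℝ] V} {b : S × A × S → V}
    {xs : V} {a B κ : ℝ} (ha : 0 < a) (hB : 0 ≤ B) (hκ : 0 < κ)
    (hk : ∀ z x, ‖k z x‖ ≤ a * ‖x‖) (hb : ∀ z, ‖b z‖ ≤ B)
    (hco : ∀ x, κ * ‖x‖ ^ 2 ≤ inner ℝ x (meanOp M π k x))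
    (hxs : meanOp M π k xs = ev (statLaw M π) b) :
    LinField M π (fun x z => k z x - b z) (meanOp M π k) xs a ((a / κ + 1) * B) κ := by
  have hF := finSupp_statLaw M π
  have hx : ‖xs‖ ≤ B / κ := by
    refine (norm_le_of_coercive hκ hco xs).trans ?_
    rw [hxs]
    exact div_le_div_of_nonneg_right (norm_ev_le_of_le hF hb) hκ.le
  refine ⟨ha, by positivity, hκ, fun x z => ?_, fun x => ?_, hco, fun x => ?_⟩
  · have e1 : ‖x‖ ≤ ‖x - xs‖ + ‖xs‖ := by
      simpa using norm_add_le (x - xs) xs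
    have e2 := norm_sub_le (k z x) (b z)
    have e3 : a * ‖x‖ ≤ a * (‖x - xs‖ + B / κ) :=
      mul_le_mul_of_nonneg_left (by linarith) ha.le
    have e4 : (a / κ + 1) * B = a * (B / κ) + B := by field_simp
    rw [e4]
    linarith [hk z x, hb z]
  · rw [statMean_eq_ev, hF.ev_sub, map_sub, hxs]
    rfl
  · exact (hF.norm_ev_le _).trans (hF.ev_le fun z _ => hk z x)

/-- The constant in the mean square bound for stochastic approximation. -/
def saVar (a κ : ℝ) : ℝ := 1 / κ ^ 2 + (a / κ + 1) ^ 2 / (2 * a ^ 2)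

/-- The constant in the bias bound for stochastic approximation. -/
def saBias (a κ : ℝ) : ℝ := 1 / κ + 16 / κ * (a * √(saVar a κ) + (a / κ + 1))

theorem saVar_nonneg (a κ : ℝ) : 0 ≤ saVar a κ := by unfold saVar; positivity

theorem saBias_nonneg {a κ : ℝ} (ha : 0 < a) (hκ : 0 < κ) : 0 ≤ saBias a κ := by
  unfold saBias; positivity

theorem sa_affine_bounds {π : Policy S A} {k : S × A × S → V →ₗ[ℝ] V} {b : S × A × S → V}
    {xs : V} {a B κ γ : ℝ} {τ Tmax H : ℕ} (hM : M.Ergodic) (hτ : M.mixTime π ≤ τ) (hτ1 : 1 ≤ τ)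
    (ha : 0 < a) (hB : 0 ≤ B) (hκ : 0 < κ)
    (hk : ∀ z x, ‖k z x‖ ≤ a * ‖x‖) (hb : ∀ z, ‖b z‖ ≤ B)
    (hco : ∀ x, κ * ‖x‖ ^ 2 ≤ inner ℝ x (meanOp M π k x))
    (hxs : meanOp M π k xs = ev (statLaw M π) b) (hγ : StepSmall τ Tmax γ a κ)
    (hH : Real.log Tmax ≤ γ * κ * H) (s : S) :
    ‖xs‖ ≤ B / κ ∧
    ev (iterLaw (saStep M π Tmax γ fun x z => k z x - b z) H (s, 0))
      (fun y => ‖y.2 - xs‖ ^ 2) ≤ saVar a κ * B ^ 2 ∧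
    ‖ev (iterLaw (saStep M π Tmax γ fun x z => k z x - b z) H (s, 0)) (fun y => y.2) - xs‖ ≤
      saBias a κ * τ / √Tmax * B := by
  have hF := finSupp_statLaw M π
  have hv := linField_of_affine ha hB hκ hk hb hco hxs
  have hx : ‖xs‖ ≤ B / κ := by
    refine (norm_le_of_coercive hκ hco xs).trans ?_
    rw [hxs]
    exact div_le_div_of_nonneg_right (norm_ev_le_of_le hF hb) hκ.le
  have hx0 : ‖(0 : V) - xs‖ ≤ B / κ := by rwa [zero_sub, norm_neg]
  have hsq : ‖(0 : V) - xs‖ ^ 2 + ((a / κ + 1) * B) ^ 2 / (2 * a ^ 2) ≤ saVar a κ * B ^ 2 := by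
    have e : saVar a κ * B ^ 2 = (B / κ) ^ 2 + ((a / κ + 1) * B) ^ 2 / (2 * a ^ 2) := by
      unfold saVar; field_simp
    rw [e]
    gcongr
  refine ⟨hx, (ev_saStep_iter_sq_le hM hτ hv hγ (s, 0) H).trans hsq, ?_⟩
  refine (norm_ev_saStep_iter_sub_le hM hτ hv hγ (s, 0) H).trans ?_
  have hT0 : (0 : ℝ) < Tmax := by have := hγ.T_ne; positivity
  have hT1 : (1 : ℝ) ≤ Tmax := by exact_mod_cast Nat.one_le_iff_ne_zero.2 hγ.T_ne
  have hs0 : 0 < √(Tmax : ℝ) := Real.sqrt_pos.2 hT0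
  have hs1 : √(Tmax : ℝ) ≤ Tmax := by
    rw [Real.sqrt_le_left hT0.le]; nlinarith
  have hτ1' : (1 : ℝ) ≤ τ := by exact_mod_cast hτ1
  -- The loop is long enough to reduce the initial error to `exp(-log Tmax / 2) = 1/√Tmax`. The
  -- factor `τ ≥ 1` only matches the shape of the bias term.
  have hpow : (1 - γ * κ / 2) ^ H ≤ τ / √Tmax := by
    have e1 : 1 - γ * κ / 2 ≤ Real.exp (-(γ * κ / 2)) := by
      linarith [Real.add_one_le_exp (-(γ * κ / 2))]
    have e2 : (1 - γ * κ / 2) ^ H ≤ Real.exp (-(Real.log Tmax / 2)) := by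
      refine (pow_le_pow_left₀ (by linarith [hγ.le_one]) e1 H).trans ?_
      rw [← Real.exp_nat_mul, Real.exp_le_exp]
      linarith
    have e3 : Real.exp (-(Real.log Tmax / 2)) = 1 / √Tmax := by
      rw [← Real.log_sqrt hT0.le, Real.exp_neg, Real.exp_log hs0, one_div]
    rw [e3] at e2
    exact e2.trans (div_le_div_of_nonneg_right hτ1' hs0.le)
  have hτT : (τ : ℝ) / Tmax ≤ τ / √Tmax := by gcongr
  have hroot : √(‖(0 : V) - xs‖ ^ 2 + ((a / κ + 1) * B) ^ 2 / (2 * a ^ 2)) ≤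
      √(saVar a κ) * B := by
    refine (Real.sqrt_le_sqrt hsq).trans_eq ?_
    rw [Real.sqrt_mul (saVar_nonneg a κ), Real.sqrt_sq hB]
  calc _ ≤ τ / √Tmax * (B / κ) + 16 / κ * (τ / √Tmax) *
        (a * (√(saVar a κ) * B) + (a / κ + 1) * B) := by
        have e : 2 * (8 * (τ : ℝ) / Tmax) / κ = 16 / κ * (τ / Tmax) := by field_simp; ring
        rw [e]
        gcongr
    _ = saBias a κ * τ / √Tmax * B := by
        unfold saBias
        have := hs0.ne'
        field_simp

end StationaryLaw

/-! ### Compatibility of the estimates with linear maps -/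

section Linearity

variable {S A : Type*}

theorem levelAvg_map {X Y : Type*} [AddCommGroup X] [Module ℝ X] [AddCommGroup Y] [Module ℝ Y]
    (L : X →ₗ[ℝ] Y) (v : S × A × S → X) (zs : List (S × A × S)) (j : ℕ) :
    L (levelAvg v zs j) = levelAvg (fun z => L (v z)) zs j := by
  simp only [levelAvg, map_smul, map_list_sum, List.map_map]
  rfl

/-- The estimate is linear in the sampled values, so the critic recursion can be carried into a
Hilbert space, where coercivity makes sense. -/
theorem mlmc_map {X Y : Type*} [AddCommGroup X] [Module ℝ X] [AddCommGroup Y] [Module ℝ Y]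
    (L : X →ₗ[ℝ] Y) (Tmax : ℕ) (v : S × A × S → X) (zs : List (S × A × S)) (q : ℕ) :
    L (mlmc Tmax v zs q) = mlmc Tmax (fun z => L (v z)) zs q := by
  simp only [mlmc, map_add, levelAvg_map]
  split_ifs <;> simp only [map_smul, map_sub, map_zero, levelAvg_map]

theorem mlmc_congr_level {X : Type*} [AddCommGroup X] [Module ℝ X] {Tmax q q' : ℕ}
    (h : ¬ 2 ^ q ≤ Tmax) (h' : ¬ 2 ^ q' ≤ Tmax) (v : S × A × S → X) (zs : List (S × A × S)) :
    mlmc Tmax v zs q = mlmc Tmax v zs q' := by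
  simp only [mlmc, if_neg h, if_neg h']

theorem meanZ_map [Fintype S] [DecidableEq S] [Fintype A] {d : ℕ} {X Y : Type*} [AddCommGroup X]
    [Module ℝ X] [AddCommGroup Y] [Module ℝ Y] (L : X →ₗ[ℝ] Y) (M : CMDP S A)
    (π : E d → Policy S A) (θ : E d) (f : S × A × S → X) :
    L (meanZ M π θ f) = meanZ M π θ fun z => L (f z) := by
  simp only [meanZ, map_sum, map_smul]

end Linearity

/-! ### The critic -/

section CriticAnalysis

variable {S A : Type*} [Fintype S] [DecidableEq S] [Fintype A] {M : CMDP S A} {d m : ℕ}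

/-- The Hilbert space of critic vectors `(η, ζ)`. -/
abbrev CriticSpace (m : ℕ) := WithLp 2 (ℝ × E m)

/-- Critic vectors as elements of a Hilbert space. -/
def critEmb : Critic m →ₗ[ℝ] CriticSpace m where
  toFun ξ := WithLp.toLp 2 (ξ (Sum.inl ()), WithLp.toLp 2 fun i => ξ (Sum.inr i))
  map_add' _ _ := rfl
  map_smul' _ _ := rfl

theorem critEmb_fst (ξ : Critic m) : (critEmb ξ).fst = ξ (Sum.inl ()) := rfl

theorem critEmb_snd_apply (ξ : Critic m) (i : Fin m) : (critEmb ξ).snd i = ξ (Sum.inr i) := rfl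

theorem critEmb_injective : Function.Injective (critEmb (m := m)) := by
  intro ξ ξ' h
  funext i
  rcases i with ⟨⟩ | i
  · exact congrArg (fun x : CriticSpace m => x.fst) h
  · exact congrArg (fun x : CriticSpace m => x.snd i) h

/-- The linear part of the critic field. -/
def critK (φ : Sig → S → E m) (cγ : ℝ) (g : Sig) (z : S × A × S) :
    CriticSpace m →ₗ[ℝ] CriticSpace m where
  toFun x := WithLp.toLp 2
    (cγ * x.fst, (x.fst + inner ℝ (φ g z.1 - φ g z.2.2) x.snd) • φ g z.1)
  map_add' x y := by
    apply (WithLp.equiv 2 _).injective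
    refine Prod.ext ?_ ?_
    · change cγ * (x.fst + y.fst) = cγ * x.fst + cγ * y.fst; ring
    · change (x.fst + y.fst + inner ℝ _ (x.snd + y.snd)) • _ =
        (_ : ℝ) • φ g z.1 + (_ : ℝ) • φ g z.1
      rw [inner_add_right, ← add_smul]; congr 1; ring
  map_smul' c x := by
    apply (WithLp.equiv 2 _).injective
    refine Prod.ext ?_ ?_
    · change cγ * (c * x.fst) = c * (cγ * x.fst); ring
    · change (c * x.fst + inner ℝ _ (c • x.snd)) • _ = c • (_ • φ g z.1)
      rw [inner_smul_right, smul_smul]; congr 1; ring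

/-- The constant part of the critic field. -/
def critOff (M : CMDP S A) (φ : Sig → S → E m) (cγ : ℝ) (g : Sig) (z : S × A × S) :
    CriticSpace m :=
  WithLp.toLp 2 (cγ * M.sig g z.1 z.2.1, M.sig g z.1 z.2.1 • φ g z.1)

theorem inner_eq_sum (x y : E m) : inner ℝ x y = ∑ i, x i * y i := by
  rw [PiLp.inner_apply]
  exact Finset.sum_congr rfl fun i _ => by simp [mul_comm]

theorem critEmb_mulVec (φ : Sig → S → E m) (cγ : ℝ) (g : Sig) (z : S × A × S) (ξ : Critic m) :
    critEmb (Matrix.mulVec (critA φ cγ g z) ξ) = critK φ cγ g z (critEmb ξ) := by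
  apply (WithLp.equiv 2 _).injective
  refine Prod.ext ?_ ?_
  · change Matrix.mulVec (critA φ cγ g z) ξ (Sum.inl ()) = cγ * ξ (Sum.inl ())
    simp [Matrix.mulVec, dotProduct, critA]
  · ext i
    change Matrix.mulVec (critA φ cγ g z) ξ (Sum.inr i) =
      (ξ (Sum.inl ()) + inner ℝ (φ g z.1 - φ g z.2.2) (critEmb ξ).snd) * φ g z.1 i
    rw [inner_eq_sum]
    simp only [Matrix.mulVec, dotProduct, critA, Fintype.sum_sum_type, Finset.univ_unique,
      Finset.sum_singleton, Matrix.fromBlocks_apply₂₁, Matrix.fromBlocks_apply₂₂, Matrix.of_apply,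
      critEmb_snd_apply, PiLp.sub_apply, add_mul, Finset.sum_mul]
    congr 1
    · exact mul_comm _ _
    · exact Finset.sum_congr rfl fun j _ => by ring

theorem critEmb_critb (M : CMDP S A) (φ : Sig → S → E m) (cγ : ℝ) (g : Sig) (z : S × A × S) :
    critEmb (critb M φ cγ g z) = critOff M φ cγ g z := rfl

theorem norm_critK_le {φ : Sig → S → E m} (hφ : ∀ g s, ‖φ g s‖ ≤ 1) {cγ : ℝ} (hc : 0 ≤ cγ)
    (g : Sig) (z : S × A × S) (x : CriticSpace m) :
    ‖critK φ cγ g z x‖ ≤ (cγ + 3) * ‖x‖ := by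
  refine le_of_sq_le_sq ?_ (by positivity)
  rw [mul_pow, WithLp.prod_norm_sq_eq_of_L2, WithLp.prod_norm_sq_eq_of_L2]
  change ‖cγ * x.fst‖ ^ 2 + ‖(x.fst + inner ℝ (φ g z.1 - φ g z.2.2) x.snd) • φ g z.1‖ ^ 2 ≤ _
  have h1 : ‖(x.fst + inner ℝ (φ g z.1 - φ g z.2.2) x.snd) • φ g z.1‖ ≤
      ‖x.fst‖ + 2 * ‖x.snd‖ := by
    rw [norm_smul]
    have e1 : ‖x.fst + inner ℝ (φ g z.1 - φ g z.2.2) x.snd‖ ≤ ‖x.fst‖ + 2 * ‖x.snd‖ := by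
      refine (norm_add_le _ _).trans ?_
      have e2 := norm_inner_le_norm (𝕜 := ℝ) (φ g z.1 - φ g z.2.2) x.snd
      have e3 : ‖φ g z.1 - φ g z.2.2‖ ≤ 2 :=
        (norm_sub_le _ _).trans (by linarith [hφ g z.1, hφ g z.2.2])
      have e4 := mul_le_mul_of_nonneg_right e3 (norm_nonneg x.snd)
      linarith
    calc _ ≤ (‖x.fst‖ + 2 * ‖x.snd‖) * 1 := by
          gcongr
          exact hφ g z.1
      _ = _ := mul_one _
  have h2 := pow_le_pow_left₀ (norm_nonneg _) h1 2
  rw [norm_mul, Real.norm_of_nonneg hc]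
  -- This is `(p + 2r)² ≤ 5 (p² + r²)`, and `cγ² + 5 ≤ (cγ + 3)²`.
  have h3 := sq_nonneg (2 * ‖x.fst‖ - ‖x.snd‖)
  have h4 : 0 ≤ cγ * (‖x.fst‖ ^ 2 + ‖x.snd‖ ^ 2) := by positivity
  have h5 : 0 ≤ cγ ^ 2 * ‖x.snd‖ ^ 2 := by positivity
  nlinarith [sq_nonneg ‖x.fst‖, sq_nonneg ‖x.snd‖]

theorem norm_critOff_le {φ : Sig → S → E m} (hφ : ∀ g s, ‖φ g s‖ ≤ 1) {cγ : ℝ} (hc : 0 ≤ cγ)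
    (g : Sig) (z : S × A × S) : ‖critOff M φ cγ g z‖ ≤ cγ + 1 := by
  refine le_of_sq_le_sq ?_ (by positivity)
  rw [WithLp.prod_norm_sq_eq_of_L2]
  change ‖cγ * M.sig g z.1 z.2.1‖ ^ 2 + ‖M.sig g z.1 z.2.1 • φ g z.1‖ ^ 2 ≤ _
  have h := abs_sig_le M g z.1 z.2.1
  rw [norm_mul, norm_smul, Real.norm_of_nonneg hc, Real.norm_eq_abs]
  have h1 : cγ * |M.sig g z.1 z.2.1| ≤ cγ * 1 := mul_le_mul_of_nonneg_left h hc
  have h2 : |M.sig g z.1 z.2.1| * ‖φ g z.1‖ ≤ 1 * 1 :=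
    mul_le_mul h (hφ g z.1) (norm_nonneg _) zero_le_one
  have h3 := pow_le_pow_left₀ (by positivity) h1 2
  have h4 := pow_le_pow_left₀ (by positivity) h2 2
  nlinarith

/-- Completing the square in `r` with half of `lam r²` absorbs the cross term at the price `p²/(2
lam)`, so it suffices that `1/(2 lam) ≤ cγ - lam/2`. This is what the lower bound on `cγ` provides.
-/
theorem quadratic_lower_bound {lam cγ p r : ℝ} (hlam : 0 < lam)
    (hcγ : lam + √(1 / lam ^ 2 - 1) ≤ cγ) :
    lam / 2 * (p ^ 2 + r ^ 2) ≤ cγ * p ^ 2 - |p| * r + lam * r ^ 2 := by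
  -- For `lam ≤ 1` put `w = lam * u`. Then `w² = 1 - lam²` and `w ≤ 1`, so `lam² + 2w ≥ lam² + w² =
  -- 1`. For `lam > 1` nonnegativity of the root is enough.
  have key : 1 ≤ lam * (2 * cγ - lam) := by
    rcases le_or_gt lam 1 with h | h
    · set u := √(1 / lam ^ 2 - 1) with hu
      have hu0 : 0 ≤ u := Real.sqrt_nonneg _
      have harg : 0 ≤ 1 / lam ^ 2 - 1 := by
        rw [sub_nonneg, le_div_iff₀ (by positivity)]; nlinarith
      have hu2 : u ^ 2 = 1 / lam ^ 2 - 1 := Real.sq_sqrt harg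
      have hw : (lam * u) ^ 2 = 1 - lam ^ 2 := by rw [mul_pow, hu2]; field_simp
      have hw0 : 0 ≤ lam * u := by positivity
      have hw1 : lam * u ≤ 1 := by nlinarith [sq_nonneg lam]
      nlinarith [mul_le_mul_of_nonneg_left hcγ hlam.le]
    · have : lam ≤ cγ := by linarith [Real.sqrt_nonneg (1 / lam ^ 2 - 1)]
      nlinarith
  have h1 : 0 ≤ lam / 2 * (r - |p| / lam) ^ 2 := by positivity
  have h2 : lam / 2 * (r - |p| / lam) ^ 2 = lam / 2 * r ^ 2 - |p| * r + p ^ 2 / (2 * lam) := by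
    rw [← sq_abs p]; field_simp; ring
  have h3 : p ^ 2 / (2 * lam) ≤ (cγ - lam / 2) * p ^ 2 := by
    rw [div_le_iff₀ (by positivity)]
    nlinarith [mul_le_mul_of_nonneg_left key (sq_nonneg p)]
  linarith

/-- The averaged operator is block triangular with diagonal blocks `cγ` and a `lam`-coercive one.
Its off-diagonal block has norm at most one because the features do, and absorbing it costs half of
`lam`. -/
theorem critK_coercive {π : E d → Policy S A} {φ : Sig → S → E m} (hφ : ∀ g s, ‖φ g s‖ ≤ 1)
    {lam cγ : ℝ} (hlam : 0 < lam) (hcγ : lam + √(1 / lam ^ 2 - 1) ≤ cγ)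
    (hpd : CriticPosDef M π φ lam) (g : Sig) (θ : E d) (x : CriticSpace m) :
    lam / 2 * ‖x‖ ^ 2 ≤ inner ℝ x (meanOp M (π θ) (critK φ cγ g) x) := by
  have hF := finSupp_statLaw M (π θ)
  rw [inner_meanOp, WithLp.prod_norm_sq_eq_of_L2]
  have h1 := hpd g θ x.snd
  rw [meanZ_eq_statMean, statMean_eq_ev] at h1
  have e : ∀ z : S × A × S, inner ℝ x (critK φ cγ g z x) =
      cγ * x.fst ^ 2 + (x.fst * inner ℝ x.snd (φ g z.1) +
        inner ℝ x.snd (φ g z.1) * inner ℝ (φ g z.1 - φ g z.2.2) x.snd) := by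
    intro z
    rw [WithLp.prod_inner_apply]
    change inner ℝ x.fst (cγ * x.fst) +
      inner ℝ x.snd ((x.fst + inner ℝ (φ g z.1 - φ g z.2.2) x.snd) • φ g z.1) = _
    rw [inner_smul_right]
    simp only [RCLike.inner_apply, conj_trivial]
    ring
  simp_rw [e]
  rw [hF.ev_add, hF.ev_add, hF.ev_const]
  have h2 : -(|x.fst| * ‖x.snd‖) ≤
      ev (statLaw M (π θ)) fun z => x.fst * inner ℝ x.snd (φ g z.1) := by
    rw [← hF.ev_const (-(|x.fst| * ‖x.snd‖))]
    refine hF.ev_mono fun z _ => ?_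
    have e1 := abs_real_inner_le_norm x.snd (φ g z.1)
    have e2 : ‖x.snd‖ * ‖φ g z.1‖ ≤ ‖x.snd‖ * 1 :=
      mul_le_mul_of_nonneg_left (hφ g z.1) (norm_nonneg _)
    have e3 := neg_abs_le (x.fst * inner ℝ x.snd (φ g z.1))
    rw [abs_mul] at e3
    have e4 := mul_le_mul_of_nonneg_left (e1.trans e2) (abs_nonneg x.fst)
    linarith
  have h3 := quadratic_lower_bound (p := x.fst) (r := ‖x.snd‖) hlam hcγ
  rw [Real.norm_eq_abs, sq_abs]
  linarith

theorem critEmb_meanZ_mulVec (M : CMDP S A) (π : E d → Policy S A) (φ : Sig → S → E m)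
    (cγ : ℝ) (g : Sig) (θ : E d) (ξ : Critic m) :
    critEmb (Matrix.mulVec (meanZ M π θ (critA φ cγ g)) ξ) =
      meanOp M (π θ) (critK φ cγ g) (critEmb ξ) := by
  let L : Matrix (Unit ⊕ Fin m) (Unit ⊕ Fin m) ℝ →ₗ[ℝ] CriticSpace m :=
    { toFun := fun X => critEmb (Matrix.mulVec X ξ)
      map_add' := fun X Y => by rw [Matrix.add_mulVec, map_add]
      map_smul' := fun c X => by rw [Matrix.smul_mulVec, map_smul]; rfl }
  change L _ = _
  rw [meanZ_map, meanZ_eq_statMean, statMean_eq_ev]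
  change ev _ (fun z => critEmb (Matrix.mulVec (critA φ cγ g z) ξ)) = ev _ _
  simp_rw [critEmb_mulVec]

/-- Coercivity makes the averaged matrix invertible, so the formal inverse in `xiStar` is a genuine
one and `xiStar` is the zero of the mean field. -/
theorem meanOp_xiStar {π : E d → Policy S A} {φ : Sig → S → E m} (hφ : ∀ g s, ‖φ g s‖ ≤ 1)
    {lam cγ : ℝ} (hlam : 0 < lam) (hcγ : lam + √(1 / lam ^ 2 - 1) ≤ cγ)
    (hpd : CriticPosDef M π φ lam) (g : Sig) (θ : E d) :
    meanOp M (π θ) (critK φ cγ g) (critEmb (xiStar M π φ cγ g θ)) =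
      ev (statLaw M (π θ)) (critOff M φ cγ g) := by
  have hinj : Function.Injective (Matrix.mulVec (meanZ M π θ (critA φ cγ g))) := by
    intro ξ ξ' h
    refine critEmb_injective (injective_of_coercive (half_pos hlam)
      (critK_coercive hφ hlam hcγ hpd g θ) ?_)
    rw [← critEmb_meanZ_mulVec, ← critEmb_meanZ_mulVec, h]
  have hu : IsUnit (meanZ M π θ (critA φ cγ g)).det :=
    (Matrix.isUnit_iff_isUnit_det _).1 (Matrix.mulVec_injective_iff_isUnit.1 hinj)
  rw [← critEmb_meanZ_mulVec, xiStar, Matrix.mulVec_mulVec, Matrix.mul_nonsing_inv _ hu,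
    Matrix.one_mulVec, meanZ_map, meanZ_eq_statMean, statMean_eq_ev]
  rfl

/-- The first row of the linear system reads `cγ η = cγ J`, so the average reward is estimated
without approximation error. -/
theorem xiStar_inl (hM : M.Ergodic) {π : E d → Policy S A} {φ : Sig → S → E m}
    (hφ : ∀ g s, ‖φ g s‖ ≤ 1) {lam cγ : ℝ} (hlam : 0 < lam)
    (hcγ : lam + √(1 / lam ^ 2 - 1) ≤ cγ) (hpd : CriticPosDef M π φ lam) (g : Sig) (θ : E d) :
    xiStar M π φ cγ g θ (Sum.inl ()) = M.J g (π θ) := by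
  have hF := finSupp_statLaw M (π θ)
  have hc : 0 < cγ := by linarith [Real.sqrt_nonneg (1 / lam ^ 2 - 1)]
  have h := congrArg (fun x : CriticSpace m => x.fst) (meanOp_xiStar hφ hlam hcγ hpd g θ)
  let L : CriticSpace m →ₗ[ℝ] ℝ :=
    { toFun := fun x => x.fst, map_add' := fun _ _ => rfl, map_smul' := fun _ _ => rfl }
  have h1 : L (meanOp M (π θ) (critK φ cγ g) (critEmb (xiStar M π φ cγ g θ))) =
      ev (statLaw M (π θ)) fun _ => cγ * xiStar M π φ cγ g θ (Sum.inl ()) :=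
    hF.map_ev L _
  have h2 : L (ev (statLaw M (π θ)) (critOff M φ cγ g)) =
      ev (statLaw M (π θ)) fun z => cγ * M.sig g z.1 z.2.1 :=
    hF.map_ev L _
  change L _ = L _ at h
  rw [h1, h2, hF.ev_const, hF.ev_mul, hM.ev_statLaw_sig] at h
  exact mul_left_cancel₀ hc.ne' h

theorem criticStep_eq (M : CMDP S A) (π : E d → Policy S A) (φ : Sig → S → E m) {p : Params}
    (hT : p.Tmax ≠ 0) (θ : E d) (x : S × (Sig → Critic m)) :
    criticStep M π φ p θ x = (sampleLaw M (π θ) p.Tmax x.1).map fun w =>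
      (finalState x.1 w.2, fun g => x.2 g - p.γξ • mlmc p.Tmax (fun z =>
        Matrix.mulVec (critA φ p.cγ g z) (x.2 g) - critb M φ p.cγ g z) w.2 w.1) := by
  refine geomHalf_bind_rollout M (π θ) hT x.1 (fun q zs => (finalState x.1 zs,
    fun g => x.2 g - p.γξ • mlmc p.Tmax (fun z =>
        Matrix.mulVec (critA φ p.cγ g z) (x.2 g) - critb M φ p.cγ g z) zs q)) ?_
  intro q q' h h'
  funext zs
  simp only [mlmc_congr_level h h']

theorem finSupp_criticStep (M : CMDP S A) (π : E d → Policy S A) (φ : Sig → S → E m) {p : Params}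
    (hT : p.Tmax ≠ 0) (θ : E d) (x : S × (Sig → Critic m)) :
    FinSupp (criticStep M π φ p θ x) := by
  rw [criticStep_eq M π φ hT]
  exact (finSupp_sampleLaw _ _ _ _).map _

/-- The update of one signal involves only its own vector and the shared samples, so it is a
stochastic approximation by itself. -/
theorem criticStep_map (M : CMDP S A) (π : E d → Policy S A) (φ : Sig → S → E m) {p : Params}
    (hT : p.Tmax ≠ 0) (θ : E d) (g : Sig) (x : S × (Sig → Critic m)) :
    (criticStep M π φ p θ x).map (fun y => (y.1, critEmb (y.2 g))) =
      saStep M (π θ) p.Tmax p.γξ (fun y z => critK φ p.cγ g z y - critOff M φ p.cγ g z)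
        (x.1, critEmb (x.2 g)) := by
  rw [criticStep_eq M π φ hT, PMF.map_comp, saStep]
  congr 1
  funext w
  simp only [Function.comp, map_sub, map_smul, mlmc_map, critEmb_mulVec, critEmb_critb]

theorem critic_bounds (hM : M.Ergodic) {π : E d → Policy S A} {φ : Sig → S → E m}
    (hφ : ∀ g s, ‖φ g s‖ ≤ 1) {lam : ℝ} {p : Params} {τ : ℕ} {θ : E d} (hlam : 0 < lam)
    (hcγ : lam + √(1 / lam ^ 2 - 1) ≤ p.cγ) (hpd : CriticPosDef M π φ lam)
    (hτ : M.mixTime (π θ) ≤ τ) (hτ1 : 1 ≤ τ)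
    (hγ : StepSmall τ p.Tmax p.γξ (p.cγ + 3) (lam / 2))
    (hH : Real.log p.Tmax ≤ p.γξ * (lam / 2) * p.H) (g : Sig) (s : S) :
    ‖critEmb (xiStar M π φ p.cγ g θ)‖ ≤ (p.cγ + 1) / (lam / 2) ∧
    ev (iterLaw (criticStep M π φ p θ) p.H (s, 0))
      (fun y => ‖critEmb (y.2 g) - critEmb (xiStar M π φ p.cγ g θ)‖ ^ 2) ≤
        saVar (p.cγ + 3) (lam / 2) * (p.cγ + 1) ^ 2 ∧
    ‖ev (iterLaw (criticStep M π φ p θ) p.H (s, 0)) (fun y => critEmb (y.2 g)) -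
      critEmb (xiStar M π φ p.cγ g θ)‖ ≤
        saBias (p.cγ + 3) (lam / 2) * τ / √p.Tmax * (p.cγ + 1) := by
  have hc : 0 < p.cγ := by linarith [Real.sqrt_nonneg (1 / lam ^ 2 - 1)]
  have h := sa_affine_bounds hM hτ hτ1 (by linarith) (by linarith) (half_pos hlam)
    (norm_critK_le hφ hc.le g) (norm_critOff_le (M := M) hφ hc.le g)
    (critK_coercive hφ hlam hcγ hpd g θ) (meanOp_xiStar hφ hlam hcγ hpd g θ) hγ hH s
  have hmap := iterLaw_map (criticStep_map M π φ hγ.T_ne θ g) p.H (s, 0)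
  have h0 : critEmb ((0 : Sig → Critic m) g) = 0 := map_zero _
  simp only [h0] at hmap
  have hI := finSupp_iterLaw (finSupp_criticStep M π φ hγ.T_ne θ) p.H (s, 0)
  rw [← hmap, hI.ev_map, hI.ev_map] at h
  exact h

end CriticAnalysis

/-! ### The actor -/

section ActorAnalysis

variable {S A : Type*} [Fintype S] [DecidableEq S] [Fintype A] {M : CMDP S A} {d m : ℕ}
  {π : E d → Policy S A} {φ : Sig → S → E m} {G₁ G₂ μ lam : ℝ} {p : Params} {τ : ℕ} {θ : E d}

/-- The score at a transition. -/
def scoreZ (π : E d → Policy S A) (θ : E d) (z : S × A × S) : E d := score π θ z.1 z.2.1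

/-- The linear part of the actor field. -/
def actK (π : E d → Policy S A) (θ : E d) (z : S × A × S) : E d →ₗ[ℝ] E d :=
  (innerₗ (E d) (scoreZ π θ z)).smulRight (scoreZ π θ z)

theorem actK_apply (π : E d → Policy S A) (θ : E d) (z : S × A × S) (x : E d) :
    actK π θ z x = inner ℝ (scoreZ π θ z) x • scoreZ π θ z := rfl

/-- The part of the temporal difference error that is linear in the critic vector. -/
def advLin (φ : Sig → S → E m) (g : Sig) (x : CriticSpace m) (z : S × A × S) : ℝ :=
  -x.fst + inner ℝ x.snd (φ g z.2.2 - φ g z.1)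

theorem advEst_eq (M : CMDP S A) (φ : Sig → S → E m) (g : Sig) (ξ : Critic m) (z : S × A × S) :
    advEst M φ g ξ z = M.sig g z.1 z.2.1 + advLin φ g (critEmb ξ) z := by
  simp only [advEst, advLin, inner_eq_sum, critEmb_fst, critEmb_snd_apply, PiLp.sub_apply]
  ring

theorem norm_fst_le (x : CriticSpace m) : |x.fst| ≤ ‖x‖ := by
  refine abs_le_of_sq_le_sq ?_ (norm_nonneg _)
  rw [WithLp.prod_norm_sq_eq_of_L2, Real.norm_eq_abs, sq_abs]
  exact le_add_of_nonneg_right (sq_nonneg _)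

theorem norm_snd_le (x : CriticSpace m) : ‖x.snd‖ ≤ ‖x‖ := by
  refine le_of_sq_le_sq ?_ (norm_nonneg _)
  rw [WithLp.prod_norm_sq_eq_of_L2]
  exact le_add_of_nonneg_left (sq_nonneg _)

theorem abs_advLin_le (hφ : ∀ g s, ‖φ g s‖ ≤ 1) (g : Sig) (x : CriticSpace m)
    (z : S × A × S) : |advLin φ g x z| ≤ 3 * ‖x‖ := by
  have h1 := abs_real_inner_le_norm x.snd (φ g z.2.2 - φ g z.1)
  have h2 : ‖φ g z.2.2 - φ g z.1‖ ≤ 2 :=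
    (norm_sub_le _ _).trans (by linarith [hφ g z.2.2, hφ g z.1])
  have h3 := mul_le_mul (norm_snd_le x) h2 (norm_nonneg _) (norm_nonneg _)
  refine (abs_add_le _ _).trans ?_
  rw [abs_neg]
  linarith [norm_fst_le x]

theorem norm_scoreZ_le (hS : ScoreBounds π G₁ G₂) (θ : E d) (z : S × A × S) :
    ‖scoreZ π θ z‖ ≤ G₁ := hS.bound θ _ _

theorem norm_actK_le (hS : ScoreBounds π G₁ G₂) (z : S × A × S) (x : E d) :
    ‖actK π θ z x‖ ≤ G₁ ^ 2 * ‖x‖ := by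
  have h := norm_scoreZ_le hS θ z
  have h0 := norm_nonneg (scoreZ π θ z)
  rw [actK_apply, norm_smul]
  have h1 := norm_inner_le_norm (𝕜 := ℝ) (scoreZ π θ z) x
  calc _ ≤ ‖scoreZ π θ z‖ * ‖x‖ * ‖scoreZ π θ z‖ := mul_le_mul_of_nonneg_right h1 h0
    _ = ‖scoreZ π θ z‖ ^ 2 * ‖x‖ := by ring
    _ ≤ _ := by gcongr

theorem actK_coercive (hfi : FisherNonDeg M π μ) (θ : E d) (x : E d) :
    μ * ‖x‖ ^ 2 ≤ inner ℝ x (meanOp M (π θ) (actK π θ) x) := by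
  have h := (hfi θ).dotProduct_mulVec_nonneg (x : Fin d → ℝ)
  rw [inner_meanOp]
  simp only [actK_apply, inner_smul_right]
  have e1 : (ev (statLaw M (π θ)) fun z => inner ℝ (scoreZ π θ z) x * inner ℝ x (scoreZ π θ z)) =
      ∑ s, ∑ a, M.occ (π θ) s a * (inner ℝ (score π θ s a) x * inner ℝ x (score π θ s a)) :=
    (sum_occ_eq_ev M (π θ) fun s a => inner ℝ (score π θ s a) x * inner ℝ x (score π θ s a)).symm
  have e2 : (x : Fin d → ℝ) ⬝ᵥ Matrix.mulVec (fisher M π θ) x =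
      ∑ s, ∑ a, M.occ (π θ) s a * (inner ℝ (score π θ s a) x * inner ℝ x (score π θ s a)) := by
    simp only [fisher, Matrix.sum_mulVec, Matrix.smul_mulVec, dotProduct_sum, dotProduct_smul,
      smul_eq_mul]
    refine Finset.sum_congr rfl fun s _ => Finset.sum_congr rfl fun a _ => ?_
    congr 1
    rw [Matrix.vecMulVec_mulVec, inner_eq_sum, inner_eq_sum]
    simp only [dotProduct, Pi.smul_apply, op_smul_eq_smul, smul_eq_mul]
    rw [Finset.mul_sum]
    exact Finset.sum_congr rfl fun i _ => by ring
  have e3 : ‖x‖ ^ 2 = (x : Fin d → ℝ) ⬝ᵥ (x : Fin d → ℝ) := by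
    rw [← real_inner_self_eq_norm_sq, inner_eq_sum]; rfl
  rw [star_trivial, Matrix.sub_mulVec, dotProduct_sub, Matrix.smul_mulVec, Matrix.one_mulVec,
    dotProduct_smul, smul_eq_mul, ← e3, e2] at h
  rw [e1]
  linarith

/-- The inverse is needed as a linear map, so that it commutes with the expectation over the critic
output. -/
theorem exists_meanOp_inverse {V : Type*} [NormedAddCommGroup V] [InnerProductSpace ℝ V]
    [FiniteDimensional ℝ V] {K : V →ₗ[ℝ] V} {κ : ℝ} (hκ : 0 < κ)
    (h : ∀ x, κ * ‖x‖ ^ 2 ≤ inner ℝ x (K x)) :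
    ∃ I : V →ₗ[ℝ] V, (∀ b, K (I b) = b) ∧ (∀ x, I (K x) = x) ∧ ∀ b, ‖I b‖ ≤ ‖b‖ / κ := by
  let e := LinearEquiv.ofInjectiveEndo K (injective_of_coercive hκ h)
  have he : ∀ b, K (e.symm b) = b := fun b => e.apply_symm_apply b
  refine ⟨e.symm.toLinearMap, he, fun x => e.symm_apply_apply x, fun b => ?_⟩
  have := norm_le_of_coercive hκ h (e.symm b)
  rwa [he] at this

theorem actorStep_eq (M : CMDP S A) (π : E d → Policy S A) (φ : Sig → S → E m) {p : Params}
    (hT : p.Tmax ≠ 0) (θ : E d) (ξ : Sig → Critic m) (x : S × (Sig → E d)) :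
    actorStep M π φ p θ ξ x = (sampleLaw M (π θ) p.Tmax x.1).map fun w =>
      (finalState x.1 w.2, fun g => x.2 g - p.γω • mlmc p.Tmax
        (npgGrad M π φ θ g (ξ g) (x.2 g)) w.2 w.1) := by
  refine geomHalf_bind_rollout M (π θ) hT x.1 (fun q zs => (finalState x.1 zs,
    fun g => x.2 g - p.γω • mlmc p.Tmax (npgGrad M π φ θ g (ξ g) (x.2 g)) zs q)) ?_
  intro q q' h h'
  funext zs
  simp only [mlmc_congr_level h h']

theorem finSupp_actorStep (M : CMDP S A) (π : E d → Policy S A) (φ : Sig → S → E m) {p : Params}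
    (hT : p.Tmax ≠ 0) (θ : E d) (ξ : Sig → Critic m) (x : S × (Sig → E d)) :
    FinSupp (actorStep M π φ p θ ξ x) := by
  rw [actorStep_eq M π φ hT]
  exact (finSupp_sampleLaw _ _ _ _).map _

theorem actorStep_map (M : CMDP S A) (π : E d → Policy S A) (φ : Sig → S → E m) {p : Params}
    (hT : p.Tmax ≠ 0) (θ : E d) (ξ : Sig → Critic m) (g : Sig) (x : S × (Sig → E d)) :
    (actorStep M π φ p θ ξ x).map (fun y => (y.1, y.2 g)) =
      saStep M (π θ) p.Tmax p.γω
        (fun y z => actK π θ z y - advEst M φ g (ξ g) z • scoreZ π θ z) (x.1, x.2 g) := by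
  rw [actorStep_eq M π φ hT, PMF.map_comp, saStep]
  rfl

/-- The actor started from zero, for a given critic output. -/
theorem actor_bounds (hM : M.Ergodic) (hφ : ∀ g s, ‖φ g s‖ ≤ 1) (hS : ScoreBounds π G₁ G₂)
    (hfi : FisherNonDeg M π μ) (hG : 0 < G₁) (hμ : 0 < μ)
    (hτ : M.mixTime (π θ) ≤ τ) (hτ1 : 1 ≤ τ)
    (hγ : StepSmall τ p.Tmax p.γω (G₁ ^ 2) μ)
    (hH : Real.log p.Tmax ≤ p.γω * μ * p.H) (ξ : Sig → Critic m) (g : Sig) (s : S) {x : E d}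
    (hx : meanOp M (π θ) (actK π θ) x =
      ev (statLaw M (π θ)) fun z => advEst M φ g (ξ g) z • scoreZ π θ z) :
    ev (iterLaw (actorStep M π φ p θ ξ) p.H (s, 0)) (fun w => ‖w.2 g‖ ^ 2) ≤
      (2 * saVar (G₁ ^ 2) μ + 2 / μ ^ 2) * (G₁ * (1 + 3 * ‖critEmb (ξ g)‖)) ^ 2 ∧
    ‖ev (iterLaw (actorStep M π φ p θ ξ) p.H (s, 0)) (fun w => w.2 g) - x‖ ≤
      saBias (G₁ ^ 2) μ * τ / √p.Tmax * (G₁ * (1 + 3 * ‖critEmb (ξ g)‖)) := by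
  have hb : ∀ z, ‖advEst M φ g (ξ g) z • scoreZ π θ z‖ ≤
      G₁ * (1 + 3 * ‖critEmb (ξ g)‖) := by
    intro z
    rw [norm_smul, advEst_eq, Real.norm_eq_abs, mul_comm]
    have h1 := abs_add_le (M.sig g z.1 z.2.1) (advLin φ g (critEmb (ξ g)) z)
    have h2 := abs_sig_le M g z.1 z.2.1
    have h3 := abs_advLin_le hφ g (critEmb (ξ g)) z
    exact mul_le_mul (norm_scoreZ_le hS θ z) (by linarith) (abs_nonneg _) hG.le
  set B := G₁ * (1 + 3 * ‖critEmb (ξ g)‖) with hB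
  have hB0 : 0 ≤ B := by positivity
  obtain ⟨h1, h2, h3⟩ := sa_affine_bounds hM hτ hτ1 (by positivity) hB0 hμ
    (norm_actK_le (θ := θ) hS) hb (actK_coercive hfi θ) hx hγ hH s
  have hmap := iterLaw_map (actorStep_map M π φ hγ.T_ne θ ξ g) p.H (s, 0)
  have h0 : (0 : Sig → E d) g = 0 := rfl
  simp only [h0] at hmap
  have hI := finSupp_iterLaw (finSupp_actorStep M π φ hγ.T_ne θ ξ) p.H (s, 0)
  rw [← hmap, hI.ev_map] at h2 h3
  refine ⟨?_, h3⟩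
  have h4 : ∀ w ∈ (iterLaw (actorStep M π φ p θ ξ) p.H (s, 0)).support,
      ‖w.2 g‖ ^ 2 ≤ 2 * ‖w.2 g - x‖ ^ 2 + 2 * ‖x‖ ^ 2 := by
    intro w _
    simpa using norm_add_sq_le_two (w.2 g - x) x
  refine (hI.ev_mono h4).trans ?_
  rw [hI.ev_add, hI.ev_const, hI.ev_mul]
  have h5 := pow_le_pow_left₀ (norm_nonneg _) h1 2
  have h6 : (B / μ) ^ 2 = 1 / μ ^ 2 * B ^ 2 := by field_simp
  rw [h6] at h5
  have h7 : (2 * saVar (G₁ ^ 2) μ + 2 / μ ^ 2) * B ^ 2 =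
      2 * (saVar (G₁ ^ 2) μ * B ^ 2) + 2 * (1 / μ ^ 2 * B ^ 2) := by ring
  rw [h7]
  linarith

/-- A bound for the second moment of the critic output. -/
def criticMom (lam cγ : ℝ) : ℝ :=
  2 * (saVar (cγ + 3) (lam / 2) * (cγ + 1) ^ 2) + 2 * ((cγ + 1) / (lam / 2)) ^ 2

/-- A bound for the second moment of the actor output. -/
def actorMom (G₁ μ lam cγ : ℝ) : ℝ :=
  (2 * saVar (G₁ ^ 2) μ + 2 / μ ^ 2) * (G₁ ^ 2 * (2 + 18 * criticMom lam cγ))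

/-- The constant in the bound for the bias of the actor output. -/
def actorBias (G₁ μ lam cγ : ℝ) (τ : ℕ) : ℝ :=
  saBias (G₁ ^ 2) μ * τ * (G₁ * (1 + 3 * √(criticMom lam cγ))) +
    3 * G₁ / μ * (saBias (cγ + 3) (lam / 2) * τ * (cγ + 1)) + 2 * G₁ / μ

theorem criticMom_nonneg (lam cγ : ℝ) : 0 ≤ criticMom lam cγ := by
  have := saVar_nonneg (cγ + 3) (lam / 2)
  unfold criticMom; positivity

theorem actorMom_nonneg (G₁ μ lam cγ : ℝ) : 0 ≤ actorMom G₁ μ lam cγ := by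
  have := saVar_nonneg (G₁ ^ 2) μ
  have := criticMom_nonneg lam cγ
  unfold actorMom; positivity

/-- The inner loops of an epoch are well tuned. -/
structure Tuned (G₁ μ lam : ℝ) (p : Params) (τ : ℕ) : Prop where
  critic : StepSmall τ p.Tmax p.γξ (p.cγ + 3) (lam / 2)
  critic_len : Real.log p.Tmax ≤ p.γξ * (lam / 2) * p.H
  actor : StepSmall τ p.Tmax p.γω (G₁ ^ 2) μ
  actor_len : Real.log p.Tmax ≤ p.γω * μ * p.H

/-- The standing assumptions, at one parameter. -/
structure Setup (M : CMDP S A) (π : E d → Policy S A) (φ : Sig → S → E m) (p : Params)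
    (G₁ G₂ μ lam : ℝ) (τ : ℕ) : Prop where
  ergodic : M.Ergodic
  feat : ∀ g s, ‖φ g s‖ ≤ 1
  score : ScoreBounds π G₁ G₂
  fisher : FisherNonDeg M π μ
  posDef : CriticPosDef M π φ lam
  errFin : CriticErrFinite M π φ p.cγ
  G₁_pos : 0 < G₁
  μ_pos : 0 < μ
  lam_pos : 0 < lam
  cγ_ge : lam + √(1 / lam ^ 2 - 1) ≤ p.cγ
  mix : ∀ θ, M.mixTime (π θ) ≤ τ
  one_le : 1 ≤ τ
  tuned : Tuned G₁ μ lam p τ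

theorem Setup.cγ_pos (h : Setup M π φ p G₁ G₂ μ lam τ) : 0 < p.cγ := by
  linarith [Real.sqrt_nonneg (1 / lam ^ 2 - 1), h.cγ_ge, h.lam_pos]

theorem Setup.finSupp_critic (h : Setup M π φ p G₁ G₂ μ lam τ) (θ : E d) (s : S) :
    FinSupp (iterLaw (criticStep M π φ p θ) p.H (s, 0)) :=
  finSupp_iterLaw (finSupp_criticStep M π φ h.tuned.critic.T_ne θ) p.H (s, 0)

theorem Setup.finSupp_actor (h : Setup M π φ p G₁ G₂ μ lam τ) (θ : E d) (ξ : Sig → Critic m)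
    (s : S) : FinSupp (iterLaw (actorStep M π φ p θ ξ) p.H (s, 0)) :=
  finSupp_iterLaw (finSupp_actorStep M π φ h.tuned.critic.T_ne θ ξ) p.H (s, 0)

theorem Setup.critic_bounds (h : Setup M π φ p G₁ G₂ μ lam τ) (θ : E d) (g : Sig) (s : S) :
    ‖critEmb (xiStar M π φ p.cγ g θ)‖ ≤ (p.cγ + 1) / (lam / 2) ∧
    ev (iterLaw (criticStep M π φ p θ) p.H (s, 0))
      (fun y => ‖critEmb (y.2 g) - critEmb (xiStar M π φ p.cγ g θ)‖ ^ 2) ≤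
        saVar (p.cγ + 3) (lam / 2) * (p.cγ + 1) ^ 2 ∧
    ‖ev (iterLaw (criticStep M π φ p θ) p.H (s, 0)) (fun y => critEmb (y.2 g)) -
      critEmb (xiStar M π φ p.cγ g θ)‖ ≤
        saBias (p.cγ + 3) (lam / 2) * τ / √p.Tmax * (p.cγ + 1) :=
  PDNAC.critic_bounds h.ergodic h.feat h.lam_pos h.cγ_ge h.posDef (h.mix θ) h.one_le
    h.tuned.critic h.tuned.critic_len g s

theorem Setup.critic_sq (h : Setup M π φ p G₁ G₂ μ lam τ) (θ : E d) (g : Sig) (s : S) :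
    ev (iterLaw (criticStep M π φ p θ) p.H (s, 0)) (fun y => ‖critEmb (y.2 g)‖ ^ 2) ≤
      criticMom lam p.cγ := by
  obtain ⟨h1, h2, -⟩ := h.critic_bounds θ g s
  have hI := h.finSupp_critic θ s
  set xs := critEmb (xiStar M π φ p.cγ g θ)
  have h4 : ∀ y ∈ (iterLaw (criticStep M π φ p θ) p.H (s, 0)).support,
      ‖critEmb (y.2 g)‖ ^ 2 ≤ 2 * ‖critEmb (y.2 g) - xs‖ ^ 2 + 2 * ‖xs‖ ^ 2 := by
    intro y _
    simpa using norm_add_sq_le_two (critEmb (y.2 g) - xs) xs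
  refine (hI.ev_mono h4).trans ?_
  rw [hI.ev_add, hI.ev_const, hI.ev_mul]
  have h5 := pow_le_pow_left₀ (norm_nonneg _) h1 2
  unfold criticMom
  linarith

theorem Setup.critic_abs (h : Setup M π φ p G₁ G₂ μ lam τ) (θ : E d) (g : Sig) (s : S) :
    ev (iterLaw (criticStep M π φ p θ) p.H (s, 0)) (fun y => ‖critEmb (y.2 g)‖) ≤
      √(criticMom lam p.cγ) :=
  ((h.finSupp_critic θ s).ev_le_sqrt _).trans (Real.sqrt_le_sqrt (h.critic_sq θ g s))

theorem Setup.critErr_le (h : Setup M π φ p G₁ G₂ μ lam τ) (θ : E d) (g : Sig) :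
    critErr M π φ p.cγ g θ ≤ epsApp M π φ p.cγ := by
  cases g
  · exact (le_ciSup (h.errFin .r) θ).trans (le_max_left _ _)
  · exact (le_ciSup (h.errFin .c) θ).trans (le_max_right _ _)

/-- The critic approximation error controls the error of the policy gradient. -/
theorem Setup.norm_grad_sub_le (h : Setup M π φ p G₁ G₂ μ lam τ) (θ : E d) (g : Sig) :
    ‖ev (statLaw M (π θ)) (fun z =>
        advEst M φ g (xiStar M π φ p.cγ g θ) z • scoreZ π θ z) -
      ev (statLaw M (π θ)) (fun z => M.Adv g (π θ) z.1 z.2.1 • scoreZ π θ z)‖ ≤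
      2 * G₁ * √(epsApp M π φ p.cγ) := by
  have hF := finSupp_statLaw M (π θ)
  set ξ := xiStar M π φ p.cγ g θ with hξ
  -- The residual of the limiting critic. Given `(s, a)`, the mean temporal difference error minus
  -- the advantage is the expected increment of `e`, because the baseline is exactly `J`.
  set e : S → ℝ := fun s => ∑ i, ξ (Sum.inr i) * φ g s i - M.V g (π θ) s with he
  have hη : ξ (Sum.inl ()) = M.J g (π θ) :=
    xiStar_inl h.ergodic h.feat h.lam_pos h.cγ_ge h.posDef g θ
  have key : ev (statLaw M (π θ)) (fun z => advEst M φ g ξ z • scoreZ π θ z) -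
      ev (statLaw M (π θ)) (fun z => M.Adv g (π θ) z.1 z.2.1 • scoreZ π θ z) =
      ev (statLaw M (π θ)) (fun z => (e z.2.2 - e z.1) • scoreZ π θ z) := by
    rw [← hF.ev_sub, ev_statLaw_eq, ev_statLaw_eq]
    refine Finset.sum_congr rfl fun s _ => Finset.sum_congr rfl fun a _ => ?_
    congr 1
    have hsc : ∀ s', scoreZ π θ (s, a, s') = PDNAC.score π θ s a := fun _ => rfl
    simp only [hsc, ← sub_smul, smul_smul, ← Finset.sum_smul]
    congr 1
    simp only [h.ergodic.adv_eq, advEst, he, hη, mul_sub, mul_add, Finset.sum_sub_distrib,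
      Finset.sum_add_distrib, ← Finset.sum_mul, sum_prob, one_mul]
    ring
  rw [key]
  have hst := M.statDist_isStat (π θ)
  have h1 : ∀ z ∈ (statLaw M (π θ)).support, ‖(e z.2.2 - e z.1) • scoreZ π θ z‖ ≤
      G₁ * (|e z.2.2| + |e z.1|) := by
    intro z _
    rw [norm_smul, mul_comm, Real.norm_eq_abs]
    exact mul_le_mul (norm_scoreZ_le h.score θ z) (abs_sub _ _) (abs_nonneg _) h.G₁_pos.le
  refine (hF.norm_ev_le _).trans ((hF.ev_mono h1).trans ?_)
  -- Both end points of a stationary transition have the stationary law, so the two terms have the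
  -- same mean.
  rw [hF.ev_mul, hF.ev_add, ev_statLaw_next M (π θ) (fun s => |e s|),
    ev_statLaw_fst M (π θ) (fun s => |e s|), ← ev_statPMF]
  have h2 : ev (statPMF M (π θ)) (fun s => |e s|) ≤ √(epsApp M π φ p.cγ) := by
    refine ((finSupp_of_finite _).ev_le_sqrt _).trans (Real.sqrt_le_sqrt ?_)
    refine le_trans (le_of_eq ?_) (h.critErr_le θ g)
    rw [ev_statPMF]
    simp only [sq_abs, smul_eq_mul]
    rfl
  have := mul_le_mul_of_nonneg_left (add_le_add h2 h2) h.G₁_pos.le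
  linarith

/-- Moments of the actor output of an epoch. -/
theorem Setup.actor_sq (h : Setup M π φ p G₁ G₂ μ lam τ) (θ : E d) (g : Sig) (s : S) :
    ev (iterLaw (criticStep M π φ p θ) p.H (s, 0)) (fun y =>
      ev (iterLaw (actorStep M π φ p θ y.2) p.H (y.1, 0)) fun w => ‖w.2 g‖ ^ 2) ≤
        actorMom G₁ μ lam p.cγ := by
  have hI := h.finSupp_critic θ s
  obtain ⟨I, hI1, -, -⟩ := exists_meanOp_inverse h.μ_pos (actK_coercive h.fisher θ)
  have h1 : ∀ y ∈ (iterLaw (criticStep M π φ p θ) p.H (s, 0)).support,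
      ev (iterLaw (actorStep M π φ p θ y.2) p.H (y.1, 0)) (fun w => ‖w.2 g‖ ^ 2) ≤
      (2 * saVar (G₁ ^ 2) μ + 2 / μ ^ 2) * (G₁ ^ 2 * (2 + 18 * ‖critEmb (y.2 g)‖ ^ 2)) := by
    intro y _
    refine (actor_bounds h.ergodic h.feat h.score h.fisher h.G₁_pos h.μ_pos (h.mix θ) h.one_le
      h.tuned.actor h.tuned.actor_len y.2 g y.1 (hI1 _)).1.trans ?_
    have := saVar_nonneg (G₁ ^ 2) μ
    refine mul_le_mul_of_nonneg_left ?_ (by positivity)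
    rw [mul_pow]
    refine mul_le_mul_of_nonneg_left ?_ (by positivity)
    -- This is `(1 + 3x)² ≤ 2 + 18x²`.
    linarith [sq_nonneg (1 - 3 * ‖critEmb (y.2 g)‖)]
  refine (hI.ev_mono h1).trans ?_
  rw [hI.ev_mul, hI.ev_mul, hI.ev_add, hI.ev_const, hI.ev_mul]
  have := saVar_nonneg (G₁ ^ 2) μ
  have := h.critic_sq θ g s
  unfold actorMom
  gcongr

/-- The bias of the actor output of an epoch. -/
theorem Setup.actor_bias (h : Setup M π φ p G₁ G₂ μ lam τ) (θ : E d) (g : Sig) (s : S)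
    {x : E d} (hx : meanOp M (π θ) (actK π θ) x =
      ev (statLaw M (π θ)) fun z => M.Adv g (π θ) z.1 z.2.1 • scoreZ π θ z) :
    ‖ev (iterLaw (criticStep M π φ p θ) p.H (s, 0)) (fun y =>
      ev (iterLaw (actorStep M π φ p θ y.2) p.H (y.1, 0)) fun w => w.2 g) - x‖ ≤
        actorBias G₁ μ lam p.cγ τ * (√(epsApp M π φ p.cγ) + 1 / √p.Tmax) := by
  have hI := h.finSupp_critic θ s
  have hF := finSupp_statLaw M (π θ)
  have hG := h.G₁_pos
  have hμ := h.μ_pos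
  have hc := h.cγ_pos
  have hlam := h.lam_pos
  obtain ⟨I, hI1, hI2, hI3⟩ := exists_meanOp_inverse h.μ_pos (actK_coercive h.fisher θ)
  set q := iterLaw (criticStep M π φ p θ) p.H (s, 0) with hq
  set xs := critEmb (xiStar M π φ p.cγ g θ) with hxs
  let b : S × A × S → E d := fun z => M.sig g z.1 z.2.1 • scoreZ π θ z
  let L : CriticSpace m →ₗ[ℝ] E d :=
    { toFun := fun x => ev (statLaw M (π θ)) fun z => advLin φ g x z • scoreZ π θ z
      map_add' := fun x y => by
        rw [← hF.ev_add]
        congr 1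
        funext z
        rw [← add_smul]
        congr 1
        simp only [advLin, WithLp.add_fst, WithLp.add_snd, inner_add_left]
        ring
      map_smul' := fun c x => by
        rw [RingHom.id_apply, ← hF.ev_smul]
        congr 1
        funext z
        rw [smul_smul]
        congr 1
        simp only [advLin, WithLp.smul_fst, WithLp.smul_snd, inner_smul_left, conj_trivial,
          smul_eq_mul]
        ring }
  have hL : ∀ x, ‖L x‖ ≤ 3 * G₁ * ‖x‖ := by
    intro x
    refine norm_ev_le_of_le hF fun z => ?_
    rw [norm_smul, Real.norm_eq_abs]
    have := mul_le_mul (abs_advLin_le h.feat g x z) (norm_scoreZ_le h.score θ z)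
      (norm_nonneg _) (by positivity)
    linarith
  have hgrad : ∀ ξ : Critic m, (ev (statLaw M (π θ)) fun z =>
      advEst M φ g ξ z • scoreZ π θ z) = ev (statLaw M (π θ)) b + L (critEmb ξ) := by
    intro ξ
    simp only [advEst_eq, add_smul]
    exact hF.ev_add _ _
  set c := saBias (G₁ ^ 2) μ * τ / √p.Tmax with hcdef
  have hc0 : 0 ≤ c := by
    have := saBias_nonneg (a := G₁ ^ 2) (by positivity) hμ
    positivity
  -- The error is split in three: the actor loop against its target for the given critic output, the
  -- critic output against its limit, and the limit critic against the true advantage.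
  have h1 : ‖ev q (fun y => ev (iterLaw (actorStep M π φ p θ y.2) p.H (y.1, 0)) (fun w => w.2 g)) -
      ev q (fun y => I (ev (statLaw M (π θ)) b + L (critEmb (y.2 g))))‖ ≤
      c * (G₁ * (1 + 3 * √(criticMom lam p.cγ))) := by
    rw [← hI.ev_sub]
    have e : ∀ y ∈ q.support,
        ‖ev (iterLaw (actorStep M π φ p θ y.2) p.H (y.1, 0)) (fun w => w.2 g) -
          I (ev (statLaw M (π θ)) b + L (critEmb (y.2 g)))‖ ≤
          c * (G₁ * (1 + 3 * ‖critEmb (y.2 g)‖)) := fun y _ =>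
      (actor_bounds h.ergodic h.feat h.score h.fisher h.G₁_pos h.μ_pos (h.mix θ) h.one_le
        h.tuned.actor h.tuned.actor_len y.2 g y.1 (by rw [hI1, hgrad])).2
    refine (hI.norm_ev_le _).trans ((hI.ev_mono e).trans ?_)
    rw [hI.ev_mul, hI.ev_mul, hI.ev_add, hI.ev_const, hI.ev_mul]
    have := h.critic_abs θ g s
    gcongr
  -- The target of the actor is affine in the critic vector, so only the mean of the critic output
  -- matters here, not its fluctuation.
  have h2 : ‖ev q (fun y => I (ev (statLaw M (π θ)) b + L (critEmb (y.2 g)))) -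
      I (ev (statLaw M (π θ)) b + L xs)‖ ≤
      3 * G₁ / μ * (saBias (p.cγ + 3) (lam / 2) * τ / √p.Tmax * (p.cγ + 1)) := by
    have e : ev q (fun y => I (ev (statLaw M (π θ)) b + L (critEmb (y.2 g)))) =
        I (ev (statLaw M (π θ)) b + L (ev q fun y => critEmb (y.2 g))) := by
      rw [← hI.map_ev, hI.ev_add, hI.ev_const, ← hI.map_ev]
    rw [e, ← map_sub, add_sub_add_left_eq_sub, ← map_sub]
    refine (hI3 _).trans ?_
    have e2 := (hL _).trans (mul_le_mul_of_nonneg_left (h.critic_bounds θ g s).2.2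
      (show 0 ≤ 3 * G₁ by positivity))
    refine (div_le_div_of_nonneg_right e2 hμ.le).trans_eq ?_
    ring
  have h3 : ‖I (ev (statLaw M (π θ)) b + L xs) - x‖ ≤ 2 * G₁ / μ * √(epsApp M π φ p.cγ) := by
    rw [← hI2 x, hx, ← hgrad, ← map_sub]
    refine (hI3 _).trans ((div_le_div_of_nonneg_right (h.norm_grad_sub_le θ g) hμ.le).trans_eq ?_)
    ring
  have h4 := (norm_sub_le_norm_sub_add_norm_sub _ _ _).trans
    (add_le_add ((norm_sub_le_norm_sub_add_norm_sub _ _ _).trans (add_le_add h1 h2)) h3)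
  refine h4.trans ?_
  set u := 1 / √(p.Tmax : ℝ) with hu
  have hu0 : 0 ≤ u := by positivity
  set v := √(epsApp M π φ p.cγ)
  have hv0 : 0 ≤ v := Real.sqrt_nonneg _
  have e1 : c * (G₁ * (1 + 3 * √(criticMom lam p.cγ))) =
      saBias (G₁ ^ 2) μ * τ * (G₁ * (1 + 3 * √(criticMom lam p.cγ))) * u := by
    rw [hcdef, hu]; ring
  have e2 : 3 * G₁ / μ * (saBias (p.cγ + 3) (lam / 2) * τ / √p.Tmax * (p.cγ + 1)) =
      3 * G₁ / μ * (saBias (p.cγ + 3) (lam / 2) * τ * (p.cγ + 1)) * u := by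
    rw [hu]; ring
  rw [e1, e2]
  have s1 := saBias_nonneg (a := G₁ ^ 2) (by positivity) hμ
  have s2 := saBias_nonneg (a := p.cγ + 3) (by positivity) (half_pos hlam)
  unfold actorBias
  have p1 : 0 ≤ saBias (G₁ ^ 2) μ * τ * (G₁ * (1 + 3 * √(criticMom lam p.cγ))) := by positivity
  have p2 : 0 ≤ 3 * G₁ / μ * (saBias (p.cγ + 3) (lam / 2) * τ * (p.cγ + 1)) := by positivity
  have p3 : 0 ≤ 2 * G₁ / μ := by positivity
  have q1 := mul_nonneg p1 hv0
  have q2 := mul_nonneg p2 hv0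
  have q3 := mul_nonneg p3 hu0
  linarith

end ActorAnalysis

/-! ### Drift of the potential over one epoch and Lagrangian regret -/

section EpochDrift

variable {S A : Type*} [Fintype S] [DecidableEq S] [Fintype A] {M : CMDP S A} {d m : ℕ}
  {π : E d → Policy S A} {φ : Sig → S → E m} {G₁ G₂ μ lam : ℝ} {p : Params} {τ : ℕ}
  {πs : Policy S A} {εbias : ℝ}

theorem compErr_eq_ev (M : CMDP S A) (π : E d → Policy S A) (π' : Policy S A) (ω θ : E d)
    (l : ℝ) : compErr M π (M.occ π') ω θ l = ev (statLaw M π') fun z =>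
      (inner ℝ (scoreZ π θ z) ω - M.Adv .r (π θ) z.1 z.2.1 - l * M.Adv .c (π θ) z.1 z.2.1) ^ 2 :=
  sum_occ_eq_ev M π' fun s a =>
    (inner ℝ (score π θ s a) ω - M.Adv .r (π θ) s a - l * M.Adv .c (π θ) s a) ^ 2

/-- Solutions of the normal equations minimize the compatible function approximation error. -/
theorem compErr_minimal {θ : E d} {x : Sig → E d}
    (hx : ∀ g, meanOp M (π θ) (actK π θ) (x g) =
      ev (statLaw M (π θ)) fun z => M.Adv g (π θ) z.1 z.2.1 • scoreZ π θ z) (l : ℝ) (ω' : E d) :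
    compErr M π (M.occ (π θ)) (x .r + l • x .c) θ l ≤ compErr M π (M.occ (π θ)) ω' θ l := by
  have hF := finSupp_statLaw M (π θ)
  set ω := x .r + l • x .c with hω
  rw [compErr_eq_ev, compErr_eq_ev]
  set R : S × A × S → ℝ := fun z => inner ℝ (scoreZ π θ z) ω - M.Adv .r (π θ) z.1 z.2.1 -
    l * M.Adv .c (π θ) z.1 z.2.1 with hR
  -- By the normal equations the residual is orthogonal to every direction of the score, so a change
  -- of `ω` adds a square.
  have horth : ev (statLaw M (π θ)) (fun z => R z * inner ℝ (scoreZ π θ z) (ω' - ω)) = 0 := by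
    have e1 : ev (statLaw M (π θ)) (fun z => R z • scoreZ π θ z) = 0 := by
      have e2 : ∀ z, R z • scoreZ π θ z = actK π θ z ω -
          (M.Adv .r (π θ) z.1 z.2.1 • scoreZ π θ z +
            l • (M.Adv .c (π θ) z.1 z.2.1 • scoreZ π θ z)) := by
        intro z
        rw [actK_apply, hR, smul_smul, ← add_smul, ← sub_smul]
        congr 1
        ring
      simp_rw [e2]
      rw [hF.ev_sub, hF.ev_add, hF.ev_smul, ← hx, ← hx, ← map_smul, ← map_add, ← hω]
      exact sub_self _
    have e3 := hF.map_ev (innerₗ (E d) (ω' - ω)) fun z => R z • scoreZ π θ z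
    rw [e1, map_zero] at e3
    rw [e3]
    congr 1
    funext z
    rw [innerₗ_apply_apply, inner_smul_right, real_inner_comm]
  have e4 : ∀ z, (inner ℝ (scoreZ π θ z) ω' - M.Adv .r (π θ) z.1 z.2.1 -
      l * M.Adv .c (π θ) z.1 z.2.1) ^ 2 =
      R z ^ 2 + (2 * (R z * inner ℝ (scoreZ π θ z) (ω' - ω)) +
        (inner ℝ (scoreZ π θ z) (ω' - ω)) ^ 2) := by
    intro z
    rw [hR, inner_sub_right]
    ring
  simp_rw [e4]
  rw [hF.ev_add, hF.ev_add, hF.ev_mul, horth]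
  have := hF.ev_nonneg (f := fun z => (inner ℝ (scoreZ π θ z) (ω' - ω)) ^ 2)
    fun z => sq_nonneg _
  linarith

/-- The mean of the score under the optimal occupancy measure. -/
def scoreStar (M : CMDP S A) (π : E d → Policy S A) (πs : Policy S A) (θ : E d) : E d :=
  ev (statLaw M πs) (scoreZ π θ)

theorem norm_scoreStar_le (hS : ScoreBounds π G₁ G₂) (θ : E d) :
    ‖scoreStar M π πs θ‖ ≤ G₁ :=
  norm_ev_le_of_le (finSupp_statLaw M πs) (norm_scoreZ_le hS θ)

theorem inner_scoreStar (M : CMDP S A) (π : E d → Policy S A) (πs : Policy S A) (θ v : E d) :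
    inner ℝ (scoreStar M π πs θ) v = ev (statLaw M πs) fun z => inner ℝ (scoreZ π θ z) v := by
  have h := (finSupp_statLaw M πs).map_ev (innerₗ (E d) v) (scoreZ π θ)
  rw [scoreStar, real_inner_comm]
  refine h.trans ?_
  congr 1
  funext z
  exact real_inner_comm (scoreZ π θ z) v

/-- The gain along the natural policy gradient direction. -/
theorem CMDP.Ergodic.npg_gain (hM : M.Ergodic) {δ : ℝ} (hb : BiasBound M π πs δ εbias) {θ : E d}
    {x : Sig → E d} (hx : ∀ g, meanOp M (π θ) (actK π θ) (x g) =
      ev (statLaw M (π θ)) fun z => M.Adv g (π θ) z.1 z.2.1 • scoreZ π θ z)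
    {l : ℝ} (hl : l ∈ Set.Icc 0 (2 / δ)) :
    M.J .r πs - M.J .r (π θ) + l * (M.J .c πs - M.J .c (π θ)) - √εbias ≤
      inner ℝ (scoreStar M π πs θ) (x .r + l • x .c) := by
  have hF := finSupp_statLaw M πs
  -- One combination of the two solutions minimizes the error for each multiplier `l`, so the bias
  -- assumption applies to it.
  have h := hb θ l hl _ (compErr_minimal hx l)
  rw [compErr_eq_ev] at h
  have h1 := (hF.ev_le_sqrt fun z => -(inner ℝ (scoreZ π θ z) (x .r + l • x .c) -
    M.Adv .r (π θ) z.1 z.2.1 - l * M.Adv .c (π θ) z.1 z.2.1))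
  simp only [neg_sq] at h1
  have h2 := h1.trans (Real.sqrt_le_sqrt h)
  have e : ∀ z : S × A × S, -(inner ℝ (scoreZ π θ z) (x .r + l • x .c) -
      M.Adv .r (π θ) z.1 z.2.1 - l * M.Adv .c (π θ) z.1 z.2.1) =
      (M.Adv .r (π θ) z.1 z.2.1 + l * M.Adv .c (π θ) z.1 z.2.1) -
        inner ℝ (scoreZ π θ z) (x .r + l • x .c) := fun z => by ring
  simp_rw [e] at h2
  rw [hF.ev_sub, hF.ev_add, hF.ev_mul, ← inner_scoreStar] at h2
  have e2 : ∀ g, ev (statLaw M πs) (fun z => M.Adv g (π θ) z.1 z.2.1) =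
      M.J g πs - M.J g (π θ) := by
    intro g
    rw [← hM.sum_occ_adv, ← sum_occ_eq_ev M πs (M.Adv g (π θ))]
    rfl
  rw [e2, e2] at h2
  linarith

/-- The mean value theorem evaluates the score at one point of the segment, which costs `G₂` instead
of the `G₂ / 2` that integration would give. -/
theorem log_prob_sub_ge (hS : ScoreBounds π G₁ G₂) (hG₂ : 0 ≤ G₂) (θ v : E d) (s : S) (a : A) :
    inner ℝ (score π θ s a) v - G₂ * ‖v‖ ^ 2 ≤
      Real.log (prob (π (θ + v) s) a) - Real.log (prob (π θ s) a) := by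
  obtain ⟨z, hz, he⟩ := domain_mvt (f := fun θ' => Real.log (prob (π θ' s) a)) (s := Set.univ)
    (x := θ) (y := θ + v) (f' := fun θ' => InnerProductSpace.toDual ℝ (E d) (score π θ' s a))
    (fun θ' _ => ((hS.diff s a θ').hasGradientAt.hasFDerivAt).hasFDerivWithinAt) convex_univ
    (Set.mem_univ _) (Set.mem_univ _)
  rw [he, add_sub_cancel_left, InnerProductSpace.toDual_apply_apply]
  have hzn : ‖z - θ‖ ≤ ‖v‖ := by
    rw [segment_eq_image'] at hz
    obtain ⟨t, ht, rfl⟩ := hz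
    rw [add_sub_cancel_left, add_sub_cancel_left, norm_smul, Real.norm_of_nonneg ht.1]
    exact mul_le_of_le_one_left (norm_nonneg _) ht.2
  have h1 : inner ℝ (score π z s a) v = inner ℝ (score π θ s a) v -
      inner ℝ (score π θ s a - score π z s a) v := by rw [inner_sub_left]; ring
  have h2 := real_inner_le_norm (score π θ s a - score π z s a) v
  have h3 : ‖score π θ s a - score π z s a‖ ≤ G₂ * ‖v‖ := by
    rw [norm_sub_rev]
    exact (hS.lip z θ s a).trans (mul_le_mul_of_nonneg_left hzn hG₂)
  have h4 := mul_le_mul_of_nonneg_right h3 (norm_nonneg v)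
  rw [h1]
  nlinarith

theorem klFrom_eq (M : CMDP S A) (πs π' : Policy S A) :
    M.klFrom πs π' =
      ∑ s, ∑ a, M.occ πs s a * Real.log (prob (πs s) a / prob (π' s) a) := by
  simp only [CMDP.klFrom, CMDP.occ, Finset.mul_sum, mul_assoc]

/-- Gibbs' inequality, from `1 - 1/x ≤ log x`; actions to which `πs` gives no mass are treated
apart. -/
theorem klFrom_nonneg (M : CMDP S A) (πs : Policy S A) {π' : Policy S A}
    (hpos : ∀ s a, 0 < prob (π' s) a) : 0 ≤ M.klFrom πs π' := by
  refine Finset.sum_nonneg fun s _ => mul_nonneg ((M.statDist_isStat πs).1 s) ?_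
  have h : ∑ a, (prob (πs s) a - prob (π' s) a) ≤
      ∑ a, prob (πs s) a * Real.log (prob (πs s) a / prob (π' s) a) := by
    refine Finset.sum_le_sum fun a _ => ?_
    rcases (prob_nonneg (πs s) a).eq_or_lt with h0 | h0
    · rw [← h0, zero_mul, zero_sub]
      linarith [hpos s a]
    · have h1 := Real.one_sub_inv_le_log_of_pos (div_pos h0 (hpos s a))
      have h2 := mul_le_mul_of_nonneg_left h1 h0.le
      have h3 : prob (πs s) a * (1 - (prob (πs s) a / prob (π' s) a)⁻¹) =
          prob (πs s) a - prob (π' s) a := by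
        have := (hpos s a).ne'
        field_simp
      linarith
  rw [Finset.sum_sub_distrib, sum_prob, sum_prob, sub_self] at h
  exact h

/-- The entropy of `πs` cancels in the difference of divergences, leaving the mean change of the
log-likelihood under the occupancy measure of `πs`. -/
theorem klFrom_step (hS : ScoreBounds π G₁ G₂) (hG₂ : 0 ≤ G₂) (θ v : E d) :
    M.klFrom πs (π (θ + v)) ≤
      M.klFrom πs (π θ) - inner ℝ (scoreStar M π πs θ) v + G₂ * ‖v‖ ^ 2 := by
  have hF := finSupp_statLaw M πs
  have h1 : M.klFrom πs (π θ) - M.klFrom πs (π (θ + v)) =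
      ∑ s, ∑ a, M.occ πs s a •
        (Real.log (prob (π (θ + v) s) a) - Real.log (prob (π θ s) a)) := by
    simp only [klFrom_eq, ← Finset.sum_sub_distrib]
    refine Finset.sum_congr rfl fun s _ => Finset.sum_congr rfl fun a _ => ?_
    rw [smul_eq_mul, ← mul_sub]
    rcases (prob_nonneg (πs s) a).eq_or_lt with h0 | h0
    · rw [CMDP.occ, ← h0]; simp
    · rw [Real.log_div h0.ne' (hS.pos _ _ _).ne', Real.log_div h0.ne' (hS.pos _ _ _).ne']
      ring
  rw [sum_occ_eq_ev M πs fun s a =>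
    Real.log (prob (π (θ + v) s) a) - Real.log (prob (π θ s) a)] at h1
  have h2 := hF.ev_mono (f := fun z => inner ℝ (scoreZ π θ z) v - G₂ * ‖v‖ ^ 2)
    fun z _ => log_prob_sub_ge hS hG₂ θ v z.1 z.2.1
  rw [hF.ev_sub, hF.ev_const, ← inner_scoreStar] at h2
  linarith

theorem Setup.finSupp_epoch (h : Setup M π φ p G₁ G₂ μ lam τ) (x : AlgState S d) :
    FinSupp (epoch M π φ p x) :=
  (h.finSupp_critic x.θ x.state).bind fun y => (h.finSupp_actor x.θ y.2 y.1).map _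

theorem Setup.ev_epoch (h : Setup M π φ p G₁ G₂ μ lam τ) (x : AlgState S d)
    (f : AlgState S d → ℝ) :
    ev (epoch M π φ p x) f = ev (iterLaw (criticStep M π φ p x.θ) p.H (x.state, 0)) fun y =>
      ev (iterLaw (actorStep M π φ p x.θ y.2) p.H (y.1, 0)) fun w =>
        f { state := w.1
            θ := x.θ + p.α • (w.2 .r + x.lam • w.2 .c)
            lam := max 0 (min (2 / p.δ) (x.lam - p.β * y.2 .c (Sum.inl ()))) } := by
  rw [epoch, (h.finSupp_critic x.θ x.state).ev_bind fun y => (h.finSupp_actor x.θ y.2 y.1).map _]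
  simp_rw [(h.finSupp_actor x.θ _ _).ev_map]

/-- Expected decrease of the divergence to the optimal policy over one epoch. -/
theorem Setup.kl_drift (h : Setup M π φ p G₁ G₂ μ lam τ) (hG₂ : 0 ≤ G₂) (hα : 0 ≤ p.α)
    (hb : BiasBound M π πs p.δ εbias) {x : AlgState S d}
    (hl : x.lam ∈ Set.Icc 0 (2 / p.δ)) :
    ev (epoch M π φ p x) (fun x' => M.klFrom πs (π x'.θ)) ≤
      M.klFrom πs (π x.θ) - p.α * (M.J .r πs - M.J .r (π x.θ) +
        x.lam * (M.J .c πs - M.J .c (π x.θ))) +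
      p.α * (√εbias + G₁ * ((1 + 2 / p.δ) * (actorBias G₁ μ lam p.cγ τ *
        (√(epsApp M π φ p.cγ) + 1 / √p.Tmax)))) +
      p.α ^ 2 * (G₂ * (2 * (1 + (2 / p.δ) ^ 2) * actorMom G₁ μ lam p.cγ)) := by
  obtain ⟨I, hI1, -, -⟩ := exists_meanOp_inverse h.μ_pos (actK_coercive h.fisher x.θ)
  obtain ⟨xd, hxd⟩ : ∃ xd : Sig → E d, ∀ g, meanOp M (π x.θ) (actK π x.θ) (xd g) =
      ev (statLaw M (π x.θ)) fun z => M.Adv g (π x.θ) z.1 z.2.1 • scoreZ π x.θ z :=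
    ⟨fun g => I (ev (statLaw M (π x.θ)) fun z => M.Adv g (π x.θ) z.1 z.2.1 • scoreZ π x.θ z),
      fun g => hI1 _⟩
  have hgain := h.ergodic.npg_gain hb hxd hl
  have hC := h.finSupp_critic x.θ x.state
  set q := iterLaw (criticStep M π φ p x.θ) p.H (x.state, 0) with hq
  set k : S × (Sig → Critic m) → PMF (S × (Sig → E d)) := fun y =>
    iterLaw (actorStep M π φ p x.θ y.2) p.H (y.1, 0) with hk
  have hK : ∀ y, FinSupp (k y) := fun y => h.finSupp_actor x.θ y.2 y.1
  set l := x.lam with hldef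
  set v := scoreStar M π πs x.θ with hv
  -- The actor output is combined with the dual variable from the start of the epoch, which is fixed
  -- here, so its mean inherits the biases of the two signals linearly.
  set Eω : E d := ev q fun y => ev (k y) fun w => w.2 .r + l • w.2 .c with hEω
  set e := √(epsApp M π φ p.cγ) + 1 / √(p.Tmax : ℝ) with he
  have hbias : ‖Eω - (xd .r + l • xd .c)‖ ≤ (1 + 2 / p.δ) * (actorBias G₁ μ lam p.cγ τ * e) := by
    have hr := h.actor_bias x.θ .r x.state (hxd .r)
    have hc := h.actor_bias x.θ .c x.state (hxd .c)
    have e1 : Eω = ev q (fun y => ev (k y) fun w => w.2 .r) +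
        l • ev q (fun y => ev (k y) fun w => w.2 .c) := by
      rw [← hC.ev_smul, ← hC.ev_add]
      simp_rw [← (hK _).ev_smul, ← (hK _).ev_add]
      rfl
    have e2 : Eω - (xd .r + l • xd .c) = (ev q (fun y => ev (k y) fun w => w.2 .r) - xd .r) +
        l • (ev q (fun y => ev (k y) fun w => w.2 .c) - xd .c) := by
      rw [e1, smul_sub]; abel
    rw [e2]
    refine (norm_add_le _ _).trans ?_
    rw [norm_smul, Real.norm_of_nonneg hl.1]
    have e3 := mul_le_mul hl.2 hc (norm_nonneg _) (hl.1.trans hl.2)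
    linarith
  have hinner : inner ℝ v (xd .r + l • xd .c) -
      G₁ * ((1 + 2 / p.δ) * (actorBias G₁ μ lam p.cγ τ * e)) ≤ inner ℝ v Eω := by
    have e1 : inner ℝ v Eω = inner ℝ v (xd .r + l • xd .c) +
        inner ℝ v (Eω - (xd .r + l • xd .c)) := by rw [← inner_add_right]; simp
    have e2 := abs_real_inner_le_norm v (Eω - (xd .r + l • xd .c))
    have e3 := mul_le_mul (norm_scoreStar_le (M := M) (πs := πs) h.score x.θ) hbias
      (norm_nonneg _) h.G₁_pos.le
    have e4 := neg_abs_le (inner ℝ v (Eω - (xd .r + l • xd .c)))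
    linarith
  have hsq : (ev q fun y => ev (k y) fun w => ‖w.2 .r + l • w.2 .c‖ ^ 2) ≤
      2 * (1 + (2 / p.δ) ^ 2) * actorMom G₁ μ lam p.cγ := by
    have e1 : ∀ w : S × (Sig → E d), ‖w.2 .r + l • w.2 .c‖ ^ 2 ≤
        2 * ‖w.2 .r‖ ^ 2 + 2 * (2 / p.δ) ^ 2 * ‖w.2 .c‖ ^ 2 := by
      intro w
      refine (norm_add_sq_le_two _ _).trans ?_
      rw [norm_smul, mul_pow, Real.norm_of_nonneg hl.1]
      have := mul_le_mul_of_nonneg_right (pow_le_pow_left₀ hl.1 hl.2 2) (sq_nonneg ‖w.2 .c‖)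
      linarith
    refine (hC.ev_mono fun y _ => (hK y).ev_mono fun w _ => e1 w).trans ?_
    simp_rw [(hK _).ev_add, (hK _).ev_mul]
    rw [hC.ev_add, hC.ev_mul, hC.ev_mul]
    have hr := h.actor_sq x.θ .r x.state
    have hc := mul_le_mul_of_nonneg_left (h.actor_sq x.θ .c x.state)
      (show 0 ≤ 2 * (2 / p.δ) ^ 2 by positivity)
    linarith
  rw [h.ev_epoch]
  have hpt : ∀ w : S × (Sig → E d),
      M.klFrom πs (π (x.θ + p.α • (w.2 .r + l • w.2 .c))) ≤
      M.klFrom πs (π x.θ) - p.α * inner ℝ v (w.2 .r + l • w.2 .c) +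
        p.α ^ 2 * G₂ * ‖w.2 .r + l • w.2 .c‖ ^ 2 := by
    intro w
    have := klFrom_step (M := M) (πs := πs) h.score hG₂ x.θ (p.α • (w.2 .r + l • w.2 .c))
    rw [inner_smul_right, norm_smul, mul_pow, Real.norm_eq_abs, sq_abs] at this
    linarith
  refine (hC.ev_mono fun y _ => (hK y).ev_mono fun w _ => hpt w).trans ?_
  simp_rw [(hK _).ev_add, (hK _).ev_sub, (hK _).ev_mul, (hK _).ev_const]
  rw [hC.ev_add, hC.ev_sub, hC.ev_mul, hC.ev_mul, hC.ev_const]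
  have e5 : (ev q fun y => ev (k y) fun w => inner ℝ v (w.2 .r + l • w.2 .c)) = inner ℝ v Eω := by
    have e6 : inner ℝ v Eω = ev q fun y => inner ℝ v (ev (k y) fun w => w.2 .r + l • w.2 .c) :=
      hC.map_ev (innerₗ (E d) v) _
    rw [e6]
    congr 1
    funext y
    exact ((hK y).map_ev (innerₗ (E d) v) _).symm
  rw [e5]
  have e7 := mul_le_mul_of_nonneg_left hsq (show 0 ≤ p.α ^ 2 * G₂ by positivity)
  have e8 := mul_le_mul_of_nonneg_left (sub_le_sub_right hgain
    (G₁ * ((1 + 2 / p.δ) * (actorBias G₁ μ lam p.cγ τ * e)))|>.trans hinner) hα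
  linarith

theorem abs_proj_sub_le {b y l : ℝ} (hl : l ∈ Set.Icc 0 b) : |max 0 (min b y) - l| ≤ |y - l| := by
  obtain ⟨h0, h1⟩ := hl
  rcases le_total y 0 with h | h
  · rw [min_eq_right (by linarith), max_eq_left h, abs_of_nonpos (by linarith),
      abs_of_nonpos (by linarith)]
    linarith
  · rcases le_total y b with h' | h'
    · rw [min_eq_right h', max_eq_right h]
    · rw [min_eq_left h', max_eq_right (by linarith), abs_of_nonneg (by linarith),
        abs_of_nonneg (by linarith)]
      linarith

/-- Expected decrease of the distance of the dual variable to `l₀` over one epoch. -/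
theorem Setup.dual_drift (h : Setup M π φ p G₁ G₂ μ lam τ) (hβ : 0 ≤ p.β) {x : AlgState S d}
    (hl : x.lam ∈ Set.Icc 0 (2 / p.δ)) {l₀ : ℝ} (hl₀ : l₀ ∈ Set.Icc 0 (2 / p.δ)) :
    ev (epoch M π φ p x) (fun x' => (x'.lam - l₀) ^ 2) ≤
      (x.lam - l₀) ^ 2 - 2 * p.β * ((x.lam - l₀) * M.J .c (π x.θ)) +
      2 * p.β * (2 / p.δ *
        (saBias (p.cγ + 3) (lam / 2) * τ / √p.Tmax * (p.cγ + 1))) +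
      p.β ^ 2 * criticMom lam p.cγ := by
  have hC := h.finSupp_critic x.θ x.state
  rw [h.ev_epoch]
  simp_rw [(h.finSupp_actor x.θ _ _).ev_const]
  set q := iterLaw (criticStep M π φ p x.θ) p.H (x.state, 0) with hq
  have hpt : ∀ y ∈ q.support,
      (max 0 (min (2 / p.δ) (x.lam - p.β * y.2 .c (Sum.inl ()))) - l₀) ^ 2 ≤
      (x.lam - l₀) ^ 2 - 2 * p.β * (x.lam - l₀) * y.2 .c (Sum.inl ()) +
        p.β ^ 2 * ‖critEmb (y.2 .c)‖ ^ 2 := by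
    intro y _
    have e1 := sq_le_sq.2 (abs_proj_sub_le (y := x.lam - p.β * y.2 .c (Sum.inl ())) hl₀)
    have e2 := pow_le_pow_left₀ (abs_nonneg _) (norm_fst_le (critEmb (y.2 .c))) 2
    rw [critEmb_fst, sq_abs] at e2
    have e3 := mul_le_mul_of_nonneg_left e2 (sq_nonneg p.β)
    nlinarith
  refine (hC.ev_mono hpt).trans ?_
  rw [hC.ev_add, hC.ev_sub, hC.ev_const, hC.ev_mul, hC.ev_mul]
  have h1 := mul_le_mul_of_nonneg_left (h.critic_sq x.θ .c x.state) (sq_nonneg p.β)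
  have h2 : |ev q (fun y => y.2 .c (Sum.inl ())) - M.J .c (π x.θ)| ≤
      saBias (p.cγ + 3) (lam / 2) * τ / √p.Tmax * (p.cγ + 1) := by
    refine le_trans ?_ (h.critic_bounds x.θ .c x.state).2.2
    let L : CriticSpace m →ₗ[ℝ] ℝ :=
      { toFun := fun x => x.fst, map_add' := fun _ _ => rfl, map_smul' := fun _ _ => rfl }
    have e1 : ev q (fun y => y.2 .c (Sum.inl ())) = L (ev q fun y => critEmb (y.2 .c)) :=
      (hC.map_ev L fun y => critEmb (y.2 .c)).symm
    have e2 : M.J .c (π x.θ) = L (critEmb (xiStar M π φ p.cγ .c x.θ)) :=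
      (xiStar_inl h.ergodic h.feat h.lam_pos h.cγ_ge h.posDef .c x.θ).symm
    rw [e1, e2, ← map_sub]
    exact norm_fst_le _
  set bη := saBias (p.cγ + 3) (lam / 2) * τ / √p.Tmax * (p.cγ + 1)
  -- Both dual variables lie in `[0, 2/δ]`, which bounds the factor of the critic bias.
  have h3 : -((x.lam - l₀) * (ev q (fun y => y.2 .c (Sum.inl ())) - M.J .c (π x.θ))) ≤
      2 / p.δ * bη := by
    refine (neg_le_abs _).trans ?_
    rw [abs_mul]
    refine mul_le_mul ?_ h2 (abs_nonneg _) (hl.1.trans hl.2)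
    rw [abs_le]
    constructor <;> linarith [hl.1, hl.2, hl₀.1, hl₀.2]
  have h4 := mul_le_mul_of_nonneg_left h3 (show 0 ≤ 2 * p.β by positivity)
  linarith

theorem Setup.finSupp_algLaw (h : Setup M π φ p G₁ G₂ μ lam τ) (θ₀ : E d) (k : ℕ) :
    FinSupp (algLaw M π φ p θ₀ k) :=
  (finSupp_of_finite _).bind fun _ => finSupp_iterLaw h.finSupp_epoch k _

theorem Setup.ev_algLaw_succ (h : Setup M π φ p G₁ G₂ μ lam τ) (θ₀ : E d) (k : ℕ)
    (f : AlgState S d → ℝ) :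
    ev (algLaw M π φ p θ₀ (k + 1)) f =
      ev (algLaw M π φ p θ₀ k) fun x => ev (epoch M π φ p x) f := by
  rw [algLaw, algLaw, (finSupp_of_finite _).ev_bind fun _ => finSupp_iterLaw h.finSupp_epoch _ _,
    (finSupp_of_finite _).ev_bind fun _ => finSupp_iterLaw h.finSupp_epoch _ _]
  simp_rw [ev_iterLaw_succ h.finSupp_epoch]

theorem lam_mem_of_mem_algLaw (hδ : 0 < p.δ) {θ₀ : E d} {k : ℕ} {x : AlgState S d}
    (hx : x ∈ (algLaw M π φ p θ₀ k).support) : x.lam ∈ Set.Icc 0 (2 / p.δ) := by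
  rw [algLaw, PMF.mem_support_bind_iff] at hx
  obtain ⟨s, -, hx⟩ := hx
  cases k with
  | zero =>
    rw [iterLaw, PMF.mem_support_pure_iff] at hx
    rw [hx]
    exact ⟨le_rfl, by positivity⟩
  | succ k =>
    rw [iterLaw, PMF.mem_support_bind_iff] at hx
    obtain ⟨x₁, -, hx⟩ := hx
    rw [epoch, PMF.mem_support_bind_iff] at hx
    obtain ⟨y, -, hx⟩ := hx
    rw [PMF.mem_support_map_iff] at hx
    obtain ⟨w, -, rfl⟩ := hx
    exact ⟨le_max_left _ _, max_le (by positivity) (min_le_left _ _)⟩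

/-- The error per epoch in the Lagrangian regret. -/
def epochErr (G₁ G₂ μ lam cγ δ : ℝ) (τ : ℕ) : ℝ :=
  1 + G₁ * ((1 + 2 / δ) * actorBias G₁ μ lam cγ τ) +
    G₂ * (2 * (1 + (2 / δ) ^ 2) * actorMom G₁ μ lam cγ) +
    2 / δ * (saBias (cγ + 3) (lam / 2) * τ * (cγ + 1)) + criticMom lam cγ

theorem actorBias_nonneg {G₁ μ lam cγ : ℝ} {τ : ℕ} (hG : 0 < G₁) (hμ : 0 < μ) (hlam : 0 < lam)
    (hc : 0 < cγ) : 0 ≤ actorBias G₁ μ lam cγ τ := by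
  have s1 := saBias_nonneg (a := G₁ ^ 2) (by positivity) hμ
  have s2 := saBias_nonneg (a := cγ + 3) (by positivity) (half_pos hlam)
  unfold actorBias
  positivity

theorem epochErr_nonneg {G₁ G₂ μ lam cγ δ : ℝ} {τ : ℕ} (hG : 0 < G₁) (hG₂ : 0 < G₂) (hμ : 0 < μ)
    (hlam : 0 < lam) (hc : 0 < cγ) (hδ : 0 < δ) : 0 ≤ epochErr G₁ G₂ μ lam cγ δ τ := by
  have s1 := actorBias_nonneg (τ := τ) hG hμ hlam hc
  have s2 := saBias_nonneg (a := cγ + 3) (by positivity) (half_pos hlam)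
  have s3 := actorMom_nonneg G₁ μ lam cγ
  have s4 := criticMom_nonneg lam cγ
  unfold epochErr
  positivity

/-- All error terms of one epoch are brought to the common scale `aa + bb + 1/t`, where `t = √Tmax`.
The dual terms carry the factor 1/2 of the potential. -/
theorem epochErr_bound {G₁ G₂ μ lam cγ δ aa bb t : ℝ} {τ : ℕ} (hG : 0 < G₁) (hG₂ : 0 < G₂)
    (hμ : 0 < μ) (hlam : 0 < lam) (hc : 0 < cγ) (hδ : 0 < δ) (ha : 0 ≤ aa) (hb : 0 ≤ bb)
    (ht : 0 ≤ t) :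
    1 / t * (aa + G₁ * ((1 + 2 / δ) * (actorBias G₁ μ lam cγ τ * (bb + 1 / t)))) +
      (1 / t) ^ 2 * (G₂ * (2 * (1 + (2 / δ) ^ 2) * actorMom G₁ μ lam cγ)) +
      1 / 2 * (2 * (1 / t) * (2 / δ * (saBias (cγ + 3) (lam / 2) * τ / t * (cγ + 1))) +
        (1 / t) ^ 2 * criticMom lam cγ) ≤
      1 / t * (epochErr G₁ G₂ μ lam cγ δ τ * (aa + bb + 1 / t)) := by
  have s1 := actorBias_nonneg (τ := τ) hG hμ hlam hc
  have s2 := saBias_nonneg (a := cγ + 3) (by positivity) (half_pos hlam)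
  have s3 := actorMom_nonneg G₁ μ lam cγ
  have s4 := criticMom_nonneg lam cγ
  have e1 : saBias (cγ + 3) (lam / 2) * τ / t * (cγ + 1) =
    saBias (cγ + 3) (lam / 2) * τ * (cγ + 1) * (1 / t) := by ring
  rw [e1]
  unfold epochErr
  have t1 : 0 ≤ G₁ * ((1 + 2 / δ) * actorBias G₁ μ lam cγ τ) := by positivity
  have t2 : 0 ≤ G₂ * (2 * (1 + (2 / δ) ^ 2) * actorMom G₁ μ lam cγ) := by positivity
  have t3 : 0 ≤ 2 / δ * (saBias (cγ + 3) (lam / 2) * τ * (cγ + 1)) := by positivity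
  have hu0 : 0 ≤ 1 / t := by positivity
  generalize 1 / t = u at *
  have w0 := mul_nonneg hu0 (add_nonneg hb hu0)
  have w1 := mul_nonneg hu0 (mul_nonneg t1 ha)
  have w2 := mul_nonneg hu0 (mul_nonneg t2 (add_nonneg ha hb))
  have w3 := mul_nonneg hu0 (mul_nonneg t3 (add_nonneg ha hb))
  have w4 := mul_nonneg hu0 (mul_nonneg s4 (add_nonneg ha hb))
  have w5 := mul_nonneg hu0 (mul_nonneg s4 hu0)
  linarith

/-- The primal and dual drifts of one epoch, combined. -/
theorem Setup.potential_drift (h : Setup M π φ p G₁ G₂ μ lam τ) (hG₂ : 0 < G₂)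
    (hα : p.α = 1 / √p.Tmax) (hβ : p.β = 1 / √p.Tmax) (hδ : 0 < p.δ)
    (hb : BiasBound M π πs p.δ εbias) (hJc : 0 ≤ M.J .c πs) {l₀ : ℝ}
    (hl₀ : l₀ ∈ Set.Icc 0 (2 / p.δ)) {x : AlgState S d} (hx : x.lam ∈ Set.Icc 0 (2 / p.δ)) :
    ev (epoch M π φ p x) (fun x' => M.klFrom πs (π x'.θ) + 1 / 2 * (x'.lam - l₀) ^ 2) ≤
      M.klFrom πs (π x.θ) + 1 / 2 * (x.lam - l₀) ^ 2 -
        p.α * (M.J .r πs - M.J .r (π x.θ) - l₀ * M.J .c (π x.θ)) +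
        p.α * (epochErr G₁ G₂ μ lam p.cγ p.δ τ *
          (√εbias + √(epsApp M π φ p.cγ) + 1 / √p.Tmax)) := by
  have hE := h.finSupp_epoch x
  have hα0 : 0 ≤ p.α := by rw [hα]; positivity
  have h1 := h.kl_drift hG₂.le hα0 hb hx
  have h2 := h.dual_drift (by rw [hβ]; positivity) hx hl₀
  rw [hE.ev_add, hE.ev_mul]
  -- Feasibility of `πs` discards this term. The products `x.lam * M.J .c (π x.θ)` in the two drifts
  -- cancel because `α = β`.
  have h4 : 0 ≤ p.α * (x.lam * M.J .c πs) := mul_nonneg hα0 (mul_nonneg hx.1 hJc)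
  have h5 := epochErr_bound (τ := τ) h.G₁_pos hG₂ h.μ_pos h.lam_pos h.cγ_pos hδ
    (Real.sqrt_nonneg εbias) (Real.sqrt_nonneg (epsApp M π φ p.cγ)) (Real.sqrt_nonneg p.Tmax)
  rw [hβ] at h2
  rw [hα] at h1 h4 ⊢
  linarith

/-- The Lagrangian regret of the algorithm against a fixed dual variable `l₀`. -/
theorem Setup.lagrangian_regret (h : Setup M π φ p G₁ G₂ μ lam τ) (hG₂ : 0 < G₂)
    (hα : p.α = 1 / √p.Tmax) (hβ : p.β = 1 / √p.Tmax) (hδ : 0 < p.δ)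
    (hb : BiasBound M π πs p.δ εbias) (hJc : 0 ≤ M.J .c πs) (θ₀ : E d) {l₀ : ℝ}
    (hl₀ : l₀ ∈ Set.Icc 0 (2 / p.δ)) (K : ℕ) :
    p.α * ∑ k ∈ Finset.range K, ev (algLaw M π φ p θ₀ k)
      (fun x => M.J .r πs - M.J .r (π x.θ) - l₀ * M.J .c (π x.θ)) ≤
      M.klFrom πs (π θ₀) + l₀ ^ 2 / 2 + K * (p.α * (epochErr G₁ G₂ μ lam p.cγ p.δ τ *
        (√εbias + √(epsApp M π φ p.cγ) + 1 / √p.Tmax))) := by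
  have hstep := fun (x : AlgState S d) (hx : x.lam ∈ Set.Icc 0 (2 / p.δ)) =>
    h.potential_drift hG₂ hα hβ hδ hb hJc hl₀ hx
  generalize epochErr G₁ G₂ μ lam p.cγ p.δ τ *
        (√εbias + √(epsApp M π φ p.cγ) + 1 / √p.Tmax) = R at hstep ⊢
  have hΨ0 : ∀ x : AlgState S d, 0 ≤ M.klFrom πs (π x.θ) + 1 / 2 * (x.lam - l₀) ^ 2 :=
    fun x => add_nonneg (klFrom_nonneg M πs (h.score.pos x.θ)) (by positivity)
  have hstart : ev (algLaw M π φ p θ₀ 0)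
      (fun x => M.klFrom πs (π x.θ) + 1 / 2 * (x.lam - l₀) ^ 2) =
      M.klFrom πs (π θ₀) + l₀ ^ 2 / 2 := by
    rw [algLaw, (finSupp_of_finite _).ev_bind fun _ => finSupp_iterLaw h.finSupp_epoch _ _]
    simp only [iterLaw, ev_pure]
    rw [(finSupp_of_finite _).ev_const]
    ring
  have hsucc := fun k => h.ev_algLaw_succ θ₀ k
    (fun x => M.klFrom πs (π x.θ) + 1 / 2 * (x.lam - l₀) ^ 2)
  -- The induction keeps the current potential on the left; it is dropped at the end by
  -- nonnegativity.
  have hind : p.α * ∑ k ∈ Finset.range K, ev (algLaw M π φ p θ₀ k)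
      (fun x => M.J .r πs - M.J .r (π x.θ) - l₀ * M.J .c (π x.θ)) +
      ev (algLaw M π φ p θ₀ K) (fun x => M.klFrom πs (π x.θ) + 1 / 2 * (x.lam - l₀) ^ 2) ≤
      M.klFrom πs (π θ₀) + l₀ ^ 2 / 2 + K * (p.α * R) := by
    induction K with
    | zero => rw [hstart]; simp
    | succ K ih =>
      have hF := h.finSupp_algLaw θ₀ K
      rw [hsucc, Finset.sum_range_succ, mul_add]
      have e1 := hF.ev_mono fun x hx => hstep x (lam_mem_of_mem_algLaw hδ hx)
      rw [hF.ev_add, hF.ev_sub, hF.ev_mul, hF.ev_const] at e1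
      push_cast
      linarith
  have hnn := (h.finSupp_algLaw θ₀ K).ev_nonneg hΨ0
  linarith

end EpochDrift

/-! ### Choice of the step sizes and of the loop length -/

section Tuning

theorem log_two_le_log {T : ℕ} (hT : 2 ≤ T) : Real.log 2 ≤ Real.log T :=
  Real.log_le_log (by norm_num) (by exact_mod_cast hT)

/-- The loop length makes `γ`, of order `log T / H`, smaller than the inverse of the `τ log T` in
the second moment; `H ≤ T` turns the same lower bound on `H` into one on `T`, for the bias. The
constants: 3 gives `2ℓ ≤ H` as `ℓ ≥ 2/3`, 80 covers `32 / 0.48`, and 5808 is `16 * 363`. -/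
theorem stepSmall_of_large {τ T H : ℕ} {γ a κ c₀ : ℝ} (hτ : 1 ≤ τ) (hT : 2 ≤ T) (hHT : H ≤ T)
    (ha : 0 < a) (hκ : 0 < κ) (hγ0 : 0 ≤ γ) (hγ : γ * κ * H ≤ 2 * Real.log T)
    (hc : 3 + 80 * a / κ + 5808 * a ^ 2 / κ ^ 2 ≤ c₀)
    (hH : c₀ * τ ^ 2 * Real.log T ^ 2 ≤ H) : StepSmall τ T γ a κ := by
  have hl : (0.6931 : ℝ) ≤ Real.log T := by
    linarith [log_two_le_log hT, Real.log_two_gt_d9]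
  set ℓ := Real.log T with hℓ
  have hτ' : (1 : ℝ) ≤ τ := by exact_mod_cast hτ
  have hHT' : (H : ℝ) ≤ T := by exact_mod_cast hHT
  have p1 : 0 ≤ 80 * a / κ := by positivity
  have p2 : 0 ≤ 5808 * a ^ 2 / κ ^ 2 := by positivity
  have hc₀ : 0 ≤ c₀ := by linarith
  have hτ2 : (τ : ℝ) ≤ τ ^ 2 := by nlinarith
  have hℓ2 : (0.48 : ℝ) ≤ ℓ ^ 2 := by nlinarith
  have hlow : ∀ c, 0 ≤ c → c ≤ c₀ → c * (τ * ℓ ^ 2) ≤ H := by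
    intro c hc0 hcc
    refine le_trans ?_ hH
    rw [mul_assoc]
    gcongr
  have hH3 := hlow 3 (by norm_num) (by linarith)
  have hτℓ : 0.48 * (τ : ℝ) ≤ τ * ℓ ^ 2 := by nlinarith
  have hH0 : (0 : ℝ) < H := by nlinarith
  have hT0 : (0 : ℝ) < T := by linarith
  have hJ : (Nat.log 2 T : ℝ) ≤ 1.5 * ℓ := by
    have h1 : ((2 : ℝ) ^ Nat.log 2 T) ≤ T := by
      exact_mod_cast Nat.pow_log_le_self 2 (by lia)
    have h2 := Real.log_le_log (by positivity) h1
    rw [Real.log_pow] at h2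
    have h3 : (0 : ℝ) ≤ Nat.log 2 T := by positivity
    nlinarith [Real.log_two_gt_d9]
  refine ⟨by lia, hγ0, ?_, ?_, ?_⟩
  · have h1 : γ * κ * H ≤ 1 * H := by
      have : ℓ ^ 2 ≤ τ * ℓ ^ 2 := by nlinarith
      nlinarith
    exact le_of_mul_le_mul_right h1 hH0
  · have h1 := hlow (80 * a / κ) p1 (by linarith)
    have h2 : 80 * a / κ * (0.48 * τ) ≤ T :=
      (mul_le_mul_of_nonneg_left hτℓ p1).trans (h1.trans hHT')
    have h3 : κ * (80 * a / κ * (0.48 * τ)) = 38.4 * (a * τ) := by field_simp; norm_num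
    have h4 := mul_le_mul_of_nonneg_left h2 hκ.le
    rw [h3] at h4
    have h5 : 4 * (8 * (τ : ℝ) / T) * a = 32 * (a * τ) / T := by ring
    rw [h5, div_le_iff₀ hT0]
    have : 0 ≤ a * (τ : ℝ) := by positivity
    linarith
  · have h1 := hlow (5808 * a ^ 2 / κ ^ 2) p2 (by linarith)
    have h2 : κ ^ 2 * (5808 * a ^ 2 / κ ^ 2 * (τ * ℓ ^ 2)) = 5808 * a ^ 2 * (τ * ℓ ^ 2) := by
      field_simp
    have h3 := mul_le_mul_of_nonneg_left h1 (sq_nonneg κ)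
    rw [h2] at h3
    have hJ0 : (0 : ℝ) ≤ Nat.log 2 T := by positivity
    -- Here `240 * 1.5 = 360`, and the remaining 2 is at most `3ℓ`.
    have hσ : 2 + 12 * (4 + 16 * (τ : ℝ)) * Nat.log 2 T ≤ 363 * (τ * ℓ) := by
      have e1 : 12 * (4 + 16 * (τ : ℝ)) * Nat.log 2 T ≤ 240 * τ * (1.5 * ℓ) := by
        have : 12 * (4 + 16 * (τ : ℝ)) ≤ 240 * τ := by linarith
        gcongr
      have e2 : ℓ ≤ τ * ℓ := by nlinarith
      linarith
    set σ := 2 + 12 * (4 + 16 * (τ : ℝ)) * Nat.log 2 T with hσdef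
    have hσ0 : 0 ≤ σ := by positivity
    have h4 : 8 * γ * σ * a ^ 2 * (κ * H) ≤ κ * (κ * H) := by
      calc 8 * γ * σ * a ^ 2 * (κ * H) = γ * κ * H * (8 * σ * a ^ 2) := by ring
        _ ≤ 2 * ℓ * (8 * σ * a ^ 2) := by gcongr
        _ = 16 * ℓ * a ^ 2 * σ := by ring
        _ ≤ 16 * ℓ * a ^ 2 * (363 * (τ * ℓ)) := by gcongr
        _ = 5808 * a ^ 2 * (τ * ℓ ^ 2) := by ring
        _ ≤ κ ^ 2 * H := h3
        _ = κ * (κ * H) := by ring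
    exact le_of_mul_le_mul_right h4 (by positivity)

/-- The constant in the lower bound on the inner loop size. -/
def loopConst (G₁ μ lam cγ : ℝ) : ℝ :=
  (3 + 80 * (cγ + 3) / (lam / 2) + 5808 * (cγ + 3) ^ 2 / (lam / 2) ^ 2) +
    (3 + 80 * G₁ ^ 2 / μ + 5808 * (G₁ ^ 2) ^ 2 / μ ^ 2) + 48 * cγ ^ 2 / lam ^ 2 +
    8 * (6 * G₁ ^ 4 + 2 * G₁ ^ 2) / μ ^ 2

/-- After clearing denominators, each bound needs one summand of `loopConst`: `48 = 2 * 24` and `8 =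
2 * 4`, where the 2 comes from `2 log T`. -/
theorem stepsize_bounds {G₁ μ lam cγ δ : ℝ} {τ T H : ℕ} (hG : 0 < G₁) (hμ : 0 < μ)
    (hlam : 0 < lam) (hc : 0 < cγ) (hτ : 1 ≤ τ) (hT : 2 ≤ T)
    (hH : loopConst G₁ μ lam cγ * τ ^ 2 * Real.log T ^ 2 ≤ H) :
    (horizonParams μ lam cγ δ T H).γξ ≤ lam / (24 * cγ ^ 2 * τ * Real.log T) ∧
    (horizonParams μ lam cγ δ T H).γω ≤
      μ / (4 * (6 * G₁ ^ 4 * τ * Real.log T + 2 * G₁ ^ 2 * τ ^ 2 * Real.log T)) := by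
  have hl : 0 < Real.log T := by
    linarith [log_two_le_log hT, Real.log_two_gt_d9]
  set ℓ := Real.log T with hℓ
  have hτ' : (1 : ℝ) ≤ τ := by exact_mod_cast hτ
  have p1 : 0 ≤ 80 * (cγ + 3) / (lam / 2) := by positivity
  have p2 : 0 ≤ 5808 * (cγ + 3) ^ 2 / (lam / 2) ^ 2 := by positivity
  have p3 : 0 ≤ 80 * G₁ ^ 2 / μ := by positivity
  have p4 : 0 ≤ 5808 * (G₁ ^ 2) ^ 2 / μ ^ 2 := by positivity
  have p5 : 0 ≤ 48 * cγ ^ 2 / lam ^ 2 := by positivity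
  have p6 : 0 ≤ 8 * (6 * G₁ ^ 4 + 2 * G₁ ^ 2) / μ ^ 2 := by positivity
  have hlow : ∀ c, c ≤ loopConst G₁ μ lam cγ → c * (τ ^ 2 * ℓ ^ 2) ≤ H := by
    intro c hcc
    refine le_trans ?_ hH
    rw [mul_assoc]
    gcongr
  have hH0 : (0 : ℝ) < H :=
    lt_of_lt_of_le (by positivity) (hlow 3 (by unfold loopConst; linarith))
  have hτ2 : (τ : ℝ) ≤ τ ^ 2 := by nlinarith
  constructor
  · change 2 * ℓ / (lam * H) ≤ _
    rw [div_le_div_iff₀ (by positivity) (by positivity)]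
    have h1 := hlow (48 * cγ ^ 2 / lam ^ 2) (by unfold loopConst; linarith)
    have h2 := mul_le_mul_of_nonneg_left h1 (sq_nonneg lam)
    have h3 : lam ^ 2 * (48 * cγ ^ 2 / lam ^ 2 * (τ ^ 2 * ℓ ^ 2)) =
        48 * cγ ^ 2 * ℓ ^ 2 * τ ^ 2 := by field_simp
    rw [h3] at h2
    have h4 : 48 * cγ ^ 2 * ℓ ^ 2 * τ ≤ 48 * cγ ^ 2 * ℓ ^ 2 * τ ^ 2 := by gcongr
    linarith
  · change 2 * ℓ / (μ * H) ≤ _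
    rw [div_le_div_iff₀ (by positivity) (by positivity)]
    have h1 := hlow (8 * (6 * G₁ ^ 4 + 2 * G₁ ^ 2) / μ ^ 2) (by unfold loopConst; linarith)
    have h2 := mul_le_mul_of_nonneg_left h1 (sq_nonneg μ)
    have h3 : μ ^ 2 * (8 * (6 * G₁ ^ 4 + 2 * G₁ ^ 2) / μ ^ 2 * (τ ^ 2 * ℓ ^ 2)) =
        48 * G₁ ^ 4 * ℓ ^ 2 * τ ^ 2 + 16 * G₁ ^ 2 * ℓ ^ 2 * τ ^ 2 := by field_simp; ring
    rw [h3] at h2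
    have h4 : 48 * G₁ ^ 4 * ℓ ^ 2 * τ ≤ 48 * G₁ ^ 4 * ℓ ^ 2 * τ ^ 2 := by gcongr
    linarith

theorem tuned_of_large {G₁ μ lam cγ δ : ℝ} {τ T H : ℕ} (hG : 0 < G₁) (hμ : 0 < μ)
    (hlam : 0 < lam) (hc : 0 < cγ) (hτ : 1 ≤ τ) (hT : 2 ≤ T) (hH1 : 1 ≤ H) (hHT : H ≤ T)
    (hH : loopConst G₁ μ lam cγ * τ ^ 2 * Real.log T ^ 2 ≤ H) :
    Tuned G₁ μ lam (horizonParams μ lam cγ δ T H) τ := by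
  have hl : 0 < Real.log T := by
    linarith [log_two_le_log hT, Real.log_two_gt_d9]
  have hH0 : (0 : ℝ) < H := by exact_mod_cast hH1
  have p1 : 0 ≤ 80 * (cγ + 3) / (lam / 2) := by positivity
  have p2 : 0 ≤ 5808 * (cγ + 3) ^ 2 / (lam / 2) ^ 2 := by positivity
  have p3 : 0 ≤ 80 * G₁ ^ 2 / μ := by positivity
  have p4 : 0 ≤ 5808 * (G₁ ^ 2) ^ 2 / μ ^ 2 := by positivity
  have p5 : 0 ≤ 48 * cγ ^ 2 / lam ^ 2 := by positivity
  have p6 : 0 ≤ 8 * (6 * G₁ ^ 4 + 2 * G₁ ^ 2) / μ ^ 2 := by positivity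
  -- The critic operator is only `lam / 2`-coercive, so the factor 2 in its step size is just enough
  -- for the required length.
  have e1 : 2 * Real.log T / (lam * H) * (lam / 2) * H = Real.log T := by field_simp
  have e2 : 2 * Real.log T / (μ * H) * μ * H = 2 * Real.log T := by field_simp
  have e3 : Real.log T ≤ 2 * Real.log T := by linarith
  refine ⟨?_, e1.ge, ?_, e3.trans e2.ge⟩
  · refine stepSmall_of_large hτ hT hHT (by change 0 < cγ + 3; positivity) (by positivity) ?_ ?_ ?_ hH
    · change 0 ≤ 2 * Real.log T / (lam * H); positivity
    · exact e1.le.trans e3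
    · change 3 + 80 * (cγ + 3) / (lam / 2) + 5808 * (cγ + 3) ^ 2 / (lam / 2) ^ 2 ≤ _
      unfold loopConst; linarith
  · refine stepSmall_of_large hτ hT hHT (by positivity) hμ ?_ e2.le ?_ hH
    · change 0 ≤ 2 * Real.log T / (μ * H); positivity
    · unfold loopConst; linarith

end Tuning

/-! ### From Lagrangian regret to gap and violation -/

section Regret

variable {S A : Type*} [Fintype S] [DecidableEq S] [Fintype A] {M : CMDP S A} {d m : ℕ}
  {π : E d → Policy S A} {φ : Sig → S → E m} {G₁ G₂ μ lam : ℝ} {p : Params} {τ : ℕ}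
  {πs : Policy S A} {εbias : ℝ}

/-- From the Lagrangian regret to the averaged optimality gap and constraint violation. -/
theorem Setup.average_bounds (h : Setup M π φ p G₁ G₂ μ lam τ) (hG₂ : 0 < G₂)
    (hα : p.α = 1 / √p.Tmax) (hβ : p.β = 1 / √p.Tmax) (hδ : 0 < p.δ) (hδ1 : p.δ < 1)
    (hb : BiasBound M π πs p.δ εbias) (hopt : M.IsOptimal πs) (hsl : Slater M π p.δ) (θ₀ : E d)
    {K : ℕ} (hK : 1 ≤ K) {B : ℝ}
    (hB : (M.klFrom πs (π θ₀) + 2 / p.δ ^ 2) / (p.α * K) + epochErr G₁ G₂ μ lam p.cγ p.δ τ *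
        (√εbias + √(epsApp M π φ p.cγ) + 1 / √p.Tmax) ≤ B) :
    (1 / (K : ℝ)) * ∑ k ∈ Finset.range K, ev (algLaw M π φ p θ₀ k)
      (fun x => M.J .r πs - M.J .r (π x.θ)) ≤ B ∧
    (1 / (K : ℝ)) * ∑ k ∈ Finset.range K, ev (algLaw M π φ p θ₀ k)
      (fun x => -M.J .c (π x.θ)) ≤ B := by
  have hT0 : (0 : ℝ) < p.Tmax := by
    have := h.tuned.critic.T_ne
    positivity
  have hα0 : 0 < p.α := by rw [hα]; positivity
  have hK0 : (0 : ℝ) < K := by exact_mod_cast hK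
  have hkl := klFrom_nonneg M πs (h.score.pos θ₀)
  have hR0 : 0 ≤ epochErr G₁ G₂ μ lam p.cγ p.δ τ *
      (√εbias + √(epsApp M π φ p.cγ) + 1 / √p.Tmax) :=
    mul_nonneg (epochErr_nonneg h.G₁_pos hG₂ h.μ_pos h.lam_pos h.cγ_pos hδ) (by positivity)
  have hB0 : 0 ≤ B := le_trans (by positivity) hB
  have hreg : ∀ l₀ ∈ Set.Icc 0 (2 / p.δ), (1 / (K : ℝ)) * ∑ k ∈ Finset.range K,
      ev (algLaw M π φ p θ₀ k)
        (fun x => M.J .r πs - M.J .r (π x.θ) - l₀ * M.J .c (π x.θ)) ≤ B := by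
    intro l₀ hl₀
    have h1 := h.lagrangian_regret hG₂ hα hβ hδ hb hopt.1 θ₀ hl₀ K
    refine le_trans ?_ hB
    generalize epochErr G₁ G₂ μ lam p.cγ p.δ τ *
        (√εbias + √(epsApp M π φ p.cγ) + 1 / √p.Tmax) = R at h1 ⊢
    have h2 : l₀ ^ 2 / 2 ≤ 2 / p.δ ^ 2 := by
      have := pow_le_pow_left₀ hl₀.1 hl₀.2 2
      have e : (2 / p.δ) ^ 2 / 2 = 2 / p.δ ^ 2 := by field_simp
      rw [← e]; linarith
    generalize ∑ k ∈ Finset.range K, ev (algLaw M π φ p θ₀ k)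
        (fun x => M.J .r πs - M.J .r (π x.θ) - l₀ * M.J .c (π x.θ)) = Y at h1 ⊢
    have e1 : 1 / (K : ℝ) * Y = p.α * Y / (p.α * K) := by field_simp
    have e2 : (M.klFrom πs (π θ₀) + 2 / p.δ ^ 2) / (p.α * K) + R =
        (M.klFrom πs (π θ₀) + 2 / p.δ ^ 2 + K * (p.α * R)) / (p.α * K) := by field_simp
    rw [e1, e2]
    exact div_le_div_of_nonneg_right (by linarith) (by positivity)
  refine ⟨by simpa using hreg 0 ⟨le_rfl, by positivity⟩, ?_⟩
  obtain ⟨θb, hθb⟩ := hsl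
  obtain ⟨l, hl0, hl1, hl⟩ := h.ergodic.exists_multiplier hδ hopt hθb
  -- Twice the bound `1/δ` on the multiplier leaves a margin of at least `1/δ ≥ 1` for the
  -- violation.
  have h1 := hreg (2 / p.δ) ⟨by positivity, le_rfl⟩
  have hgap : 1 ≤ 2 / p.δ - l := by
    have e1 : 2 / p.δ = 1 / p.δ + 1 / p.δ := by ring
    have e2 : 1 ≤ 1 / p.δ := by rw [le_div_iff₀ hδ]; linarith
    linarith
  have h2 : (2 / p.δ - l) * ((1 / (K : ℝ)) * ∑ k ∈ Finset.range K, ev (algLaw M π φ p θ₀ k)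
      (fun x => -M.J .c (π x.θ))) ≤ B := by
    refine le_trans ?_ h1
    rw [mul_left_comm, Finset.mul_sum]
    refine mul_le_mul_of_nonneg_left (Finset.sum_le_sum fun k _ => ?_) (by positivity)
    have hF := h.finSupp_algLaw θ₀ k
    rw [← hF.ev_mul]
    refine hF.ev_mono fun x _ => ?_
    have := hl (π x.θ)
    linarith
  -- The margin can be dropped only if the average violation is nonnegative; otherwise the claim is
  -- trivial.
  rcases le_total ((1 / (K : ℝ)) * ∑ k ∈ Finset.range K, ev (algLaw M π φ p θ₀ k)
      (fun x => -M.J .c (π x.θ))) 0 with h0 | h0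
  · exact h0.trans hB0
  · exact le_trans (le_mul_of_one_le_left h0 hgap) h2

end Regret

end PDNAC

end

/-! ### The rates for the prescribed parameters -/

theorem mainTheorem1 (q : ℕ) :
    ∃ p : ℕ, ∀ G₁ G₂ μ lam cγ δ : ℝ,
      0 < G₁ → 0 < G₂ → 0 < μ → 0 < lam → lam + Real.sqrt (1 / lam ^ 2 - 1) ≤ cγ →
      0 < δ → δ < 1 →
    ∃ c₀ : ℝ, 0 < c₀ ∧ ∀ (c₁ D : ℝ) (τ : ℕ), ∃ C : ℝ, 0 < C ∧
    ∀ (S A : Type) [Fintype S] [DecidableEq S] [Fintype A] (d m : ℕ)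
      (M : CMDP S A) (π : E d → Policy S A) (φ : Sig → S → E m)
      (πs : Policy S A) (θ₀ : E d) (εbias : ℝ) (T H : ℕ),
      Slater M π δ →
      M.Ergodic →
      (∀ g s, ‖φ g s‖ ≤ 1) →
      CriticErrFinite M π φ cγ →
      CriticPosDef M π φ lam →
      M.IsOptimal πs →
      BiasBound M π πs δ εbias →
      ScoreBounds π G₁ G₂ →
      FisherNonDeg M π μ →
      tauMix M π = τ →
      M.klFrom πs (π θ₀) ≤ D →
      2 ≤ T →
      c₀ * τ ^ 2 * Real.log T ^ 2 ≤ H →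
      H ≤ c₁ * τ ^ 2 * Real.log T ^ q →
      (horizonParams μ lam cγ δ T H).γξ ≤ lam / (24 * cγ ^ 2 * τ * Real.log T) ∧
      (horizonParams μ lam cγ δ T H).γω ≤
        μ / (4 * (6 * G₁ ^ 4 * τ * Real.log T + 2 * G₁ ^ 2 * τ ^ 2 * Real.log T)) ∧
      (1 / ((T / H : ℕ) : ℝ)) * ∑ k ∈ Finset.range (T / H),
          expect (algLaw M π φ (horizonParams μ lam cγ δ T H) θ₀ k)
            (fun x => M.J .r πs - M.J .r (π x.θ))
        ≤ C * Real.log T ^ p * (√εbias + √(epsApp M π φ cγ) + 1 / √(T : ℝ)) ∧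
      (1 / ((T / H : ℕ) : ℝ)) * ∑ k ∈ Finset.range (T / H),
          expect (algLaw M π φ (horizonParams μ lam cγ δ T H) θ₀ k)
            (fun x => -M.J .c (π x.θ))
        ≤ C * Real.log T ^ p * (√εbias + √(epsApp M π φ cγ) + 1 / √(T : ℝ)) := by
  refine ⟨q, fun G₁ G₂ μ lam cγ δ hG₁ hG₂ hμ hlam hcγ hδ hδ1 => ?_⟩
  have hc : 0 < cγ := by linarith [Real.sqrt_nonneg (1 / lam ^ 2 - 1)]
  refine ⟨loopConst G₁ μ lam cγ, by unfold loopConst; positivity, fun c₁ D τ => ?_⟩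
  have hE := epochErr_nonneg (τ := τ) hG₁ hG₂ hμ hlam hc hδ
  have hlog2 : 0 < Real.log 2 := Real.log_pos (by norm_num)
  -- The first term carries no logarithm, and dividing by `log 2 ^ q` lets it be multiplied by `log
  -- T ^ q`. The second comes from the initial potential, where `H` brings in the power `q`; the 1
  -- gives positivity.
  refine ⟨epochErr G₁ G₂ μ lam cγ δ τ / Real.log 2 ^ q +
    2 * |c₁| * τ ^ 2 * (|D| + 2 / δ ^ 2) + 1, by positivity, ?_⟩
  intro S A _ _ _ d m M π φ πs θ₀ εbias T H hsl herg
    hfeat herr hpd hopt hb hS hF hmix hkl hT hH₀ hH₁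
  have hlog : 0 < Real.log T := hlog2.trans_le (log_two_le_log hT)
  have hT0 : (0 : ℝ) < T := by exact_mod_cast (by lia : 0 < T)
  have hbound0 : 0 ≤ (epochErr G₁ G₂ μ lam cγ δ τ / Real.log 2 ^ q +
      2 * |c₁| * τ ^ 2 * (|D| + 2 / δ ^ 2) + 1) * Real.log T ^ q *
      (√εbias + √(epsApp M π φ cγ) + 1 / √(T : ℝ)) := by positivity
  -- The value `τ = 0` is the default supremum for unbounded mixing times. It forces `H = 0`, so
  -- both step sizes and `T / H` vanish by the conventions for division by zero.
  rcases Nat.eq_zero_or_pos τ with rfl | hτ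
  · have hH : H = 0 := by
      have : (H : ℝ) ≤ 0 := by simpa using hH₁
      exact_mod_cast this.antisymm (Nat.cast_nonneg H)
    subst hH
    refine ⟨by simp [horizonParams], by simp [horizonParams], ?_, ?_⟩ <;>
      simpa using hbound0
  obtain ⟨hs1, hs2⟩ := stepsize_bounds (δ := δ) hG₁ hμ hlam hc hτ hT hH₀
  refine ⟨hs1, hs2, ?_⟩
  rcases Nat.eq_zero_or_pos (T / H) with hK | hK
  · rw [hK]
    constructor <;> simpa using hbound0
  obtain ⟨hH1, hHT⟩ : 1 ≤ H ∧ H ≤ T := Nat.div_pos_iff.mp hK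
  have hset : Setup M π φ (horizonParams μ lam cγ δ T H) G₁ G₂ μ lam τ :=
    ⟨herg, hfeat, hS, hF, hpd, herr, hG₁, hμ, hlam, hcγ, mixTime_le_of_tauMix hmix hτ, hτ,
      tuned_of_large hG₁ hμ hlam hc hτ hT hH1 hHT hH₀⟩
  have hα : (T : ℝ) ^ (-(1 / 2) : ℝ) = 1 / √(T : ℝ) := by
    rw [Real.rpow_neg hT0.le, Real.sqrt_eq_rpow, one_div, one_div]
  refine hset.average_bounds hG₂ hα hα hδ hδ1 hb hopt hsl θ₀ hK ?_
  change (M.klFrom πs (π θ₀) + 2 / δ ^ 2) / ((T : ℝ) ^ (-(1 / 2) : ℝ) * (T / H : ℕ)) +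
    epochErr G₁ G₂ μ lam cγ δ τ * (√εbias + √(epsApp M π φ cγ) + 1 / √(T : ℝ)) ≤ _
  rw [hα]
  have hsq : 0 < √(T : ℝ) := Real.sqrt_pos.mpr hT0
  have hK0 : (0 : ℝ) < (T / H : ℕ) := by exact_mod_cast hK
  -- The floor loses at most a factor 2 since `T / H ≥ 1`. Hence `1/(αK)` is at most `2H/√T`.
  have hTHK : (T : ℝ) ≤ 2 * (H * (T / H : ℕ)) := by
    have h1 : T < H * (T / H + 1) := by
      rw [mul_comm]; exact Nat.lt_mul_of_div_lt (Nat.lt_succ_self _) hH1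
    have h2 : H * (T / H + 1) ≤ 2 * (H * (T / H)) := by nlinarith
    exact_mod_cast h1.le.trans h2
  have hinv : 1 / (1 / √(T : ℝ) * (T / H : ℕ)) ≤ 2 * H * (1 / √(T : ℝ)) := by
    rw [div_le_iff₀ (by positivity)]
    have e : 2 * (H : ℝ) * (1 / √(T : ℝ)) * (1 / √(T : ℝ) * (T / H : ℕ)) =
        2 * (H * (T / H : ℕ)) / T := by
      rw [← Real.sq_sqrt hT0.le, Real.sqrt_sq hsq.le]
      field_simp
    rw [e, le_div_iff₀ hT0]
    linarith
  have hH2 : (H : ℝ) ≤ |c₁| * τ ^ 2 * Real.log T ^ q :=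
    hH₁.trans (by gcongr; exact le_abs_self c₁)
  have hkl' : M.klFrom πs (π θ₀) + 2 / δ ^ 2 ≤ |D| + 2 / δ ^ 2 := by
    linarith [le_abs_self D]
  have hfirst : (M.klFrom πs (π θ₀) + 2 / δ ^ 2) / (1 / √(T : ℝ) * (T / H : ℕ)) ≤
      2 * |c₁| * τ ^ 2 * (|D| + 2 / δ ^ 2) * Real.log T ^ q * (1 / √(T : ℝ)) := by
    rw [div_eq_mul_one_div]
    calc _ ≤ (|D| + 2 / δ ^ 2) * (2 * H * (1 / √(T : ℝ))) := by gcongr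
      _ ≤ (|D| + 2 / δ ^ 2) * (2 * (|c₁| * τ ^ 2 * Real.log T ^ q) * (1 / √(T : ℝ))) := by gcongr
      _ = _ := by ring
  have hpow : 1 ≤ Real.log T ^ q / Real.log 2 ^ q := by
    rw [le_div_iff₀ (by positivity), one_mul]
    exact pow_le_pow_left₀ hlog2.le (log_two_le_log hT) q
  have hu : 1 / √(T : ℝ) ≤ √εbias + √(epsApp M π φ cγ) + 1 / √(T : ℝ) := by
    linarith [Real.sqrt_nonneg εbias, Real.sqrt_nonneg (epsApp M π φ cγ)]
  have hX : 0 ≤ √εbias + √(epsApp M π φ cγ) + 1 / √(T : ℝ) := by positivity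
  generalize √εbias + √(epsApp M π φ cγ) + 1 / √(T : ℝ) = X at hu hX ⊢
  have h1 : 2 * |c₁| * τ ^ 2 * (|D| + 2 / δ ^ 2) * Real.log T ^ q * (1 / √(T : ℝ)) ≤
      2 * |c₁| * τ ^ 2 * (|D| + 2 / δ ^ 2) * Real.log T ^ q * X := by gcongr
  have h2 : epochErr G₁ G₂ μ lam cγ δ τ * X ≤
      epochErr G₁ G₂ μ lam cγ δ τ * X * (Real.log T ^ q / Real.log 2 ^ q) :=
    le_mul_of_one_le_right (mul_nonneg hE hX) hpow
  have h3 : 0 ≤ Real.log T ^ q * X := by positivity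
  calc _ ≤ 2 * |c₁| * τ ^ 2 * (|D| + 2 / δ ^ 2) * Real.log T ^ q * X +
        epochErr G₁ G₂ μ lam cγ δ τ * X * (Real.log T ^ q / Real.log 2 ^ q) +
        Real.log T ^ q * X := by linarith
    _ = _ := by ring
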